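/- **Theorem 3.2.** Let $0<\alpha<1$, let $0=t_0<t_1<t_2<\dots$ be a time mesh, and put $\tau_k=t_k-t_{k-1}$ $(k\ge1)$ and $\rho_k=\tau_k/\tau_{k-1}$ $(k\ge2)$. *Constants.* Let $\rho_*\approx0.356341$ be the positive root of $\rho(1+\rho)=1-3\rho^2(1+\rho)$, let $$\rho^*=\tfrac12\Big[\tfrac{4+3\rho_*}{1+\rho_*}+\sqrt{\big(\tfrac{4+3\rho_*}{1+\rho_*}\big)^2+4\,\tfrac{2+\rho_*}{1+\rho_*}}\,\Big]\approx4.155358,$$ let $\xi_1\approx0.459770$ be the positive root of $\frac{\rho^2(1+\rho)}{1-3\rho^2(1+\rho)}=\rho^*$ and let $\xi_2\approx3.532016$ be the positive root of $\frac{-\rho^2+4\rho+2}{\rho^2-3\rho-1}=\rho^*$. *Assumptions on the mesh.* Assume $$\rho_*<\rho_2,\qquad \rho_*<\rho_3<\rho^*,\qquad 2+\frac{2}{1+\rho_3}+\frac{4\rho_2}{1+\rho_2}-\frac{\rho_2^3}{(1+\rho_2)^2}\ge0,$$ and that for every $k\ge3$ one of the following holds: $$\begin{aligned} &\rho_*<\rho_k<\xi_1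 &&\text{and}\quad \rho_*<\rho_{k+1}\le\frac{\rho_k^2(1+\rho_k)}{1-3\rho_k^2(1+\rho_k)},\\ &\xi_1\le\rho_k\le\xi_2 &&\text{and}\quad \rho_*<\rho_{k+1}<\rho^*,\\ &\xi_2<\rho_k<\rho^* &&\text{and}\quad \rho_*<\rho_{k+1}\le\frac{-\rho_k^2+4\rho_k+2}{\rho_k^2-3\rho_k-1}. \end{aligned}$$ *The operator.* For nodal values $u^0,u^1,\dots$ let $H_2^j$ $(j\ge1)$ be the quadratic polynomial with $H_2^j(t_i)=u^i$ for $i=j-1,j,j+1$. Put $L_1^\alpha u=\dfrac{u^1-u^0}{\Gamma(2-\alpha)\tau_1^\alpha}$ and, for $k\ge2$, $$L_k^\alpha u=\frac1{\Gamma(1-\alpha)}\Big(\sum_{j=1}^{k-1}\int_{t_{j-1}}^{t_j}\frac{\partial_sH_2^j(s)}{(t_k-s)^\alpha}\,ds+\int_{t_{k-1}}^{t_k}\frac{\partial_sH_2^{k-1}(s)}{(t_k-s)^\alpha}\,ds\Big).$$ *The weights.* For $1\le j\le k-1$ let $$a_j^k=\int_{t_{j-1}}^{t_j}\frac{2s-t_j-t_{j+1}}{\tau_j(\tau_j+\tau_{j+1})}\frac{ds}{(t_k-s)^\alpha},\qquad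 c_j^k=\int_{t_{j-1}}^{t_j}\frac{2s-t_{j-1}-t_j}{\tau_{j+1}(\tau_j+\tau_{j+1})}\frac{ds}{(t_k-s)^\alpha},$$ let $$a_k^k=\int_{t_{k-1}}^{t_k}\frac{2s-t_{k-1}-t_k}{\tau_{k-1}(\tau_{k-1}+\tau_k)}\frac{ds}{(t_k-s)^\alpha},\qquad c_k^k=\int_{t_{k-1}}^{t_k}\frac{2s-t_{k-2}-t_{k-1}}{\tau_k(\tau_{k-1}+\tau_k)}\frac{ds}{(t_k-s)^\alpha}\qquad(k\ge2),$$ and $d_j^k=c_{j-1}^k-a_j^k$. Let $C$ be the symmetric $2\times2$ matrix with $$C_{11}=\frac{2\tau_1^{-\alpha}}{1-\alpha}+a_1^2,\qquad C_{12}=C_{21}=-a_2^2,\qquad C_{22}=2c_1^2+2c_2^2-(d_2^3+a_1^3-a_1^2)-a_3^3,$$ and let $$\hat g(\alpha)=\tfrac12\Big(C_{11}+C_{22}-\sqrt{(C_{11}-C_{22})^2+4C_{12}C_{21}}\Big)$$ be its smaller eigenvalue. For $n\ge2$ and $1\le k\le n$ put $$g_k(\alpha)=\begin{cases} (2-\alpha)(1-\alpha)\,\hat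 g(\alpha), & k=1,2,\\[4pt] \dfrac{\alpha}{\tau_k^\alpha}\Big(\dfrac{(1+\alpha)(2-\alpha)}{\alpha}+\dfrac{\rho_{k+1}-1+\alpha}{(1+\rho_{k+1})^\alpha}-\dfrac{2\rho_{k+1}^{2-\alpha}}{1+\rho_{k+1}}-\dfrac{\rho_k(\rho_k-2)}{1+\rho_k}\Big), & 3\le k\le n-1,\\[8pt] \dfrac{\alpha}{\tau_n^\alpha}\Big(\dfrac{(1+\alpha)(2-\alpha)}{\alpha}-\dfrac{\rho_n(\rho_n-2)}{1+\rho_n}\Big), & k=n\ne2. \end{cases}$$ *Conclusion.* For every $n\ge2$ the weights $g_1(\alpha),\dots,g_n(\alpha)$ are positive. Moreover, for every measurable $\Omega\subseteq\mathbb R^d$ and every real function $u$ of time and of $x\in\Omega$ such that $u^k=u(t_k,\cdot)\in L^2(\Omega)$ for $0\le k\le n$, with $\delta_ku=u^k-u^{k-1}$ and with the inner product of $L^2(\Omega)$, $$\mathcal B_n(u,u)=\sum_{k=1}^n\langle L_k^\alpha u,\delta_ku\rangle\ \ge\ \sum_{k=1}^n\frac{g_k(\alpha)}{2\Gamma(3-\alpha)}\,\|\delta_ku\|_{L^2(\Omega)}^2\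 \ge\ 0.$$ -/

import Mathlib

open MeasureTheory

/-- The equation defining `rhoLow` has exactly one positive root. -/
theorem existsUnique_rhoLow :
    ∃! r : ℝ, 0 < r ∧ r * (1 + r) = 1 - 3 * r ^ 2 * (1 + r) := by
  have hc : ContinuousOn (fun r : ℝ => r * (1 + r) + 3 * r ^ 2 * (1 + r)) (Set.Icc 0 1) := by
    fun_prop
  obtain ⟨r, hr, h⟩ := intermediate_value_Icc (by norm_num : (0 : ℝ) ≤ 1) hc
    (show (1 : ℝ) ∈ Set.Icc _ _ by constructor <;> norm_num)
  simp only at h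
  have hr0 : 0 < r := by
    rcases hr.1.eq_or_lt with h0 | h0
    · subst h0
      norm_num at h
    · exact h0
  refine ⟨r, ⟨hr0, by linarith⟩, ?_⟩
  rintro s ⟨hs0, hs⟩
  have hp : 0 < 1 + 4 * (s + r) + 3 * (s ^ 2 + s * r + r ^ 2) := by positivity
  have : (s - r) * (1 + 4 * (s + r) + 3 * (s ^ 2 + s * r + r ^ 2)) = 0 := by nlinarith
  rcases mul_eq_zero.mp this with h1 | h1
  · linarith
  · exact absurd h1 hp.ne'

/-- `ρ_*`: the positive root of `ρ (1 + ρ) = 1 - 3 ρ² (1 + ρ)`, about `0.356341`. -/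
noncomputable def rhoLow : ℝ := existsUnique_rhoLow.exists.choose

theorem rhoLow_spec :
    0 < rhoLow ∧ rhoLow * (1 + rhoLow) = 1 - 3 * rhoLow ^ 2 * (1 + rhoLow) :=
  existsUnique_rhoLow.exists.choose_spec

/-- `ρ^*`, about `4.155358`. -/
noncomputable def rhoHigh : ℝ :=
  1 / 2 * ((4 + 3 * rhoLow) / (1 + rhoLow)
    + Real.sqrt (((4 + 3 * rhoLow) / (1 + rhoLow)) ^ 2 + 4 * ((2 + rhoLow) / (1 + rhoLow))))

theorem rhoHigh_pos : 0 < rhoHigh := by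
  have := rhoLow_spec.1
  unfold rhoHigh
  positivity

/-- The equation defining `xiLow` has exactly one positive root. -/
theorem existsUnique_xiLow :
    ∃! r : ℝ, 0 < r ∧ r ^ 2 * (1 + r) / (1 - 3 * r ^ 2 * (1 + r)) = rhoHigh := by
  have hR := rhoHigh_pos
  set R := rhoHigh
  have key : ∀ r : ℝ, r ^ 2 * (1 + r) / (1 - 3 * r ^ 2 * (1 + r)) = R ↔
      (1 + 3 * R) * (r ^ 2 * (1 + r)) = R := by
    intro r
    constructor
    · intro h
      have hne : 1 - 3 * r ^ 2 * (1 + r) ≠ 0 := by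
        intro h0
        rw [h0, div_zero] at h
        exact hR.ne h
      rw [div_eq_iff hne] at h
      linarith
    · intro h
      have hne : 1 - 3 * r ^ 2 * (1 + r) ≠ 0 := by
        intro h0
        have h1 : r ^ 2 * (1 + r) = 1 / 3 := by linarith
        rw [h1] at h
        linarith
      rw [div_eq_iff hne]
      linarith
  have hc : ContinuousOn (fun r : ℝ => (1 + 3 * R) * (r ^ 2 * (1 + r))) (Set.Icc 0 1) := by
    fun_prop
  obtain ⟨r, hr, h⟩ := intermediate_value_Icc (by norm_num : (0 : ℝ) ≤ 1) hc
    (show R ∈ Set.Icc _ _ by constructor <;> norm_num <;> linarith)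
  simp only at h
  have hr0 : 0 < r := by
    rcases hr.1.eq_or_lt with h0 | h0
    · subst h0
      norm_num at h
      exact absurd h hR.ne
    · exact h0
  refine ⟨r, ⟨hr0, (key r).2 h⟩, ?_⟩
  rintro s ⟨hs0, hs⟩
  rw [key] at hs
  have he : s ^ 2 * (1 + s) = r ^ 2 * (1 + r) :=
    mul_left_cancel₀ (by positivity : (1 + 3 * R) ≠ 0) (hs.trans h.symm)
  have hp : 0 < (s + r) + (s ^ 2 + s * r + r ^ 2) := by positivity
  have : (s - r) * ((s + r) + (s ^ 2 + s * r + r ^ 2)) = 0 := by nlinarith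
  rcases mul_eq_zero.mp this with h1 | h1
  · linarith
  · exact absurd h1 hp.ne'

/-- `ξ₁`: the positive root of `ρ² (1 + ρ) / (1 - 3 ρ² (1 + ρ)) = ρ^*`, about `0.459770`. -/
noncomputable def xiLow : ℝ := existsUnique_xiLow.exists.choose

theorem xiLow_spec :
    0 < xiLow ∧ xiLow ^ 2 * (1 + xiLow) / (1 - 3 * xiLow ^ 2 * (1 + xiLow)) = rhoHigh :=
  existsUnique_xiLow.exists.choose_spec

/-- The equation defining `xiHigh` has exactly one positive root. -/
theorem existsUnique_xiHigh :
    ∃! r : ℝ, 0 < r ∧ (-r ^ 2 + 4 * r + 2) / (r ^ 2 - 3 * r - 1) = rhoHigh := by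
  have hR := rhoHigh_pos
  set R := rhoHigh
  have key : ∀ r : ℝ, 0 < r → ((-r ^ 2 + 4 * r + 2) / (r ^ 2 - 3 * r - 1) = R ↔
      (1 + R) * r ^ 2 - (4 + 3 * R) * r = 2 + R) := by
    intro r hr
    constructor
    · intro h
      have hne : r ^ 2 - 3 * r - 1 ≠ 0 := by
        intro h0
        rw [h0, div_zero] at h
        exact hR.ne h
      rw [div_eq_iff hne] at h
      linarith
    · intro h
      have hne : r ^ 2 - 3 * r - 1 ≠ 0 := by
        intro h0
        have h1 : r ^ 2 = 3 * r + 1 := by linarith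
        rw [h1] at h
        linarith
      rw [div_eq_iff hne]
      linarith
  have hc : ContinuousOn (fun r : ℝ => (1 + R) * r ^ 2 - (4 + 3 * R) * r) (Set.Icc 0 6) := by
    fun_prop
  obtain ⟨r, hr, h⟩ := intermediate_value_Icc (by norm_num : (0 : ℝ) ≤ 6) hc
    (show 2 + R ∈ Set.Icc _ _ by constructor <;> norm_num <;> linarith)
  simp only at h
  have hr0 : 0 < r := by
    rcases hr.1.eq_or_lt with h0 | h0
    · subst h0
      norm_num at h
      linarith
    · exact h0
  refine ⟨r, ⟨hr0, (key r hr0).2 h⟩, ?_⟩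
  rintro s ⟨hs0, hs⟩
  rw [key s hs0] at hs
  have hr1 : 0 < (1 + R) * r - (4 + 3 * R) := by
    by_contra hcon
    have h2 : r * ((1 + R) * r - (4 + 3 * R)) ≤ 0 :=
      mul_nonpos_of_nonneg_of_nonpos hr0.le (not_lt.mp hcon)
    nlinarith
  have hp : 0 < (1 + R) * s + ((1 + R) * r - (4 + 3 * R)) := by positivity
  have : (s - r) * ((1 + R) * s + ((1 + R) * r - (4 + 3 * R))) = 0 := by linarith
  rcases mul_eq_zero.mp this with h1 | h1
  · linarith
  · exact absurd h1 hp.ne'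

/-- `ξ₂`: the positive root of `(-ρ² + 4 ρ + 2) / (ρ² - 3 ρ - 1) = ρ^*`, about `3.532016`. -/
noncomputable def xiHigh : ℝ := existsUnique_xiHigh.exists.choose

theorem xiHigh_spec :
    0 < xiHigh ∧ (-xiHigh ^ 2 + 4 * xiHigh + 2) / (xiHigh ^ 2 - 3 * xiHigh - 1) = rhoHigh :=
  existsUnique_xiHigh.exists.choose_spec

/-- Time steps `τ_k = t_k - t_{k-1}`, used for `k ≥ 1`. -/
def timeStep (t : ℕ → ℝ) (k : ℕ) : ℝ := t k - t (k - 1)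

/-- Step ratios `ρ_k = τ_k / τ_{k-1}`, used for `k ≥ 2`. -/
noncomputable def stepRatio (t : ℕ → ℝ) (k : ℕ) : ℝ := timeStep t k / timeStep t (k - 1)

/-- The constraint on the first two step ratios `(ρ₂, ρ₃) = (r, s)`. -/
def FirstRatioCond (r s : ℝ) : Prop :=
  rhoLow < r ∧ rhoLow < s ∧ s < rhoHigh ∧
    0 ≤ 2 + 2 / (1 + s) + 4 * r / (1 + r) - r ^ 3 / (1 + r) ^ 2

/-- The constraint on two later consecutive step ratios `(ρ_k, ρ_{k+1}) = (r, s)`, `k ≥ 3`: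
`r` lies in one of three ranges, and `s` satisfies the bounds that belong to this range. -/
def RatioCond (r s : ℝ) : Prop :=
  (rhoLow < r ∧ r < xiLow ∧ rhoLow < s ∧ s ≤ r ^ 2 * (1 + r) / (1 - 3 * r ^ 2 * (1 + r))) ∨
  (xiLow ≤ r ∧ r ≤ xiHigh ∧ rhoLow < s ∧ s < rhoHigh) ∨
  (xiHigh < r ∧ r < rhoHigh ∧ rhoLow < s ∧ s ≤ (-r ^ 2 + 4 * r + 2) / (r ^ 2 - 3 * r - 1))

/-- The quadratic Lagrange polynomial `H₂ʲ` that interpolates the nodal values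
`v_{j-1}, v_j, v_{j+1}` at `t_{j-1}, t_j, t_{j+1}`, for `j ≥ 1`. -/
noncomputable def quadInterp (t v : ℕ → ℝ) (j : ℕ) (s : ℝ) : ℝ :=
  (s - t j) * (s - t (j + 1)) / ((t (j - 1) - t j) * (t (j - 1) - t (j + 1))) * v (j - 1)
  + (s - t (j - 1)) * (s - t (j + 1)) / ((t j - t (j - 1)) * (t j - t (j + 1))) * v j
  + (s - t (j - 1)) * (s - t j) / ((t (j + 1) - t (j - 1)) * (t (j + 1) - t j)) * v (j + 1)

/-- The L2 fractional-derivative operator `L_k^α` (`k ≥ 1`) on a sequence of nodal values. -/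
noncomputable def fracL2 (α : ℝ) (t v : ℕ → ℝ) (k : ℕ) : ℝ :=
  if k = 1 then (v 1 - v 0) / (Real.Gamma (2 - α) * timeStep t 1 ^ α)
  else 1 / Real.Gamma (1 - α) *
    ((∑ j ∈ Finset.Icc 1 (k - 1),
        ∫ s in (t (j - 1))..(t j), deriv (quadInterp t v j) s / (t k - s) ^ α)
      + ∫ s in (t (k - 1))..(t k), deriv (quadInterp t v (k - 1)) s / (t k - s) ^ α)

/-- The bilinear form `B_n(v, w) = ∑_{k=1}^n ⟨L_k^α v, δ_k w⟩` with the inner product of `L²(Ω)`,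
where `v^k = v(t_k, ·)` and `δ_k w = w^k - w^{k-1}`. -/
noncomputable def bilinB (α : ℝ) (t : ℕ → ℝ) {d : ℕ} (Ω : Set (EuclideanSpace ℝ (Fin d))) (n : ℕ)
    (v w : ℝ → EuclideanSpace ℝ (Fin d) → ℝ) : ℝ :=
  ∑ k ∈ Finset.Icc 1 n,
    ∫ x in Ω, fracL2 α t (fun i => v (t i) x) k * (w (t k) x - w (t (k - 1)) x)

/-- The coefficients `a_j^k`, `1 ≤ j ≤ k`. -/
noncomputable def coeffA (α : ℝ) (t : ℕ → ℝ) (k j : ℕ) : ℝ :=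
  if j = k then
    ∫ s in (t (k - 1))..(t k),
      (2 * s - t (k - 1) - t k) / (timeStep t (k - 1) * (timeStep t (k - 1) + timeStep t k))
        * (1 / (t k - s) ^ α)
  else
    ∫ s in (t (j - 1))..(t j),
      (2 * s - t j - t (j + 1)) / (timeStep t j * (timeStep t j + timeStep t (j + 1)))
        * (1 / (t k - s) ^ α)

/-- The coefficients `c_j^k`, `1 ≤ j ≤ k`. -/
noncomputable def coeffC (α : ℝ) (t : ℕ → ℝ) (k j : ℕ) : ℝ :=
  if j = k then
    ∫ s in (t (k - 1))..(t k),
      (2 * s - t (k - 2) - t (k - 1)) / (timeStep t k * (timeStep t (k - 1) + timeStep t k))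
        * (1 / (t k - s) ^ α)
  else
    ∫ s in (t (j - 1))..(t j),
      (2 * s - t (j - 1) - t j) / (timeStep t (j + 1) * (timeStep t j + timeStep t (j + 1)))
        * (1 / (t k - s) ^ α)

/-- `d_j^k = c_{j-1}^k - a_j^k`. -/
noncomputable def coeffD (α : ℝ) (t : ℕ → ℝ) (k j : ℕ) : ℝ :=
  coeffC α t k (j - 1) - coeffA α t k j

/-- The symmetric `2 × 2` matrix `C` with entries
`C₁₁ = 2 (1-α)⁻¹ τ₁^{-α} - 2 β₁`, `C₁₂ = C₂₁ = -a_2^2`, `C₂₂ = 2 c_1^2 + 2 c_2^2 - 2 β₂ - a_3^3`,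
where `2 β₁ = -a_1^2` and `2 β₂ = d_2^3 + a_1^3 - a_1^2`. -/
noncomputable def matC (α : ℝ) (t : ℕ → ℝ) : Matrix (Fin 2) (Fin 2) ℝ :=
  !![2 * (1 - α)⁻¹ * timeStep t 1 ^ (-α) - -coeffA α t 2 1, -coeffA α t 2 2;
     -coeffA α t 2 2,
     2 * coeffC α t 2 1 + 2 * coeffC α t 2 2
       - (coeffD α t 3 2 + coeffA α t 3 1 - coeffA α t 2 1) - coeffA α t 3 3]

/-- `ĝ(α)`: the smaller eigenvalue of `C`. -/
noncomputable def gHat (α : ℝ) (t : ℕ → ℝ) : ℝ :=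
  (matC α t 0 0 + matC α t 1 1
    - Real.sqrt ((matC α t 0 0 - matC α t 1 1) ^ 2 + 4 * (matC α t 0 1 * matC α t 1 0))) / 2

/-- The weights `g_k(α)` for `1 ≤ k ≤ n`, `n ≥ 2`. -/
noncomputable def gWeight (α : ℝ) (t : ℕ → ℝ) (n k : ℕ) : ℝ :=
  if k ≤ 2 then (2 - α) * (1 - α) * gHat α t
  else if k < n then
    α / timeStep t k ^ α *
      ((1 + α) * (2 - α) / α
        + (stepRatio t (k + 1) - 1 + α) / (1 + stepRatio t (k + 1)) ^ α
        - 2 * stepRatio t (k + 1) ^ (2 - α) / (1 + stepRatio t (k + 1))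
        - stepRatio t k * (stepRatio t k - 2) / (1 + stepRatio t k))
  else
    α / timeStep t k ^ α *
      ((1 + α) * (2 - α) / α - stepRatio t k * (stepRatio t k - 2) / (1 + stepRatio t k))

/-! The estimate is pointwise in x: it is an inequality for the real sequence v_k = u(t_k, x),
integrated over Ω at the end. For such a sequence Γ(1-α) L_k v is a combination of increments δ_j: a
diagonal term, a term -a_k^k δ_{k-1} due to the parabola reused on the last interval, and a history
∑_{j<k} S_{k,j} δ_j with S = `histCoeff` (`gamma_mul_fracL2`). Twice Γ(1-α) times the whole form is
`lowerForm`.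

History. Abel summation replaces S by its increments in j, polarisation turns the products into
squares (v_k - v_i)², and the sum over k telescopes (`incrForm_step`). What is thrown away is
nonnegative as soon as the increments of S in j are nonnegative and decrease in k. These are one
statement: S_{k,j} is a linear functional `histFun` of the kernel, so both concern J(s) =
(T₁-s)^(-α) - θ (T₂-s)^(-α) with θ = 0 or θ = 1, which is nonnegative, nondecreasing and convex.
Comparing J with its tangent at a node leaves a cubic inequality between step lengths, true because
all ratios exceed ρ_* (`histFun_incr_nonneg`).

Diagonal. From k = 3 on, the product a_k^k δ_k δ_{k-1} is split evenly between the two squares. The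
remaining coefficient of δ_k² (`lastRow`, `innerRow`), multiplied by (1-α)(2-α), is at least g_k
plus the same multiple of a functional `rowFun` of J. For k ≥ 4 the tangent comparison gives
`rowFun` ≥ 0, by the upper bound on the next ratio attached to small ratios. For k = 3 the pair (ρ₂,
ρ₃) is not constrained in this way, and the possible deficit is paid by two squares saved from the
telescoping (`third_row_nonneg`). The bound attached to large ratios gives g_k > 0
(`gWeight_pos_of_ratioCond`).

The first two increments keep their cross term and form the matrix C. Positivity of its smaller
eigenvalue comes from a determinant inequality (`det_bound`), whose non-strict limit as α → 1 is
precisely the assumption on (ρ₂, ρ₃). -/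

/-! ### Interpolation weights tested against monotone and convex functions -/

theorem integral_centered {l r : ℝ} : ∫ s in l..r, (2 * s - l - r) = 0 := by
  have : ∀ s ∈ Set.uIcc l r, HasDerivAt (fun s : ℝ => s ^ 2 - l * s - r * s) (2 * s - l - r) s := by
    intro s _
    refine ((((hasDerivAt_id s).pow 2).sub ((hasDerivAt_id s).const_mul l)).sub
      ((hasDerivAt_id s).const_mul r)).congr_deriv ?_
    simp
  rw [intervalIntegral.integral_eq_sub_of_hasDerivAt this (by apply Continuous.intervalIntegrable; fun_prop)]
  ring

theorem integral_linear_mul_linear {l r a b c d : ℝ} :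
    ∫ s in l..r, (a * s + b) * (c * s + d) =
      a * c * (r ^ 3 - l ^ 3) / 3 + (a * d + b * c) * (r ^ 2 - l ^ 2) / 2 + b * d * (r - l) := by
  have : ∀ s ∈ Set.uIcc l r, HasDerivAt
      (fun s : ℝ => a * c / 3 * s ^ 3 + (a * d + b * c) / 2 * s ^ 2 + b * d * s)
      ((a * s + b) * (c * s + d)) s := by
    intro s _
    refine (((((hasDerivAt_id s).pow 3).const_mul (a * c / 3)).add
      (((hasDerivAt_id s).pow 2).const_mul ((a * d + b * c) / 2))).add
      ((hasDerivAt_id s).const_mul (b * d))).congr_deriv ?_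
    simp
    ring
  rw [intervalIntegral.integral_eq_sub_of_hasDerivAt this (by apply Continuous.intervalIntegrable; fun_prop)]
  ring

theorem MonotoneOn.intervalIntegrable_linear_mul {l r : ℝ} (hlr : l ≤ r) {G : ℝ → ℝ}
    (hG : MonotoneOn G (Set.Icc l r)) (a b : ℝ) :
    IntervalIntegrable (fun s => (a * s + b) * G s) volume l r := by
  have h : IntervalIntegrable G volume l r := by
    apply MonotoneOn.intervalIntegrable
    rwa [Set.uIcc_of_le hlr]
  exact h.continuousOn_mul (by fun_prop)

/-- Chebyshev's inequality for a centred linear weight. -/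
theorem integral_centered_mul_nonneg {l r : ℝ} (hlr : l ≤ r) {G : ℝ → ℝ}
    (hG : MonotoneOn G (Set.Icc l r)) : 0 ≤ ∫ s in l..r, (2 * s - l - r) * G s := by
  set M := (l + r) / 2 with hM
  have hMm : M ∈ Set.Icc l r := ⟨by rw [hM]; linarith, by rw [hM]; linarith⟩
  have hi : IntervalIntegrable (fun s => (2 * s - l - r) * G s) volume l r := by
    have := hG.intervalIntegrable_linear_mul hlr 2 (-l - r)
    convert this using 3
    ring
  have h0 : ∫ s in l..r, (2 * s - l - r) * G M = 0 := by
    rw [intervalIntegral.integral_mul_const, integral_centered, zero_mul]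
  have : ∫ s in l..r, (2 * s - l - r) * G s
      = ∫ s in l..r, ((2 * s - l - r) * G s - (2 * s - l - r) * G M) := by
    rw [intervalIntegral.integral_sub hi (by apply Continuous.intervalIntegrable; fun_prop), h0, sub_zero]
  rw [this]
  apply intervalIntegral.integral_nonneg hlr
  intro s hs
  rw [← mul_sub]
  rcases le_total s M with h | h
  · exact mul_nonneg_of_nonpos_of_nonpos (by linarith) (by linarith [hG hs hMm h])
  · exact mul_nonneg (by linarith) (by linarith [hG hMm hs h])

/-- The integral of `J` over `[x, y]` against the weight of the left node of the quadratic
interpolation at `x < y < z`. -/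
noncomputable def leftWeight (x y z : ℝ) (J : ℝ → ℝ) : ℝ :=
  ∫ s in x..y, (2 * s - y - z) / ((y - x) * (z - x)) * J s

/-- The integral of `J` over `[x, y]` against the weight of the right node of the quadratic
interpolation at `x < y < z`. -/
noncomputable def rightWeight (x y z : ℝ) (J : ℝ → ℝ) : ℝ :=
  ∫ s in x..y, (2 * s - x - y) / ((z - y) * (z - x)) * J s

theorem rightWeight_eq (x y z : ℝ) (J : ℝ → ℝ) :
    rightWeight x y z J = (∫ s in x..y, (2 * s - x - y) * J s) / ((z - y) * (z - x)) := by
  unfold rightWeight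
  rw [← intervalIntegral.integral_div]
  congr 1; ext s; ring

theorem leftWeight_eq (x y z : ℝ) (J : ℝ → ℝ) :
    leftWeight x y z J = (∫ s in x..y, (2 * s - y - z) * J s) / ((y - x) * (z - x)) := by
  unfold leftWeight
  rw [← intervalIntegral.integral_div]
  congr 1; ext s; ring

/-- The weight is increasing with mean zero on [x, y], so constants are invisible and Chebyshev's
inequality needs only the growth of G - F, not its sign. -/
theorem rightWeight_mono {x y z : ℝ} (hxy : x < y) (hyz : y < z) {F G : ℝ → ℝ}
    (hF : IntervalIntegrable F volume x y) (hG : IntervalIntegrable G volume x y)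
    (h : MonotoneOn (fun s => G s - F s) (Set.Icc x y)) :
    rightWeight x y z F ≤ rightWeight x y z G := by
  rw [rightWeight_eq, rightWeight_eq]
  have h1 : 0 < (z - y) * (z - x) := mul_pos (by linarith) (by linarith)
  apply div_le_div_of_nonneg_right _ h1.le
  have := integral_centered_mul_nonneg hxy.le h
  have h2 : ∫ s in x..y, (2 * s - x - y) * (G s - F s)
      = (∫ s in x..y, (2 * s - x - y) * G s) - ∫ s in x..y, (2 * s - x - y) * F s := by
    rw [← intervalIntegral.integral_sub]
    · congr 1; ext s; ring
    · exact hG.continuousOn_mul (by fun_prop)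
    · exact hF.continuousOn_mul (by fun_prop)
  linarith

theorem rightWeight_linear {x y z : ℝ} (m : ℝ) :
    rightWeight x y z (fun s => m * s) = m * (y - x) ^ 3 / (6 * ((z - y) * (z - x))) := by
  rw [rightWeight_eq]
  have : ∫ s in x..y, (2 * s - x - y) * (m * s) = m * (y - x) ^ 3 / 6 := by
    have := @integral_linear_mul_linear x y 2 (-x - y) m 0
    rw [show (fun s : ℝ => (2 * s - x - y) * (m * s)) =
      fun s => (2 * s + (-x - y)) * (m * s + 0) by ext s; ring, this]
    ring
  rw [this, div_div]

theorem rightWeight_ge {x y z m : ℝ} (hxy : x < y) (hyz : y < z) {J : ℝ → ℝ}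
    (hJ : IntervalIntegrable J volume x y)
    (h : MonotoneOn (fun s => J s - m * s) (Set.Icc x y)) :
    m * (y - x) ^ 3 / (6 * ((z - y) * (z - x))) ≤ rightWeight x y z J := by
  rw [← rightWeight_linear]
  exact rightWeight_mono hxy hyz (by apply Continuous.intervalIntegrable; fun_prop) hJ h

theorem rightWeight_le {x y z m : ℝ} (hxy : x < y) (hyz : y < z) {J : ℝ → ℝ}
    (hJ : IntervalIntegrable J volume x y)
    (h : AntitoneOn (fun s => J s - m * s) (Set.Icc x y)) :
    rightWeight x y z J ≤ m * (y - x) ^ 3 / (6 * ((z - y) * (z - x))) := by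
  rw [← rightWeight_linear]
  refine rightWeight_mono hxy hyz hJ (by apply Continuous.intervalIntegrable; fun_prop) ?_
  intro a ha b hb hab
  have := h ha hb hab
  simp only at this ⊢
  linarith

/-- The weight is nonpositive on [x, y], hence the reversed order. -/
theorem leftWeight_mono {x y z : ℝ} (hxy : x < y) (hyz : y < z) {F G : ℝ → ℝ}
    (hF : IntervalIntegrable F volume x y) (hG : IntervalIntegrable G volume x y)
    (h : ∀ s ∈ Set.Icc x y, F s ≤ G s) :
    leftWeight x y z G ≤ leftWeight x y z F := by
  unfold leftWeight
  have h1 : 0 < (y - x) * (z - x) := mul_pos (by linarith) (by linarith)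
  apply intervalIntegral.integral_mono_on hxy.le
  · exact hG.continuousOn_mul (by fun_prop)
  · exact hF.continuousOn_mul (by fun_prop)
  · intro s hs
    apply mul_le_mul_of_nonpos_left (h s hs)
    apply div_nonpos_of_nonpos_of_nonneg _ h1.le
    linarith [hs.2]

theorem leftWeight_affine {x y z : ℝ} (hxy : x < y) (hyz : y < z) (m b : ℝ) :
    leftWeight x y z (fun s => m * s + b) =
      -(m * x + b) - m * ((y - x) * (2 * (y - x) + 3 * (z - y)) / (6 * (z - x))) := by
  rw [leftWeight_eq]
  have : ∫ s in x..y, (2 * s - y - z) * (m * s + b) =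
      -(m * x + b) * ((y - x) * (z - x)) - m * ((y - x) ^ 2 * (2 * (y - x) + 3 * (z - y)) / 6) := by
    have := @integral_linear_mul_linear x y 2 (-y - z) m b
    rw [show (fun s : ℝ => (2 * s - y - z) * (m * s + b)) =
      fun s => (2 * s + (-y - z)) * (m * s + b) by ext s; ring, this]
    ring
  rw [this]
  have h1 : y - x ≠ 0 := by linarith
  have h2 : z - x ≠ 0 := by linarith
  field_simp

/-- The left weight is nonpositive with integral -1, so the right-hand side averages J(y) - J(s)
against a probability density; J grows with slope at least m. -/
theorem leftWeight_add_right_ge {x y z m : ℝ} (hxy : x < y) (hyz : y < z) {J : ℝ → ℝ}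
    (hJ : IntervalIntegrable J volume x y)
    (h : MonotoneOn (fun s => J s - m * s) (Set.Icc x y)) :
    m * ((y - x) * (4 * (y - x) + 3 * (z - y)) / (6 * (z - x))) ≤ leftWeight x y z J + J y := by
  have h1 := leftWeight_mono hxy hyz hJ (G := fun s => m * s + (J y - m * y))
    (by apply Continuous.intervalIntegrable; fun_prop) (fun s hs => by
      have := h hs (Set.right_mem_Icc.2 hxy.le) hs.2
      simp only at this
      linarith)
  rw [leftWeight_affine hxy hyz] at h1
  have h2 : z - x ≠ 0 := by linarith
  have h3 : m * ((y - x) * (4 * (y - x) + 3 * (z - y)) / (6 * (z - x))) =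
      m * (y - x) - m * ((y - x) * (2 * (y - x) + 3 * (z - y)) / (6 * (z - x))) := by
    field_simp
    ring
  linarith

theorem neg_leftWeight_ge {x y z m : ℝ} (hxy : x < y) (hyz : y < z) {J : ℝ → ℝ}
    (hJ : IntervalIntegrable J volume x y)
    (h : MonotoneOn (fun s => J s - m * s) (Set.Icc x y)) :
    J x + m * ((y - x) * (2 * (y - x) + 3 * (z - y)) / (6 * (z - x))) ≤ -leftWeight x y z J := by
  have h1 := leftWeight_mono hxy hyz (F := fun s => m * s + (J x - m * x))
    (by apply Continuous.intervalIntegrable; fun_prop) hJ (fun s hs => by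
      have := h (Set.left_mem_Icc.2 hxy.le) hs hs.1
      simp only at this
      linarith)
  rw [leftWeight_affine hxy hyz] at h1
  linarith

/-- Meant for convex J with m = J'(x): its slope is at most m on [w, x] and at least m on [x, y].
Each of the three weights is compared with its value at a function of slope m, for which equality
holds. -/
theorem interp_weights_ge {w x y z m : ℝ} (hwx : w < x) (hxy : x < y) (hyz : y < z)
    {J : ℝ → ℝ} (hJ₁ : IntervalIntegrable J volume w x)
    (hJ₂ : IntervalIntegrable J volume x y)
    (h₁ : AntitoneOn (fun s => J s - m * s) (Set.Icc w x))
    (h₂ : MonotoneOn (fun s => J s - m * s) (Set.Icc x y)) :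
    m / 6 * (3 * (y - x) + (y - x) ^ 2 / (z - y) - (x - w) ^ 3 / ((y - x) * (y - w))) ≤
      rightWeight x y z J - rightWeight w x y J + (leftWeight x y z J + J y) := by
  have e1 := rightWeight_ge hxy hyz hJ₂ h₂
  have e2 := rightWeight_le hwx hxy hJ₁ h₁
  have e3 := leftWeight_add_right_ge hxy hyz hJ₂ h₂
  have n1 : z - y ≠ 0 := by linarith
  have n2 : z - x ≠ 0 := by linarith
  have n3 : y - x ≠ 0 := by linarith
  have n4 : y - w ≠ 0 := by linarith
  have key : m / 6 * (3 * (y - x) + (y - x) ^ 2 / (z - y) - (x - w) ^ 3 / ((y - x) * (y - w))) =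
      m * (y - x) ^ 3 / (6 * ((z - y) * (z - x))) - m * (x - w) ^ 3 / (6 * ((y - x) * (y - w)))
      + m * ((y - x) * (4 * (y - x) + 3 * (z - y)) / (6 * (z - x))) := by
    field_simp
    ring
  rw [key]
  linarith

/-! ### The mixed kernel: sign, monotonicity, convexity -/

/-- A mixture of the kernels `(T₁ - s) ^ (-α)` and `(T₂ - s) ^ (-α)`. -/
noncomputable def kerMix (α θ T₁ T₂ s : ℝ) : ℝ := (T₁ - s) ^ (-α) - θ * (T₂ - s) ^ (-α)

/-- The derivative of `kerMix`. -/
noncomputable def kerMixDeriv (α θ T₁ T₂ s : ℝ) : ℝ :=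
  α * ((T₁ - s) ^ (-α - 1) - θ * (T₂ - s) ^ (-α - 1))

theorem hasDerivAt_kerMix {α θ T₁ T₂ s : ℝ} (h₁ : s < T₁) (h₂ : s < T₂) :
    HasDerivAt (kerMix α θ T₁ T₂) (kerMixDeriv α θ T₁ T₂ s) s := by
  have a1 : HasDerivAt (fun s => (T₁ - s) ^ (-α)) _ s :=
    ((hasDerivAt_id s).const_sub T₁).rpow_const (p := -α) (Or.inl (by simp; linarith))
  have a2 : HasDerivAt (fun s => (T₂ - s) ^ (-α)) _ s :=
    ((hasDerivAt_id s).const_sub T₂).rpow_const (p := -α) (Or.inl (by simp; linarith))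
  refine (a1.sub (a2.const_mul θ)).congr_deriv ?_
  simp [kerMixDeriv]
  ring

/-- For 0 ≤ θ ≤ 1 and β ≥ 0 both factors on the right are nonnegative and nonincreasing in y. With β
= α this gives the sign of the kernel, with β = α + 1 the sign and the monotonicity of its
derivative. -/
theorem rpow_neg_sub_eq {β θ v y : ℝ} (hv : 0 ≤ v) (hy : 0 < y) :
    y ^ (-β) - θ * (y + v) ^ (-β) = y ^ (-β) * (1 - θ * (y / (y + v)) ^ β) := by
  have h : 0 < y + v := by linarith
  rw [Real.div_rpow hy.le h.le, Real.rpow_neg hy.le, Real.rpow_neg h.le]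
  have : y ^ β ≠ 0 := (Real.rpow_pos_of_pos hy _).ne'
  field_simp

theorem one_sub_ratio_antitone {β θ v : ℝ} (hβ : 0 ≤ β) (hθ : 0 ≤ θ) (hθ1 : θ ≤ 1) (hv : 0 ≤ v)
    {x y : ℝ} (hx : 0 < x) (hxy : x ≤ y) :
    0 ≤ 1 - θ * (y / (y + v)) ^ β ∧
      1 - θ * (y / (y + v)) ^ β ≤ 1 - θ * (x / (x + v)) ^ β := by
  have hy : 0 < y := by linarith
  have h1 : (y / (y + v)) ^ β ≤ 1 := by
    apply Real.rpow_le_one (by positivity) _ hβ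
    rw [div_le_one (by linarith)]
    linarith
  have h0 : 0 ≤ (y / (y + v)) ^ β := by positivity
  have h2 : (x / (x + v)) ^ β ≤ (y / (y + v)) ^ β := by
    apply Real.rpow_le_rpow (by positivity) _ hβ
    rw [div_le_div_iff₀ (by linarith) (by linarith)]
    nlinarith
  constructor
  · nlinarith
  · nlinarith

theorem rpow_neg_sub_nonneg {β θ v : ℝ} (hβ : 0 ≤ β) (hθ : 0 ≤ θ) (hθ1 : θ ≤ 1) (hv : 0 ≤ v)
    {y : ℝ} (hy : 0 < y) : 0 ≤ y ^ (-β) - θ * (y + v) ^ (-β) := by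
  rw [rpow_neg_sub_eq hv hy]
  exact mul_nonneg (by positivity) (one_sub_ratio_antitone hβ hθ hθ1 hv hy le_rfl).1

theorem rpow_neg_sub_antitone {β θ v : ℝ} (hβ : 0 ≤ β) (hθ : 0 ≤ θ) (hθ1 : θ ≤ 1) (hv : 0 ≤ v)
    {x y : ℝ} (hx : 0 < x) (hxy : x ≤ y) :
    y ^ (-β) - θ * (y + v) ^ (-β) ≤ x ^ (-β) - θ * (x + v) ^ (-β) := by
  rw [rpow_neg_sub_eq hv hx, rpow_neg_sub_eq hv (by linarith)]
  have h := one_sub_ratio_antitone hβ hθ hθ1 hv hx hxy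
  exact mul_le_mul (Real.rpow_le_rpow_of_nonpos hx hxy (by linarith)) h.2 h.1 (by positivity)

section
variable {α θ T₁ T₂ : ℝ} (hα : 0 ≤ α) (hθ : 0 ≤ θ) (hθ1 : θ ≤ 1) (hT : T₁ ≤ T₂)
include hα hθ hθ1 hT

theorem kerMix_nonneg {s : ℝ} (hs : s < T₁) : 0 ≤ kerMix α θ T₁ T₂ s := by
  have := rpow_neg_sub_nonneg hα hθ hθ1 (sub_nonneg.2 hT) (sub_pos.2 hs)
  rwa [show T₁ - s + (T₂ - T₁) = T₂ - s by ring] at this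

theorem kerMixDeriv_nonneg {s : ℝ} (hs : s < T₁) : 0 ≤ kerMixDeriv α θ T₁ T₂ s := by
  have := rpow_neg_sub_nonneg (β := α + 1) (by linarith) hθ hθ1 (sub_nonneg.2 hT) (sub_pos.2 hs)
  unfold kerMixDeriv
  apply mul_nonneg hα
  rw [show T₁ - s + (T₂ - T₁) = T₂ - s by ring, show -(α + 1) = -α - 1 by ring] at this
  exact this

theorem kerMixDeriv_mono {s p : ℝ} (hsp : s ≤ p) (hp : p < T₁) :
    kerMixDeriv α θ T₁ T₂ s ≤ kerMixDeriv α θ T₁ T₂ p := by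
  have := rpow_neg_sub_antitone (β := α + 1) (by linarith) hθ hθ1 (sub_nonneg.2 hT)
    (sub_pos.2 hp) (sub_le_sub_left hsp T₁)
  unfold kerMixDeriv
  apply mul_le_mul_of_nonneg_left _ hα
  rw [show T₁ - s + (T₂ - T₁) = T₂ - s by ring, show T₁ - p + (T₂ - T₁) = T₂ - p by ring,
    show -(α + 1) = -α - 1 by ring] at this
  exact this

/-- `(T₁ - s) J'(s)` is nondecreasing in `s`. -/
theorem kerMixDeriv_mul_mono {s p : ℝ} (hsp : s ≤ p) (hp : p < T₁) :
    (T₁ - s) * kerMixDeriv α θ T₁ T₂ s ≤ (T₁ - p) * kerMixDeriv α θ T₁ T₂ p := by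
  have hv := sub_nonneg.2 hT
  have key : ∀ s, s < T₁ → (T₁ - s) * kerMixDeriv α θ T₁ T₂ s =
      α * ((T₁ - s) ^ (-α) * (1 - θ * ((T₁ - s) / ((T₁ - s) + (T₂ - T₁))) ^ (α + 1))) := by
    intro s hs
    have h1 := rpow_neg_sub_eq (β := α + 1) (θ := θ) hv (sub_pos.2 hs)
    have h2 : (T₁ - s) ^ (-α) = (T₁ - s) * (T₁ - s) ^ (-(α + 1)) := by
      conv_rhs => rw [mul_comm, ← Real.rpow_add_one (sub_pos.2 hs).ne']
      congr 1; ring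
    unfold kerMixDeriv
    rw [show -α - 1 = -(α + 1) by ring, show T₂ - s = T₁ - s + (T₂ - T₁) by ring, h1, h2]
    ring
  rw [key s (by linarith), key p hp]
  have h := one_sub_ratio_antitone (β := α + 1) (by linarith) hθ hθ1 hv (sub_pos.2 hp)
    (sub_le_sub_left hsp T₁)
  apply mul_le_mul_of_nonneg_left _ hα
  exact mul_le_mul (Real.rpow_le_rpow_of_nonpos (sub_pos.2 hp) (by linarith) (by linarith))
    h.2 h.1 (Real.rpow_nonneg (by linarith) _)

omit hα hθ hθ1 in
theorem kerMix_continuousOn {a b : ℝ} (hb : b < T₁) :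
    ContinuousOn (kerMix α θ T₁ T₂) (Set.Icc a b) := fun _ hs =>
  (hasDerivAt_kerMix (lt_of_le_of_lt hs.2 hb)
    (lt_of_le_of_lt hs.2 (hb.trans_le hT))).continuousAt.continuousWithinAt

omit hα hθ hθ1 in
theorem kerMix_intervalIntegrable {a b : ℝ} (hab : a ≤ b) (hb : b < T₁) :
    IntervalIntegrable (kerMix α θ T₁ T₂) volume a b := by
  apply ContinuousOn.intervalIntegrable
  rw [Set.uIcc_of_le hab]
  exact kerMix_continuousOn hT hb

/-- Convexity in the form used by the weight estimates: the tangent at p is subtracted. The next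
lemma is the version to the left of p. -/
theorem kerMix_sub_monotoneOn {p b : ℝ} (hb : b < T₁) :
    MonotoneOn (fun s => kerMix α θ T₁ T₂ s - kerMixDeriv α θ T₁ T₂ p * s) (Set.Icc p b) := by
  have hd : ∀ s, s < T₁ → HasDerivAt
      (fun s => kerMix α θ T₁ T₂ s - kerMixDeriv α θ T₁ T₂ p * s)
      (kerMixDeriv α θ T₁ T₂ s - kerMixDeriv α θ T₁ T₂ p) s := by
    intro s hs
    refine ((hasDerivAt_kerMix hs (hs.trans_le hT)).sub
      ((hasDerivAt_id s).const_mul _)).congr_deriv ?_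
    simp
  apply monotoneOn_of_hasDerivWithinAt_nonneg (convex_Icc p b)
    (f' := fun s => kerMixDeriv α θ T₁ T₂ s - kerMixDeriv α θ T₁ T₂ p)
  · exact fun s hs => (hd s (lt_of_le_of_lt hs.2 hb)).continuousAt.continuousWithinAt
  · intro s hs
    rw [interior_Icc] at hs
    exact (hd s (hs.2.trans hb)).hasDerivWithinAt
  · intro s hs
    rw [interior_Icc] at hs
    have := kerMixDeriv_mono hα hθ hθ1 hT hs.1.le (hs.2.trans hb)
    linarith

theorem kerMix_sub_antitoneOn {a p : ℝ} (hp : p < T₁) :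
    AntitoneOn (fun s => kerMix α θ T₁ T₂ s - kerMixDeriv α θ T₁ T₂ p * s) (Set.Icc a p) := by
  have hd : ∀ s, s < T₁ → HasDerivAt
      (fun s => kerMix α θ T₁ T₂ s - kerMixDeriv α θ T₁ T₂ p * s)
      (kerMixDeriv α θ T₁ T₂ s - kerMixDeriv α θ T₁ T₂ p) s := by
    intro s hs
    refine ((hasDerivAt_kerMix hs (hs.trans_le hT)).sub
      ((hasDerivAt_id s).const_mul _)).congr_deriv ?_
    simp
  apply antitoneOn_of_hasDerivWithinAt_nonpos (convex_Icc a p)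
    (f' := fun s => kerMixDeriv α θ T₁ T₂ s - kerMixDeriv α θ T₁ T₂ p)
  · exact fun s hs => (hd s (lt_of_le_of_lt hs.2 hp)).continuousAt.continuousWithinAt
  · intro s hs
    rw [interior_Icc] at hs
    exact (hd s (hs.2.trans hp)).hasDerivWithinAt
  · intro s hs
    rw [interior_Icc] at hs
    have := kerMixDeriv_mono hα hθ hθ1 hT hs.2.le hp
    linarith

theorem kerMix_mono {a b : ℝ} (hb : b < T₁) :
    MonotoneOn (kerMix α θ T₁ T₂) (Set.Icc a b) := by
  intro x hx y hy hxy
  have h := kerMix_sub_monotoneOn hα hθ hθ1 hT (p := a) hb hx hy hxy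
  have h0 := kerMixDeriv_nonneg hα hθ hθ1 hT (s := a) (by linarith [hx.1, hy.2])
  simp only at h
  nlinarith

theorem rightWeight_kerMix_nonneg {x y z : ℝ} (hxy : x < y) (hyz : y < z) (hy : y < T₁) :
    0 ≤ rightWeight x y z (kerMix α θ T₁ T₂) := by
  have := rightWeight_ge (m := 0) hxy hyz (kerMix_intervalIntegrable hT hxy.le hy)
    (by simpa using kerMix_mono hα hθ hθ1 hT hy)
  simpa using this

theorem leftWeight_kerMix_add_nonneg {x y z : ℝ} (hxy : x < y) (hyz : y < z) (hy : y < T₁) :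
    0 ≤ leftWeight x y z (kerMix α θ T₁ T₂) + kerMix α θ T₁ T₂ y := by
  have := leftWeight_add_right_ge (m := 0) hxy hyz (kerMix_intervalIntegrable hT hxy.le hy)
    (by simpa using kerMix_mono hα hθ hθ1 hT hy)
  simpa using this

theorem neg_leftWeight_kerMix_ge {x y z : ℝ} (hxy : x < y) (hyz : y < z) (hy : y < T₁) :
    kerMix α θ T₁ T₂ x ≤ -leftWeight x y z (kerMix α θ T₁ T₂) := by
  have := neg_leftWeight_ge (m := 0) hxy hyz (kerMix_intervalIntegrable hT hxy.le hy)
    (by simpa using kerMix_mono hα hθ hθ1 hT hy)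
  simpa using this

theorem interp_weights_kerMix_nonneg {w x y z : ℝ} (hwx : w < x) (hxy : x < y) (hyz : y < z)
    (hy : y < T₁)
    (hc : (x - w) ^ 3 / ((y - x) * (y - w)) ≤ 3 * (y - x) + (y - x) ^ 2 / (z - y)) :
    0 ≤ rightWeight x y z (kerMix α θ T₁ T₂) - rightWeight w x y (kerMix α θ T₁ T₂)
      + (leftWeight x y z (kerMix α θ T₁ T₂) + kerMix α θ T₁ T₂ y) := by
  have hm := kerMixDeriv_nonneg hα hθ hθ1 hT (hxy.trans hy)
  refine le_trans ?_ (interp_weights_ge hwx hxy hyz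
    (kerMix_intervalIntegrable hT hwx.le (hxy.trans hy)) (kerMix_intervalIntegrable hT hxy.le hy)
    (kerMix_sub_antitoneOn hα hθ hθ1 hT (hxy.trans hy)) (kerMix_sub_monotoneOn hα hθ hθ1 hT hy))
  exact mul_nonneg (by linarith) (by linarith)

/-- The negated left weight on [y, z] exceeds J(y) by a multiple of the slope, which is still at
least J'(x) there. This is the source of the extra term 2 (z - y) in the step condition. -/
theorem interp_weights_kerMix_diff_nonneg {w x y z z' : ℝ} (hwx : w < x) (hxy : x < y)
    (hyz : y < z) (hz : z < z') (hzT : z < T₁)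
    (hc : (x - w) ^ 3 / ((y - x) * (y - w)) ≤
      3 * (y - x) + (y - x) ^ 2 / (z - y) + 2 * (z - y)) :
    0 ≤ (rightWeight x y z (kerMix α θ T₁ T₂) - leftWeight y z z' (kerMix α θ T₁ T₂))
      - (rightWeight w x y (kerMix α θ T₁ T₂) - leftWeight x y z (kerMix α θ T₁ T₂)) := by
  have hm := kerMixDeriv_nonneg hα hθ hθ1 hT (hxy.trans (hyz.trans hzT))
  have h1 := interp_weights_ge hwx hxy hyz
    (kerMix_intervalIntegrable hT hwx.le (hxy.trans (hyz.trans hzT)))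
    (kerMix_intervalIntegrable hT hxy.le (hyz.trans hzT))
    (kerMix_sub_antitoneOn hα hθ hθ1 hT (hxy.trans (hyz.trans hzT)))
    (kerMix_sub_monotoneOn hα hθ hθ1 hT (hyz.trans hzT))
  have h2 := neg_leftWeight_ge hyz hz (kerMix_intervalIntegrable hT hyz.le hzT)
    ((kerMix_sub_monotoneOn hα hθ hθ1 hT (p := x) hzT).mono
      (Set.Icc_subset_Icc_left hxy.le))
  have h3 : 2 * (z - y) / 6 ≤ (z - y) * (2 * (z - y) + 3 * (z' - z)) / (6 * (z' - y)) := by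
    rw [div_le_div_iff₀ (by norm_num) (by linarith)]
    nlinarith [mul_pos (sub_pos.2 hyz) (sub_pos.2 hz)]
  have h4 := mul_le_mul_of_nonneg_left h3 hm
  have h5 := mul_nonneg (div_nonneg hm (by norm_num : (0 : ℝ) ≤ 6)) (sub_nonneg.2 hc)
  linarith

end

/-! ### Closed forms of the singular integrals -/

theorem one_div_rpow_eq {T s α : ℝ} (h : s ≤ T) : 1 / (T - s) ^ α = (T - s) ^ (-α) := by
  rw [Real.rpow_neg (sub_nonneg.2 h), one_div]

theorem intervalIntegrable_sub_rpow {α : ℝ} (hα1 : α < 1) (l r T : ℝ) :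
    IntervalIntegrable (fun s => (T - s) ^ (-α)) volume l r := by
  have h : IntervalIntegrable (fun y : ℝ => y ^ (-α)) volume (T - l) (T - r) :=
    intervalIntegral.intervalIntegrable_rpow' (by linarith)
  simpa using (h.comp_sub_left T)

theorem integral_linear_mul_sub_rpow {α : ℝ} (hα1 : α < 1) {l r T : ℝ} (hlr : l ≤ r)
    (hrT : r ≤ T) (b : ℝ) :
    ∫ s in l..r, (2 * s - b) * (T - s) ^ (-α) =
      (2 * T - b) * (((T - l) ^ (1 - α) - (T - r) ^ (1 - α)) / (1 - α))
        - 2 * (((T - l) ^ (2 - α) - (T - r) ^ (2 - α)) / (2 - α)) := by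
  have h0 := intervalIntegral.integral_comp_sub_left (a := l) (b := r)
    (fun y => (2 * (T - y) - b) * y ^ (-α)) T
  have h1 : (fun s : ℝ => (2 * s - b) * (T - s) ^ (-α)) =
      fun s => (2 * (T - (T - s)) - b) * (T - s) ^ (-α) := by
    ext s; ring_nf
  rw [h1, h0]
  have hi1 : IntervalIntegrable (fun y : ℝ => y ^ (-α)) volume (T - r) (T - l) :=
    intervalIntegral.intervalIntegrable_rpow' (by linarith)
  have hi2 : IntervalIntegrable (fun y : ℝ => y ^ (1 - α)) volume (T - r) (T - l) :=
    intervalIntegral.intervalIntegrable_rpow' (by linarith)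
  have h2 : ∫ y in (T - r)..(T - l), (2 * (T - y) - b) * y ^ (-α) =
      ∫ y in (T - r)..(T - l), ((2 * T - b) * y ^ (-α) - 2 * y ^ (1 - α)) := by
    apply intervalIntegral.integral_congr
    intro y hy
    rw [Set.uIcc_of_le (by linarith)] at hy
    have hy0 : 0 ≤ y := by linarith [hy.1]
    have : y ^ (1 - α) = y * y ^ (-α) := by
      rcases hy0.eq_or_lt with h | h
      · rw [← h, zero_mul, Real.zero_rpow (by linarith)]
      · rw [mul_comm, ← Real.rpow_add_one h.ne']
        congr 1; ring
    simp only [this]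
    ring
  rw [h2, intervalIntegral.integral_sub (hi1.const_mul _) (hi2.const_mul _),
    intervalIntegral.integral_const_mul, intervalIntegral.integral_const_mul,
    integral_rpow (Or.inl (by linarith)), integral_rpow (Or.inl (by linarith))]
  rw [show -α + 1 = 1 - α by ring, show 1 - α + 1 = 2 - α by ring]

section
variable {α : ℝ} (hα1 : α < 1)
include hα1

theorem centered_endpoint_integral {x y : ℝ} (hxy : x < y) :
    (1 - α) * (2 - α) * ∫ s in x..y, (2 * s - x - y) * (y - s) ^ (-α) =
      α * (y - x) ^ (2 : ℕ) * (y - x) ^ (-α) := by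
  have h := integral_linear_mul_sub_rpow hα1 hxy.le le_rfl (x + y)
  rw [show (fun s : ℝ => (2 * s - x - y) * (y - s) ^ (-α)) =
    fun s => (2 * s - (x + y)) * (y - s) ^ (-α) by ext s; ring, h]
  have hp : 0 < y - x := sub_pos.2 hxy
  rw [sub_self, Real.zero_rpow (by linarith), Real.zero_rpow (by linarith),
    show 1 - α = 1 + -α by ring, show 2 - α = (2 : ℕ) + -α by push_cast; ring,
    Real.rpow_add hp, Real.rpow_add hp, Real.rpow_one, Real.rpow_natCast]
  have n1 : 1 + -α ≠ 0 := by linarith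
  have n2 : ((2 : ℕ) : ℝ) + -α ≠ 0 := by push_cast; linarith
  field_simp
  push_cast
  ring

theorem shifted_endpoint_integral {w x y : ℝ} (hxy : x < y) :
    (1 - α) * (2 - α) * ∫ s in x..y, (2 * s - w - x) * (y - s) ^ (-α) =
      (y - x) * (y - x) ^ (-α) * ((2 - α) * (y - w) + α * (y - x)) := by
  have h := integral_linear_mul_sub_rpow hα1 hxy.le le_rfl (w + x)
  rw [show (fun s : ℝ => (2 * s - w - x) * (y - s) ^ (-α)) =
    fun s => (2 * s - (w + x)) * (y - s) ^ (-α) by ext s; ring, h]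
  have hp : 0 < y - x := sub_pos.2 hxy
  rw [sub_self, Real.zero_rpow (by linarith), Real.zero_rpow (by linarith),
    show 1 - α = 1 + -α by ring, show 2 - α = (2 : ℕ) + -α by push_cast; ring,
    Real.rpow_add hp, Real.rpow_add hp, Real.rpow_one, Real.rpow_natCast]
  have n1 : 1 + -α ≠ 0 := by linarith
  have n2 : ((2 : ℕ) : ℝ) + -α ≠ 0 := by push_cast; linarith
  field_simp
  push_cast
  ring

theorem leftWeight_endpoint {x y z : ℝ} (hxy : x < y) (hyz : y < z) :
    (1 - α) * (2 - α) * leftWeight x y z (fun s => (z - s) ^ (-α)) =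
      (y - x) ^ (-α) * ((1 + (z - y) / (y - x)) ^ (-α) * (α * ((z - y) / (y - x)) - 2 + 2 * α)
        - α * ((z - y) / (y - x)) ^ (2 - α) / (1 + (z - y) / (y - x))) := by
  rw [leftWeight_eq]
  have h := integral_linear_mul_sub_rpow hα1 hxy.le hyz.le (y + z)
  rw [show (fun s : ℝ => (2 * s - y - z) * (z - s) ^ (-α)) =
    fun s => (2 * s - (y + z)) * (z - s) ^ (-α) by ext s; ring, h]
  have hp : 0 < y - x := sub_pos.2 hxy
  set τ := y - x with hτ
  obtain ⟨q, hq⟩ : ∃ q, q = (z - y) / τ := ⟨_, rfl⟩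
  have hq0 : 0 < q := by rw [hq]; exact div_pos (sub_pos.2 hyz) hp
  have hzy : z - y = τ * q := by rw [hq]; field_simp
  have hzx : z - x = τ * (1 + q) := by linarith
  have h1q : 0 < 1 + q := by linarith
  rw [show 2 * z - (y + z) = τ * q by linarith, hzy, hzx]
  have hc : τ * q / τ = q := by field_simp
  rw [hc]
  rw [Real.mul_rpow hp.le hq0.le, Real.mul_rpow hp.le h1q.le, Real.mul_rpow hp.le hq0.le,
    Real.mul_rpow hp.le h1q.le,
    show 1 - α = 1 + -α by ring, show 2 - α = (2 : ℕ) + -α by push_cast; ring,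
    Real.rpow_add hp, Real.rpow_add hp, Real.rpow_add hq0, Real.rpow_add hq0,
    Real.rpow_add h1q, Real.rpow_add h1q]
  simp only [Real.rpow_one, Real.rpow_natCast]
  have n1 : 1 + -α ≠ 0 := by linarith
  have n2 : ((2 : ℕ) : ℝ) + -α ≠ 0 := by push_cast; linarith
  field_simp
  push_cast
  ring

end

/-! ### The coefficients as interpolation weights and in terms of step ratios -/

theorem timeStep_succ (t : ℕ → ℝ) (i : ℕ) : timeStep t (i + 1) = t (i + 1) - t i := by
  simp [timeStep]

theorem timeStep_pos {t : ℕ → ℝ} (ht : StrictMono t) (i : ℕ) : 0 < timeStep t (i + 1) := by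
  rw [timeStep_succ]
  exact sub_pos.2 (ht (Nat.lt_succ_self i))

theorem integral_mul_one_div_rpow {α l r T : ℝ} (hlr : l ≤ r) (hrT : r ≤ T) (f : ℝ → ℝ) :
    ∫ s in l..r, f s * (1 / (T - s) ^ α) = ∫ s in l..r, f s * (T - s) ^ (-α) := by
  apply intervalIntegral.integral_congr
  intro s hs
  rw [Set.uIcc_of_le hlr] at hs
  simp only
  rw [one_div_rpow_eq (hs.2.trans hrT)]

section
variable {t : ℕ → ℝ} (ht : StrictMono t) (α : ℝ)
include ht

theorem coeffA_eq_leftWeight {k i : ℕ} (h : i + 1 < k) :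
    coeffA α t k (i + 1) =
      leftWeight (t i) (t (i + 1)) (t (i + 2)) (fun s => (t k - s) ^ (-α)) := by
  unfold coeffA leftWeight
  rw [if_neg h.ne]
  simp only [Nat.add_sub_cancel]
  rw [integral_mul_one_div_rpow (ht (Nat.lt_succ_self i)).le (ht h).le]
  simp only [timeStep_succ]
  congr 1; ext s; congr 2; ring

theorem coeffC_eq_rightWeight {k i : ℕ} (h : i + 1 < k) :
    coeffC α t k (i + 1) =
      rightWeight (t i) (t (i + 1)) (t (i + 2)) (fun s => (t k - s) ^ (-α)) := by
  unfold coeffC rightWeight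
  rw [if_neg h.ne]
  simp only [Nat.add_sub_cancel]
  rw [integral_mul_one_div_rpow (ht (Nat.lt_succ_self i)).le (ht h).le]
  simp only [timeStep_succ]
  congr 1; ext s; congr 2; ring

theorem coeffA_self (i : ℕ) :
    coeffA α t (i + 2) (i + 2) = ∫ s in (t (i + 1))..(t (i + 2)),
      (2 * s - t (i + 1) - t (i + 2)) / ((t (i + 1) - t i) * (t (i + 2) - t i))
        * (t (i + 2) - s) ^ (-α) := by
  unfold coeffA
  rw [if_pos rfl]
  simp only [show i + 2 - 1 = i + 1 by lia]
  rw [integral_mul_one_div_rpow (ht (Nat.lt_succ_self (i + 1))).le le_rfl]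
  simp only [timeStep_succ]
  congr 1; ext s; congr 2; ring

theorem coeffC_self (i : ℕ) :
    coeffC α t (i + 2) (i + 2) = ∫ s in (t (i + 1))..(t (i + 2)),
      (2 * s - t i - t (i + 1)) / ((t (i + 2) - t (i + 1)) * (t (i + 2) - t i))
        * (t (i + 2) - s) ^ (-α) := by
  unfold coeffC
  rw [if_pos rfl]
  simp only [Nat.add_sub_cancel, show i + 2 - 1 = i + 1 by lia]
  rw [integral_mul_one_div_rpow (ht (Nat.lt_succ_self (i + 1))).le le_rfl]
  simp only [timeStep_succ]
  congr 1; ext s; congr 2; ring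

theorem stepRatio_pos (i : ℕ) : 0 < stepRatio t (i + 2) :=
  div_pos (timeStep_pos ht (i + 1)) (timeStep_pos ht i)

theorem timeStep_eq_mul_stepRatio (i : ℕ) :
    timeStep t (i + 2) = timeStep t (i + 1) * stepRatio t (i + 2) := by
  have := (timeStep_pos ht i).ne'
  unfold stepRatio
  rw [show i + 2 - 1 = i + 1 by lia]
  field_simp

variable {α} (hα1 : α < 1)
include hα1

theorem coeffA_self_eq (i : ℕ) :
    (1 - α) * (2 - α) * coeffA α t (i + 2) (i + 2) =
      timeStep t (i + 2) ^ (-α) *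
        (α * stepRatio t (i + 2) ^ 2 / (1 + stepRatio t (i + 2))) := by
  have h := centered_endpoint_integral hα1 (ht (Nat.lt_succ_self (i + 1)))
  have h1 := timeStep_pos ht i
  have h2 := stepRatio_pos ht i
  have h3 := timeStep_eq_mul_stepRatio ht i
  have e1 := timeStep_succ t i
  have e2 := timeStep_succ t (i + 1)
  rw [coeffA_self ht]
  have : ∀ s, (2 * s - t (i + 1) - t (i + 2)) / ((t (i + 1) - t i) * (t (i + 2) - t i))
        * (t (i + 2) - s) ^ (-α) = (2 * s - t (i + 1) - t (i + 2)) * (t (i + 2) - s) ^ (-α) /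
        ((t (i + 1) - t i) * (t (i + 2) - t i)) := fun s => by ring
  simp only [this]
  rw [intervalIntegral.integral_div, mul_div_assoc', h]
  rw [← e1, show t (i + 2) - t (i + 1) = timeStep t (i + 2) from e2.symm,
    show t (i + 2) - t i = timeStep t (i + 2) + timeStep t (i + 1) by
      rw [e1]; linarith [e2], h3]
  field_simp
  ring

theorem coeffC_self_eq (i : ℕ) :
    (1 - α) * (2 - α) * coeffC α t (i + 2) (i + 2) =
      timeStep t (i + 2) ^ (-α) *
        (2 - α + α * stepRatio t (i + 2) / (1 + stepRatio t (i + 2))) := by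
  have h := shifted_endpoint_integral hα1 (w := t i) (ht (Nat.lt_succ_self (i + 1)))
  have h1 := timeStep_pos ht i
  have h2 := stepRatio_pos ht i
  have h3 := timeStep_eq_mul_stepRatio ht i
  have e1 := timeStep_succ t i
  have e2 := timeStep_succ t (i + 1)
  rw [coeffC_self ht]
  have : ∀ s, (2 * s - t i - t (i + 1)) / ((t (i + 2) - t (i + 1)) * (t (i + 2) - t i))
        * (t (i + 2) - s) ^ (-α) = (2 * s - t i - t (i + 1)) * (t (i + 2) - s) ^ (-α) /
        ((t (i + 2) - t (i + 1)) * (t (i + 2) - t i)) := fun s => by ring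
  simp only [this]
  rw [intervalIntegral.integral_div, mul_div_assoc', h]
  rw [show t (i + 2) - t (i + 1) = timeStep t (i + 2) from e2.symm,
    show t (i + 2) - t i = timeStep t (i + 2) + timeStep t (i + 1) by
      rw [e1]; linarith [e2], h3]
  field_simp
  ring

/-- `(1 - α) (2 - α) a_{k-1}^k`. -/
theorem coeffA_pred_eq (i : ℕ) :
    (1 - α) * (2 - α) * coeffA α t (i + 2) (i + 1) =
      timeStep t (i + 1) ^ (-α) *
        ((1 + stepRatio t (i + 2)) ^ (-α) * (α * stepRatio t (i + 2) - 2 + 2 * α)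
          - α * stepRatio t (i + 2) ^ (2 - α) / (1 + stepRatio t (i + 2))) := by
  rw [coeffA_eq_leftWeight ht α (by lia), leftWeight_endpoint hα1 (ht (Nat.lt_succ_self i))
    (ht (Nat.lt_succ_self (i + 1)))]
  have e1 := timeStep_succ t i
  have e2 := timeStep_succ t (i + 1)
  have e3 : stepRatio t (i + 2) = (t (i + 2) - t (i + 1)) / (t (i + 1) - t i) := by
    unfold stepRatio
    rw [show i + 2 - 1 = i + 1 by lia, e1]
    congr 1
  rw [e3, e1]

end

/-! ### The operator in terms of increments -/

theorem deriv_quadInterp {t : ℕ → ℝ} (ht : StrictMono t) (v : ℕ → ℝ) (i : ℕ) (s : ℝ) :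
    deriv (quadInterp t v (i + 1)) s =
      (2 * s - t i - t (i + 1)) / ((t (i + 2) - t (i + 1)) * (t (i + 2) - t i))
        * (v (i + 2) - v (i + 1))
      - (2 * s - t (i + 1) - t (i + 2)) / ((t (i + 1) - t i) * (t (i + 2) - t i))
        * (v (i + 1) - v i) := by
  have d : ∀ a b : ℝ, HasDerivAt (fun s => (s - a) * (s - b)) (2 * s - a - b) s := by
    intro a b
    refine (((hasDerivAt_id s).sub_const a).mul ((hasDerivAt_id s).sub_const b)).congr_deriv ?_
    simp
    ring
  have h : HasDerivAt (quadInterp t v (i + 1)) _ s :=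
    ((((d (t (i + 1)) (t (i + 2))).div_const
      ((t i - t (i + 1)) * (t i - t (i + 2)))).mul_const (v i)).add
    (((d (t i) (t (i + 2))).div_const
      ((t (i + 1) - t i) * (t (i + 1) - t (i + 2)))).mul_const (v (i + 1)))).add
    (((d (t i) (t (i + 1))).div_const
      ((t (i + 2) - t i) * (t (i + 2) - t (i + 1)))).mul_const (v (i + 2)))
  rw [h.deriv]
  have h1 := ht (Nat.lt_succ_self i)
  have h2 := ht (Nat.lt_succ_self (i + 1))
  simp only [Nat.succ_eq_add_one] at h1 h2
  rw [show i + 1 + 1 = i + 2 by lia] at h2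
  have n1 : t (i + 1) - t i ≠ 0 := by linarith
  have n2 : t (i + 2) - t (i + 1) ≠ 0 := by linarith
  have n3 : t (i + 2) - t i ≠ 0 := by linarith
  have n4 : t i - t (i + 1) ≠ 0 := by linarith
  have n5 : t (i + 1) - t (i + 2) ≠ 0 := by linarith
  have n6 : t i - t (i + 2) ≠ 0 := by linarith
  rw [show t i - t (i + 1) = -(t (i + 1) - t i) by ring,
    show t i - t (i + 2) = -(t (i + 2) - t i) by ring,
    show t (i + 1) - t (i + 2) = -(t (i + 2) - t (i + 1)) by ring]
  generalize ha : t (i + 1) - t i = a at *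
  generalize hb : t (i + 2) - t (i + 1) = b at *
  generalize hc : t (i + 2) - t i = c at *
  have hcc : c = a + b := by linarith
  have e1 : t (i + 1) = t i + a := by linarith
  have e2 : t (i + 2) = t i + a + b := by linarith
  rw [e1, e2]
  field_simp
  rw [hcc]
  ring

theorem integral_deriv_quadInterp {α : ℝ} (hα1 : α < 1) {t : ℕ → ℝ} (ht : StrictMono t)
    (v : ℕ → ℝ) (i : ℕ) {l r T : ℝ} (hlr : l ≤ r) (hrT : r ≤ T) :
    ∫ s in l..r, deriv (quadInterp t v (i + 1)) s / (T - s) ^ α =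
      (∫ s in l..r, (2 * s - t i - t (i + 1)) / ((t (i + 2) - t (i + 1)) * (t (i + 2) - t i))
        * (T - s) ^ (-α)) * (v (i + 2) - v (i + 1))
      - (∫ s in l..r, (2 * s - t (i + 1) - t (i + 2)) / ((t (i + 1) - t i) * (t (i + 2) - t i))
        * (T - s) ^ (-α)) * (v (i + 1) - v i) := by
  have hk := intervalIntegrable_sub_rpow hα1 l r T
  rw [← intervalIntegral.integral_mul_const, ← intervalIntegral.integral_mul_const,
    ← intervalIntegral.integral_sub]
  · apply intervalIntegral.integral_congr
    intro s hs
    rw [Set.uIcc_of_le hlr] at hs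
    simp only [deriv_quadInterp ht]
    rw [div_eq_mul_one_div, one_div_rpow_eq (hs.2.trans hrT)]
    ring
  · exact (hk.continuousOn_mul (by fun_prop)).mul_const _
  · exact (hk.continuousOn_mul (by fun_prop)).mul_const _

/-- The coefficient of `δ_j` in `Γ(1 - α) L_k^α` for `1 ≤ j < k`, without the endpoint term. -/
noncomputable def histCoeff (α : ℝ) (t : ℕ → ℝ) (k j : ℕ) : ℝ :=
  if j = 0 then 0 else if j = 1 then -coeffA α t k 1 else coeffD α t k j

/-- Collects the two contributions of neighbouring parabolas to the same increment. The top c has no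
partner and will join the diagonal. -/
theorem sum_shift_eq (c a x S : ℕ → ℝ) (h1 : S 1 = -a 1) (hS : ∀ j, S (j + 2) = c (j + 1) - a (j + 2))
    (m : ℕ) :
    ∑ i ∈ Finset.range (m + 1), (c (i + 1) * x (i + 2) - a (i + 1) * x (i + 1)) =
      c (m + 1) * x (m + 2) + ∑ i ∈ Finset.range (m + 1), S (i + 1) * x (i + 1) := by
  induction m with
  | zero => simp [h1]; ring
  | succ m ih =>
    rw [Finset.sum_range_succ, ih, Finset.sum_range_succ (fun i => S (i + 1) * x (i + 1)) (m + 1),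
      hS]
    ring

/-- The parabola through the last three nodes is integrated over the last two intervals. The second
use enlarges the diagonal and creates the subdiagonal term with a_k^k, which is kept apart from the
history. -/
theorem gamma_mul_fracL2 {α : ℝ} (hα1 : α < 1) {t : ℕ → ℝ} (ht : StrictMono t)
    (v : ℕ → ℝ) (m : ℕ) :
    Real.Gamma (1 - α) * fracL2 α t v (m + 2) =
      (coeffC α t (m + 2) (m + 2) + coeffC α t (m + 2) (m + 1)) * (v (m + 2) - v (m + 1))
      - coeffA α t (m + 2) (m + 2) * (v (m + 1) - v m)
      + ∑ i ∈ Finset.range (m + 1), histCoeff α t (m + 2) (i + 1) * (v (i + 1) - v i) := by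
  have hG : Real.Gamma (1 - α) ≠ 0 := (Real.Gamma_pos_of_pos (by linarith)).ne'
  unfold fracL2
  rw [if_neg (by lia), ← mul_assoc, mul_one_div_cancel hG, one_mul,
    show m + 2 - 1 = m + 1 by lia]
  rw [integral_deriv_quadInterp hα1 ht v m (ht (Nat.lt_succ_self (m + 1))).le le_rfl]
  have hsum : ∑ j ∈ Finset.Icc 1 (m + 1), ∫ s in (t (j - 1))..(t j),
      deriv (quadInterp t v j) s / (t (m + 2) - s) ^ α =
      ∑ i ∈ Finset.range (m + 1), (coeffC α t (m + 2) (i + 1) * (v (i + 2) - v (i + 1))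
        - coeffA α t (m + 2) (i + 1) * (v (i + 1) - v i)) := by
    rw [show Finset.Icc 1 (m + 1) = Finset.Ico (0 + 1) (m + 1 + 1) by ext; simp,
      ← Finset.sum_Ico_add', Finset.range_eq_Ico]
    apply Finset.sum_congr rfl
    intro i hi
    rw [Finset.mem_Ico] at hi
    rw [coeffA_eq_leftWeight ht α (by lia), coeffC_eq_rightWeight ht α (by lia),
      Nat.add_sub_cancel,
      integral_deriv_quadInterp hα1 ht v i (ht (Nat.lt_succ_self i)).le (ht.monotone (by lia))]
    simp only [leftWeight, rightWeight]
  have key := sum_shift_eq (fun j => coeffC α t (m + 2) j) (fun j => coeffA α t (m + 2) j)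
    (fun j => v j - v (j - 1)) (histCoeff α t (m + 2)) (by simp [histCoeff])
    (by intro j; simp [histCoeff, coeffD]) m
  simp only [Nat.add_sub_cancel, show ∀ i, i + 2 - 1 = i + 1 from fun i => by lia] at key
  rw [hsum, key, Nat.succ_eq_add_one, show m + 1 + 1 = m + 2 by lia, ← coeffA_self ht,
    ← coeffC_self ht]
  ring

/-! ### Abel summation and telescoping of the quadratic form -/

/-- Summation by parts. -/
theorem sum_diff_mul_eq (S v : ℕ → ℝ) (hS : S 0 = 0) (n : ℕ) :
    ∑ i ∈ Finset.range n, (S (i + 1) - S i) * (v n - v i) =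
      ∑ i ∈ Finset.range n, S (i + 1) * (v (i + 1) - v i) := by
  rw [← sub_eq_zero, ← Finset.sum_sub_distrib]
  have : ∀ i ∈ Finset.range n, (S (i + 1) - S i) * (v n - v i) - S (i + 1) * (v (i + 1) - v i) =
      S (i + 1) * (v n - v (i + 1)) - S i * (v n - v i) := fun i _ => by ring
  rw [Finset.sum_congr rfl this, Finset.sum_range_sub (fun i => S i * (v n - v i)), hS]
  ring

/-- The quadratic form with increments of `S` as weights. -/
def incrForm (S v : ℕ → ℝ) (m : ℕ) : ℝ :=
  ∑ i ∈ Finset.range m, (S (i + 1) - S i) * (v (m + 1) - v i) ^ 2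

/-- After Abel summation, (b - a)² + 2 (c - b)(b - a) + (c - b)² = (c - a)² with a = v_i, b =
v_{m+1}, c = v_{m+2} moves the squares from centre b to centre c. The old form lacks the index i =
m, hence the last term on the left; the sum on the right measures the decrease of the increments
from row S to row S'. -/
theorem incrForm_step (S S' v : ℕ → ℝ) (hS' : S' 0 = 0) (m : ℕ) :
    incrForm S v m
      + 2 * (v (m + 2) - v (m + 1)) * ∑ i ∈ Finset.range (m + 1), S' (i + 1) * (v (i + 1) - v i)
      + S' (m + 1) * (v (m + 2) - v (m + 1)) ^ 2 + (S' (m + 1) - S' m) * (v (m + 1) - v m) ^ 2 =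
    incrForm S' v (m + 1)
      + ∑ i ∈ Finset.range m,
          ((S (i + 1) - S i) - (S' (i + 1) - S' i)) * (v (m + 1) - v i) ^ 2 := by
  have h1 : incrForm S' v (m + 1) =
      ∑ i ∈ Finset.range (m + 1), (S' (i + 1) - S' i) * (v (m + 1) - v i) ^ 2
      + 2 * (v (m + 2) - v (m + 1)) *
        ∑ i ∈ Finset.range (m + 1), (S' (i + 1) - S' i) * (v (m + 1) - v i)
      + S' (m + 1) * (v (m + 2) - v (m + 1)) ^ 2 := by
    have h2 : S' (m + 1) = ∑ i ∈ Finset.range (m + 1), (S' (i + 1) - S' i) := by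
      rw [Finset.sum_range_sub, hS', sub_zero]
    rw [h2, Finset.mul_sum, Finset.sum_mul, ← Finset.sum_add_distrib, ← Finset.sum_add_distrib]
    unfold incrForm
    refine Finset.sum_congr rfl fun i _ => ?_
    ring
  rw [h1, sum_diff_mul_eq S' v hS', Finset.sum_range_succ
    (fun i => (S' (i + 1) - S' i) * (v (m + 1) - v i) ^ 2)]
  have h3 : ∑ i ∈ Finset.range m,
      ((S (i + 1) - S i) - (S' (i + 1) - S' i)) * (v (m + 1) - v i) ^ 2 =
      incrForm S v m - ∑ i ∈ Finset.range m, (S' (i + 1) - S' i) * (v (m + 1) - v i) ^ 2 := by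
    unfold incrForm
    rw [← Finset.sum_sub_distrib]
    exact Finset.sum_congr rfl fun i _ => by ring
  rw [h3]
  ring

/-- Twice the quadratic form in the increments of `v` with lower triangular part `S`, diagonal
`e / 2` and subdiagonal perturbation `-a`, restricted to the first `m + 1` increments. -/
noncomputable def lowerForm (S : ℕ → ℕ → ℝ) (e a v : ℕ → ℝ) (m : ℕ) : ℝ :=
  e 1 * (v 1 - v 0) ^ 2 + ∑ i ∈ Finset.range m, 2 * (v (i + 2) - v (i + 1)) *
    (e (i + 2) / 2 * (v (i + 2) - v (i + 1)) - a (i + 2) * (v (i + 1) - v i)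
      + ∑ j ∈ Finset.range (i + 1), S (i + 2) (j + 1) * (v (j + 1) - v j))

/-- The diagonal weight that remains for the last increment. -/
def lastRow (S : ℕ → ℕ → ℝ) (e a : ℕ → ℝ) (k : ℕ) : ℝ := e k - a k - S k (k - 1)

/-- The diagonal weight that remains for an increment which is not the last one. -/
def innerRow (S : ℕ → ℕ → ℝ) (e a : ℕ → ℝ) (k : ℕ) : ℝ :=
  lastRow S e a k - a (k + 1) - (S (k + 1) k - S (k + 1) (k - 1))

section
variable {S : ℕ → ℕ → ℝ} {e a v : ℕ → ℝ} (hS0 : ∀ k, S k 0 = 0)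
include hS0

theorem lowerForm_one : lowerForm S e a v 1 =
    (e 1 - S 2 1) * (v 1 - v 0) ^ 2 - 2 * a 2 * (v 1 - v 0) * (v 2 - v 1)
      + (e 2 - S 2 1) * (v 2 - v 1) ^ 2 + incrForm (S 2) v 1 := by
  simp [lowerForm, incrForm, hS0]
  ring

/-- The product with a 3 is split evenly between two squares, whereas the one with a 2 is kept for
the binary form in the first two increments. -/
theorem lowerForm_two_ge (ha : 0 ≤ a 3) :
    (e 1 - S 2 1) * (v 1 - v 0) ^ 2 - 2 * a 2 * (v 1 - v 0) * (v 2 - v 1)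
      + (e 2 - S 2 1 - (S 3 2 - S 3 1) - a 3) * (v 2 - v 1) ^ 2
      + lastRow S e a 3 * (v 3 - v 2) ^ 2 + incrForm (S 3) v 2
      + (S 2 1 - S 3 1) * (v 2 - v 0) ^ 2 ≤ lowerForm S e a v 2 := by
  have h1 : lowerForm S e a v 2 = lowerForm S e a v 1 + 2 * (v 3 - v 2) *
    (e 3 / 2 * (v 3 - v 2) - a 3 * (v 2 - v 1)
      + ∑ j ∈ Finset.range 2, S 3 (j + 1) * (v (j + 1) - v j)) := by
    unfold lowerForm
    rw [Finset.sum_range_succ _ 1, ← add_assoc]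
  have h2 := incrForm_step (S 2) (S 3) v (hS0 3) 1
  rw [h1, lowerForm_one hS0]
  simp only [Finset.range_one, Finset.sum_singleton, hS0, zero_add, sub_zero, Nat.reduceAdd]
    at h2
  unfold lastRow
  simp only [Nat.add_one_sub_one]
  have h3 := mul_nonneg ha (sq_nonneg ((v 3 - v 2) - (v 2 - v 1)))
  nlinarith only [h2, h3]

/-- One telescoping step. All but one of the nonnegative leftover squares are discarded; the one
with index i₀ is retained for the third row. -/
theorem lowerForm_succ_ge (m : ℕ) (ha : 0 ≤ a (m + 3))
    (hS : ∀ i ∈ Finset.range (m + 1),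
      S (m + 3) (i + 1) - S (m + 3) i ≤ S (m + 2) (i + 1) - S (m + 2) i) {B : ℝ}
    (hB : B + lastRow S e a (m + 2) * (v (m + 2) - v (m + 1)) ^ 2 + incrForm (S (m + 2)) v (m + 1)
      ≤ lowerForm S e a v (m + 1)) {i₀ : ℕ} (hi₀ : i₀ ∈ Finset.range (m + 1)) :
    B + innerRow S e a (m + 2) * (v (m + 2) - v (m + 1)) ^ 2
      + lastRow S e a (m + 3) * (v (m + 3) - v (m + 2)) ^ 2 + incrForm (S (m + 3)) v (m + 2)
      + ((S (m + 2) (i₀ + 1) - S (m + 2) i₀) - (S (m + 3) (i₀ + 1) - S (m + 3) i₀))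
        * (v (m + 2) - v i₀) ^ 2
      ≤ lowerForm S e a v (m + 2) := by
  have h1 : lowerForm S e a v (m + 2) = lowerForm S e a v (m + 1) + 2 * (v (m + 3) - v (m + 2)) *
    (e (m + 3) / 2 * (v (m + 3) - v (m + 2)) - a (m + 3) * (v (m + 2) - v (m + 1))
      + ∑ j ∈ Finset.range (m + 2), S (m + 3) (j + 1) * (v (j + 1) - v j)) := by
    unfold lowerForm
    rw [Finset.sum_range_succ _ (m + 1), ← add_assoc]
  have h2 := incrForm_step (S (m + 2)) (S (m + 3)) v (hS0 _) (m + 1)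
  have h3 := mul_nonneg ha (sq_nonneg ((v (m + 3) - v (m + 2)) - (v (m + 2) - v (m + 1))))
  have h4 := Finset.single_le_sum (f := fun i =>
    ((S (m + 2) (i + 1) - S (m + 2) i) - (S (m + 3) (i + 1) - S (m + 3) i))
        * (v (m + 2) - v i) ^ 2)
    (fun i hi => mul_nonneg (sub_nonneg.2 (hS i hi)) (sq_nonneg _)) hi₀
  simp only [add_assoc, Nat.reduceAdd] at h2 h4
  rw [h1]
  unfold innerRow lastRow at *
  simp only [show m + 2 - 1 = m + 1 by lia, show m + 3 - 1 = m + 2 by lia, add_assoc,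
    Nat.reduceAdd] at *
  nlinarith only [h2, h3, h4, hB]

/-- A lower bound of `lowerForm` by a binary form in the first two increments, diagonal terms for
the others, and two spare squares. -/
theorem lowerForm_ge (m : ℕ) (ha : ∀ k, 2 ≤ k → 0 ≤ a k)
    (hS : ∀ k i, 2 ≤ k → i + 1 < k → S (k + 1) (i + 1) - S (k + 1) i ≤ S k (i + 1) - S k i) :
    (e 1 - S 2 1) * (v 1 - v 0) ^ 2 - 2 * a 2 * (v 1 - v 0) * (v 2 - v 1)
      + (e 2 - S 2 1 - (S 3 2 - S 3 1) - a 3) * (v 2 - v 1) ^ 2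
      + (S 2 1 - S 3 1) * (v 2 - v 0) ^ 2 + (S 3 1 - S 4 1) * (v 3 - v 0) ^ 2
      + ∑ i ∈ Finset.range (m + 1), innerRow S e a (i + 3) * (v (i + 3) - v (i + 2)) ^ 2
      + lastRow S e a (m + 4) * (v (m + 4) - v (m + 3)) ^ 2 + incrForm (S (m + 4)) v (m + 3)
      ≤ lowerForm S e a v (m + 3) := by
  induction m with
  | zero =>
    have h := lowerForm_two_ge (e := e) (v := v) hS0 (ha 3 (by lia))
    have h2 := lowerForm_succ_ge hS0 (e := e) (a := a) (v := v) 1 (ha 4 (by lia))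
      (fun i hi => hS 3 i (by lia) (by simp at hi; lia))
      (B := (e 1 - S 2 1) * (v 1 - v 0) ^ 2 - 2 * a 2 * (v 1 - v 0) * (v 2 - v 1)
      + (e 2 - S 2 1 - (S 3 2 - S 3 1) - a 3) * (v 2 - v 1) ^ 2
      + (S 2 1 - S 3 1) * (v 2 - v 0) ^ 2) (by simp only [Nat.reduceAdd]; linarith)
      (i₀ := 0) (by simp)
    simp only [Nat.reduceAdd, zero_add, hS0, sub_zero, Finset.range_one, Finset.sum_singleton]
      at h2 ⊢
    linarith
  | succ m ih =>
    have h2 := lowerForm_succ_ge hS0 (e := e) (a := a) (v := v) (m + 2) (ha _ (by lia))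
      (fun i hi => hS (m + 4) i (by lia) (by simp at hi; lia))
      (B := (e 1 - S 2 1) * (v 1 - v 0) ^ 2 - 2 * a 2 * (v 1 - v 0) * (v 2 - v 1)
      + (e 2 - S 2 1 - (S 3 2 - S 3 1) - a 3) * (v 2 - v 1) ^ 2
      + (S 2 1 - S 3 1) * (v 2 - v 0) ^ 2 + (S 3 1 - S 4 1) * (v 3 - v 0) ^ 2
      + ∑ i ∈ Finset.range (m + 1), innerRow S e a (i + 3) * (v (i + 3) - v (i + 2)) ^ 2)
      ih (i₀ := 0) (by simp)
    have h3 := mul_nonneg (sub_nonneg.2 (hS (m + 4) 0 (by lia) (by lia)))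
      (sq_nonneg (v (m + 4) - v 0))
    rw [Finset.sum_range_succ _ (m + 1)]
    simp only [show m + 1 + 3 = m + 4 by lia, show m + 2 + 1 = m + 3 by lia,
      show m + 2 + 3 = m + 5 by lia] at h2 h3 ⊢
    linarith

omit hS0 in
theorem incrForm_nonneg {S v : ℕ → ℝ} (m : ℕ) (h : ∀ i ∈ Finset.range m, S i ≤ S (i + 1)) :
    0 ≤ incrForm S v m :=
  Finset.sum_nonneg fun i hi => mul_nonneg (sub_nonneg.2 (h i hi)) (sq_nonneg _)

end

/-! ### Numerical enclosures and division-free ratio conditions -/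

theorem rhoLow_gt : 0.3563 < rhoLow := by
  obtain ⟨h0, h⟩ := rhoLow_spec
  by_contra hc
  push Not at hc
  nlinarith [mul_nonneg h0.le h0.le, mul_nonneg h0.le (sub_nonneg.2 hc),
    mul_nonneg (mul_nonneg h0.le h0.le) (sub_nonneg.2 hc)]

theorem rhoLow_lt : rhoLow < 0.3564 := by
  obtain ⟨h0, h⟩ := rhoLow_spec
  by_contra hc
  push Not at hc
  nlinarith [mul_nonneg h0.le h0.le, mul_nonneg h0.le (sub_nonneg.2 hc),
    mul_nonneg (mul_nonneg h0.le h0.le) (sub_nonneg.2 hc)]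

theorem rhoHigh_gt : 3 < rhoHigh := by
  have h1 := rhoLow_spec.1
  have hA : 3 < (4 + 3 * rhoLow) / (1 + rhoLow) := by
    rw [lt_div_iff₀ (by linarith)]; linarith
  have h2 : (4 + 3 * rhoLow) / (1 + rhoLow) ≤ Real.sqrt (((4 + 3 * rhoLow) / (1 + rhoLow)) ^ 2
      + 4 * ((2 + rhoLow) / (1 + rhoLow))) := by
    apply Real.le_sqrt_of_sq_le
    have : 0 ≤ (2 + rhoLow) / (1 + rhoLow) := by positivity
    linarith
  unfold rhoHigh
  linarith

theorem rhoHigh_lt : rhoHigh < 4.156 := by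
  have h1 := rhoLow_gt
  -- The two quotients are 3 + 1/(1+ρ_*) and 1 + 1/(1+ρ_*), and 1/1.3563 < 0.7374.
  have hA : (4 + 3 * rhoLow) / (1 + rhoLow) < 3.7374 := by
    rw [div_lt_iff₀ (by linarith)]; linarith
  have hA0 : 0 < (4 + 3 * rhoLow) / (1 + rhoLow) := by positivity
  have hB : (2 + rhoLow) / (1 + rhoLow) < 1.7374 := by
    rw [div_lt_iff₀ (by linarith)]; linarith
  have h2 : Real.sqrt (((4 + 3 * rhoLow) / (1 + rhoLow)) ^ 2
      + 4 * ((2 + rhoLow) / (1 + rhoLow))) < 4.5742 := by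
    rw [Real.sqrt_lt' (by norm_num)]
    nlinarith
  unfold rhoHigh
  linarith

theorem xiLow_eq : (1 + 3 * rhoHigh) * (xiLow ^ 2 * (1 + xiLow)) = rhoHigh := by
  obtain ⟨h0, h⟩ := xiLow_spec
  have hne : 1 - 3 * xiLow ^ 2 * (1 + xiLow) ≠ 0 := by
    intro h1
    rw [h1, div_zero] at h
    exact rhoHigh_pos.ne h
  rw [div_eq_iff hne] at h
  linarith

theorem xiLow_lt_one : xiLow < 1 := by
  have h := xiLow_eq
  have h0 := xiLow_spec.1
  have hR := rhoHigh_pos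
  by_contra hc
  push Not at hc
  have : 2 ≤ xiLow ^ 2 * (1 + xiLow) := by nlinarith
  nlinarith

/-- Numerator and denominator of the defining fraction add up to ξ₂ + 1. -/
theorem xiHigh_eq : (1 + rhoHigh) * (xiHigh ^ 2 - 3 * xiHigh - 1) = xiHigh + 1 := by
  obtain ⟨h0, h⟩ := xiHigh_spec
  have hne : xiHigh ^ 2 - 3 * xiHigh - 1 ≠ 0 := by
    intro h1
    rw [h1, div_zero] at h
    exact rhoHigh_pos.ne h
  rw [div_eq_iff hne] at h
  linarith

theorem xiHigh_gt : 3 < xiHigh := by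
  have h := xiHigh_eq
  have h0 := xiHigh_spec.1
  have hR := rhoHigh_pos
  by_contra hc
  push Not at hc
  have : xiHigh ^ 2 - 3 * xiHigh - 1 ≤ 0 := by nlinarith
  nlinarith

theorem xiHigh_lt : xiHigh < 4.156 := by
  have h := xiHigh_eq
  have hR := rhoHigh_gt
  by_contra hc
  push Not at hc
  have h1 : 1.156 * xiHigh - 1 ≤ xiHigh ^ 2 - 3 * xiHigh - 1 := by nlinarith
  have h2 : 4 * (1.156 * xiHigh - 1) ≤ (1 + rhoHigh) * (xiHigh ^ 2 - 3 * xiHigh - 1) :=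
    mul_le_mul (by linarith) h1 (by linarith) (by linarith)
  linarith

namespace RatioCond

variable {r s : ℝ} (h : RatioCond r s)
include h

theorem left_gt : rhoLow < r := by
  rcases h with h | h | h
  · exact h.1
  · have h0 := xiLow_spec.1
    have e := xiLow_eq
    have hR := rhoHigh_gt
    have hl := rhoLow_lt
    have hl0 := rhoLow_spec.1
    refine lt_of_lt_of_le ?_ h.1
    by_contra hc
    push Not at hc
    have h1 : xiLow < 0.3564 := by linarith
    have h2 : xiLow ^ 2 < 0.1271 := by nlinarith
    have : xiLow ^ 2 * (1 + xiLow) < 0.18 := by nlinarith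
    nlinarith
  · have := xiHigh_gt
    have := rhoLow_lt
    linarith [h.1]

theorem right_gt : rhoLow < s := by
  rcases h with h | h | h
  · exact h.2.2.1
  · exact h.2.2.1
  · exact h.2.2.1

theorem left_lt : r < 4.156 := by
  rcases h with h | h | h
  · have := xiLow_lt_one
    linarith [h.2.1]
  · have := xiHigh_lt
    linarith [h.2.1]
  · have := rhoHigh_lt
    linarith [h.2.1]

/-- The upper constraint of `RatioCond` for large `r`, free of division. -/
theorem mul_le_upper : s * (r ^ 2 - 3 * r - 1) ≤ -r ^ 2 + 4 * r + 2 := by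
  have hr := h.left_gt
  have hs := h.right_gt
  have hl := rhoLow_spec.1
  have hR := rhoHigh_gt
  rcases h with h | h | h
  · have := xiLow_lt_one
    have h1 : r ^ 2 - 3 * r - 1 < 0 := by nlinarith [h.2.1]
    nlinarith [h.2.1]
  · have hx := xiHigh_gt
    have e := xiHigh_eq
    by_cases h1 : r ^ 2 - 3 * r - 1 ≤ 0
    · nlinarith
    · push Not at h1
      have h2 : s * (r ^ 2 - 3 * r - 1) ≤ rhoHigh * (r ^ 2 - 3 * r - 1) :=
        mul_le_mul_of_nonneg_right h.2.2.2.le h1.le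
      have h3 : (1 + rhoHigh) * (r ^ 2 - 3 * r - 1) ≤ r + 1 := by
        -- Subtracting r times the equation of ξ₂ from ξ₂ times the inequality makes ξ₂ - r a
        -- factor, with a positive cofactor.
        have h4 : xiHigh * ((1 + rhoHigh) * (r ^ 2 - 3 * r - 1))
            ≤ xiHigh * (r + 1) := by
          have e' : r * ((1 + rhoHigh) * (xiHigh ^ 2 - 3 * xiHigh - 1)) = r * (xiHigh + 1) := by
            rw [e]
          have hr0 : 0 < r := hl.trans hr
          have hx0 : 0 < xiHigh := by linarith
          have h5 : 0 ≤ (xiHigh - r) * ((1 + rhoHigh) * (xiHigh * r + 1) + 1) :=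
            mul_nonneg (by linarith [h.2.1]) (by positivity)
          nlinarith
        exact le_of_mul_le_mul_left h4 (by linarith)
      linarith
  · have hx := xiHigh_gt
    have e := xiHigh_eq
    have h1 : 0 < r ^ 2 - 3 * r - 1 := by
      have h2 : 0 < xiHigh ^ 2 - 3 * xiHigh - 1 := by
        by_contra hc
        push Not at hc
        nlinarith
      nlinarith [h.1]
    exact (le_div_iff₀ h1).1 h.2.2.2

/-- The upper constraint of `RatioCond` for small `r`, free of division. -/
theorem mul_le_lower : s * (1 - 3 * (r ^ 2 * (1 + r))) ≤ r ^ 2 * (1 + r) := by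
  have hr := h.left_gt
  have hs := h.right_gt
  have hl := rhoLow_spec.1
  have hR := rhoHigh_gt
  have h0 := xiLow_spec.1
  have e := xiLow_eq
  rcases h with h | h | h
  · have h1 : r ^ 2 * (1 + r) ≤ xiLow ^ 2 * (1 + xiLow) := by
      have : r ^ 2 ≤ xiLow ^ 2 := by nlinarith [h.2.1]
      nlinarith [h.2.1]
    have h2 : 0 < 1 - 3 * r ^ 2 * (1 + r) := by nlinarith
    have := (le_div_iff₀ h2).1 h.2.2.2
    linarith
  · have h1 : xiLow ^ 2 * (1 + xiLow) ≤ r ^ 2 * (1 + r) := by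
      have : xiLow ^ 2 ≤ r ^ 2 := by nlinarith [h.1]
      nlinarith [h.1]
    by_cases h2 : 1 - 3 * (r ^ 2 * (1 + r)) ≤ 0
    · nlinarith [mul_nonneg (by linarith : (0:ℝ) ≤ s) (sub_nonneg.2 h2), sq_nonneg r]
    · push Not at h2
      have h3 := mul_le_mul_of_nonneg_right h.2.2.2.le h2.le
      nlinarith
  · have hx := xiHigh_gt
    have h2 : 1 - 3 * (r ^ 2 * (1 + r)) ≤ 0 := by nlinarith [h.1]
    have h3 : 0 ≤ r ^ 2 * (1 + r) := by nlinarith [sq_nonneg r]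
    nlinarith [mul_nonneg (by linarith : (0:ℝ) ≤ s) (sub_nonneg.2 h2)]

end RatioCond

/-! ### Lower bounds for the ratio term -/

/-- The `ρ_{k+1}`-dependent part of the weights `g_k(α)`. -/
noncomputable def ratioTerm (α s : ℝ) : ℝ :=
  (1 + α) * (2 - α) / α + (s - 1 + α) / (1 + s) ^ α - 2 * s ^ (2 - α) / (1 + s)

theorem ratioTerm_eq {α s : ℝ} (hα : α ≠ 0) (hs : 0 < s) :
    ratioTerm α s = 2 / α + (1 - α) +
      ((s - (1 - α)) * (1 + s) ^ (1 - α) - 2 * s * s ^ (1 - α)) / (1 + s) := by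
  have h1 : (1 + s) ^ (1 - α) = (1 + s) / (1 + s) ^ α := by
    rw [Real.rpow_sub (by linarith), Real.rpow_one]
  have h2 : s ^ (2 - α) = s * s ^ (1 - α) := by
    rw [show 2 - α = (1 - α) + 1 by ring, Real.rpow_add_one hs.ne']
    ring
  unfold ratioTerm
  rw [h1, h2]
  have h3 : (1 + s) ^ α ≠ 0 := (Real.rpow_pos_of_pos (by linarith) _).ne'
  have h4 : 1 + s ≠ 0 := by linarith
  field_simp
  ring

/-- Chord bound of Bernoulli type. -/
theorem rpow_le_chord {s ε : ℝ} (hs : 0 ≤ s) (h0 : 0 ≤ ε) (h1 : ε ≤ 1) :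
    s ^ ε ≤ 1 + ε * (s - 1) := by
  have := rpow_one_add_le_one_add_mul_self (s := s - 1) (by linarith) h0 h1
  rwa [add_sub_cancel] at this

/-- The chord of ε ↦ s^ε over [0, 1/2] instead of [0, 1], sharper for small ε. -/
theorem rpow_le_chord_sqrt {s ε : ℝ} (hs : 0 ≤ s) (h0 : 0 ≤ ε) (h1 : ε ≤ 1 / 2) :
    s ^ ε ≤ 1 + 2 * ε * (Real.sqrt s - 1) := by
  have := rpow_le_chord (Real.sqrt_nonneg s) (ε := 2 * ε) (by linarith) (by linarith)
  rwa [Real.sqrt_eq_rpow, ← Real.rpow_mul hs, show 1 / 2 * (2 * ε) = ε by ring,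
    ← Real.sqrt_eq_rpow] at this

/-- At α = 1 the ratio term equals 1 + 1/(1+s), so the gain is sought at first order in ε = 1 - α.
The series of 2/(1-ε) is truncated, (1+s)^ε is bounded below by s^ε where its factor is s and above
by 1 + εs where its factor is -ε; the hypothesis is what remains. -/
theorem ratioTerm_ge_of {α s κ : ℝ} (hα0 : 0 < α) (hα1 : α < 1) (hs : 0 < s)
    (h : s * (s ^ (1 - α) - 1) ≤ (1 - α) * ((1 + 2 * s) + (1 - α) * (2 + s)
      + 2 * (1 - α) ^ 2 * (1 + s) + (1 - κ) * (1 + s))) :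
    1 + 1 / (1 + s) + κ * (1 - α) ≤ ratioTerm α s := by
  rw [ratioTerm_eq hα0.ne' hs]
  obtain ⟨ε, hε⟩ : ∃ ε, ε = 1 - α := ⟨_, rfl⟩
  rw [← hε] at h ⊢
  have hα : α = 1 - ε := by linarith
  have hε0 : 0 < ε := by linarith
  have hε1 : ε < 1 := by linarith
  have h1 : s ^ ε ≤ (1 + s) ^ ε := Real.rpow_le_rpow hs.le (by linarith) hε0.le
  have h2 : (1 + s) ^ ε ≤ 1 + ε * s := by
    have := rpow_le_chord (s := 1 + s) (by linarith) hε0.le hε1.le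
    linarith
  have h3 : 2 + 2 * ε + 2 * ε ^ 2 + 2 * ε ^ 3 ≤ 2 / α := by
    rw [le_div_iff₀ hα0, hα]
    nlinarith [pow_pos hε0 4]
  have h4 : -(s * s ^ ε) - ε * (1 + ε * s) ≤ (s - ε) * (1 + s) ^ ε - 2 * s * s ^ ε := by
    nlinarith
  have h5 : (-(s * s ^ ε) - ε * (1 + ε * s)) / (1 + s) ≤
      ((s - ε) * (1 + s) ^ ε - 2 * s * s ^ ε) / (1 + s) :=
    div_le_div_of_nonneg_right h4 (by linarith)
  have h6 : 1 + 1 / (1 + s) + κ * ε ≤ 2 + 2 * ε + 2 * ε ^ 2 + 2 * ε ^ 3 + ε +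
      (-(s * s ^ ε) - ε * (1 + ε * s)) / (1 + s) := by
    have h1s : 0 < 1 + s := by linarith
    rw [← sub_nonneg]
    have : 2 + 2 * ε + 2 * ε ^ 2 + 2 * ε ^ 3 + ε + (-(s * s ^ ε) - ε * (1 + ε * s)) / (1 + s)
        - (1 + 1 / (1 + s) + κ * ε) =
        (ε * ((1 + 2 * s) + ε * (2 + s) + 2 * ε ^ 2 * (1 + s) + (1 - κ) * (1 + s))
          - s * (s ^ ε - 1)) / (1 + s) := by
      field_simp
      ring
    rw [this]
    exact div_nonneg (by linarith) h1s.le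
  linarith

theorem ratioTerm_ge {α s : ℝ} (hα0 : 0 < α) (hα1 : α < 1) (hs : 0 < s) (hs1 : s ≤ 4.156) :
    1 + 1 / (1 + s) + 1 * (1 - α) ≤ ratioTerm α s := by
  apply ratioTerm_ge_of hα0 hα1 hs
  obtain ⟨ε, hε⟩ : ∃ ε, ε = 1 - α := ⟨_, rfl⟩
  rw [← hε]
  have hε0 : 0 < ε := by linarith
  have hε1 : ε < 1 := by linarith
  rcases le_total ε (1 / 2) with h | h
  · have h1 := rpow_le_chord_sqrt hs.le hε0.le h
    obtain ⟨w, hw⟩ : ∃ w, w = Real.sqrt s := ⟨_, rfl⟩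
    have hw0 : 0 ≤ w := hw ▸ Real.sqrt_nonneg s
    have hws : w ^ 2 = s := by rw [hw, Real.sq_sqrt hs.le]
    -- Upper bound for the square root of 4.156.
    have hw1 : w ≤ 2.0387 := by nlinarith
    rw [← hw] at h1
    have h2 : s * (s ^ ε - 1) ≤ s * (2 * ε * (w - 1)) := mul_le_mul_of_nonneg_left (by linarith) hs.le
    have h3 : s * (2 * (w - 1)) ≤ 1 + 2 * s := by
      rw [← hws]
      nlinarith [mul_nonneg (sq_nonneg w) (sub_nonneg.2 hw1)]
    have h4 : s * (2 * ε * (w - 1)) ≤ ε * (1 + 2 * s) := by nlinarith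
    have h5 : 0 ≤ ε * (ε * (2 + s) + 2 * ε ^ 2 * (1 + s)) := by positivity
    linarith
  · have h1 := rpow_le_chord hs.le hε0.le hε1.le
    have h2 : s * (s ^ ε - 1) ≤ s * (ε * (s - 1)) := mul_le_mul_of_nonneg_left (by linarith) hs.le
    have h3 : s * (s - 1) ≤ (1 + 2 * s) + ε * (2 + s) + 2 * ε ^ 2 * (1 + s) := by
      have : 1 / 4 ≤ ε ^ 2 := by nlinarith
      nlinarith
    have h4 := mul_le_mul_of_nonneg_left h3 hε0.le
    linarith

/-- The doubled gain is needed in the determinant estimate when ρ₂ is largest, where s ≤ 2 is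
automatic. -/
theorem ratioTerm_ge_two {α s : ℝ} (hα0 : 0 < α) (hα1 : α < 1) (hs : 0 < s) (hs1 : s ≤ 2) :
    1 + 1 / (1 + s) + 2 * (1 - α) ≤ ratioTerm α s := by
  apply ratioTerm_ge_of hα0 hα1 hs
  obtain ⟨ε, hε⟩ : ∃ ε, ε = 1 - α := ⟨_, rfl⟩
  rw [← hε]
  have hε0 : 0 < ε := by linarith
  have hε1 : ε < 1 := by linarith
  rcases le_total ε (1 / 2) with h | h
  · have h1 := rpow_le_chord_sqrt hs.le hε0.le h
    have hw1 : Real.sqrt s ≤ 1.5 := by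
      rw [Real.sqrt_le_left (by norm_num)]; linarith
    have h2 : s * (s ^ ε - 1) ≤ s * (2 * ε * (1.5 - 1)) := by
      apply mul_le_mul_of_nonneg_left _ hs.le
      nlinarith
    have h5 : 0 ≤ ε * (ε * (2 + s) + 2 * ε ^ 2 * (1 + s)) := by positivity
    nlinarith
  · have h1 := rpow_le_chord hs.le hε0.le hε1.le
    have h2 : s * (s ^ ε - 1) ≤ s * (ε * (s - 1)) := mul_le_mul_of_nonneg_left (by linarith) hs.le
    have h3 : s * (s - 1) ≤ s + ε * (2 + s) + 2 * ε ^ 2 * (1 + s) := by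
      nlinarith [sq_nonneg ε, mul_nonneg (sq_nonneg ε) hs.le]
    have h4 := mul_le_mul_of_nonneg_left h3 hε0.le
    linarith

/-! ### The determinant inequality -/

/-- First term of the series log((1+y)/(1-y)) ≥ 2y at y = x/4, then squared. It replaces powers by
rational functions of ε. -/
theorem exp_le_pade {x : ℝ} (h0 : 0 ≤ x) (h4 : x < 4) :
    Real.exp x ≤ ((4 + x) / (4 - x)) ^ 2 := by
  have h := Real.sum_range_le_log_div (x := x / 4) (by linarith) (by linarith) 1
  simp at h
  have h1 : (1 + x / 4) / (1 - x / 4) = (4 + x) / (4 - x) := by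
    have : 4 - x ≠ 0 := by linarith
    have : 1 - x / 4 ≠ 0 := by linarith
    field_simp
  rw [h1] at h
  have hp : 0 < (4 + x) / (4 - x) := div_pos (by linarith) (by linarith)
  have h2 : x ≤ Real.log (((4 + x) / (4 - x)) ^ 2) := by
    rw [Real.log_pow]
    push_cast
    linarith
  exact (Real.le_log_iff_exp_le (by positivity)).1 h2

theorem rpow_le_pade {r L ε : ℝ} (hr : 0 < r) (hL : Real.log r ≤ L) (hL0 : 0 ≤ L) (hL1 : L < 4)
    (h0 : 0 ≤ ε) (h1 : ε ≤ 1) : r ^ ε ≤ ((4 + L * ε) / (4 - L * ε)) ^ 2 := by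
  rw [Real.rpow_def_of_pos hr]
  refine le_trans (Real.exp_le_exp.2 (mul_le_mul_of_nonneg_right hL h0))
    (exp_le_pade (by positivity) ?_)
  nlinarith

theorem log_le_of_pow_le {r L : ℝ} {a b : ℕ} (hr : 0 < r) (ha : 0 < a) (h : r ^ a ≤ 2 ^ b)
    (hL : (b : ℝ) * 0.6931471808 ≤ a * L) : Real.log r ≤ L := by
  have h1 := Real.log_le_log (by positivity) h
  rw [Real.log_pow, Real.log_pow] at h1
  have h2 := mul_le_mul_of_nonneg_left Real.log_two_lt_d9.le (Nat.cast_nonneg (α := ℝ) b)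
  have h3 : (0 : ℝ) < a := by exact_mod_cast ha
  exact le_of_mul_le_mul_left (h1.trans (h2.trans hL)) h3

/-- With P = r^ε both sides of the conclusion tend to 2W as ε → 0. After the rational bound for P
and c ≥ 1/r are inserted and denominators cleared, the difference is therefore ε times an expression
affine in W: the one in `hG` with W for Wm. If its W-coefficient is negative, Wm is the worst case;
otherwise `hB` suffices, or `hG` itself when the coefficient vanishes. -/
theorem pade_strict {L c W Wm κ ε P r : ℝ} (hε0 : 0 < ε) (hε1 : ε < 1) (hL4 : L < 4)
    (hW0 : 0 < W) (hW : W ≤ Wm) (hκ : 0 ≤ κ) (hr : 0 < r) (hrc : 1 ≤ c * r) (hP0 : 0 < P)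
    (hP : P ≤ ((4 + L * ε) / (4 - L * ε)) ^ 2)
    (hB : 0 ≤ κ * (1 + ε) * (2 * (4 - L * ε) ^ 2 - c * ε * (4 + L * ε) ^ 2))
    (hG : 0 < Wm * (64 - 32 * L + 4 * L ^ 2 * ε ^ 2 - c * (1 + ε) * (4 + L * ε) ^ 2)
      + κ * (1 + ε) * (2 * (4 - L * ε) ^ 2 - c * ε * (4 + L * ε) ^ 2)) :
    (1 - ε) * P * (2 * W) < (1 + ε) * (2 - ε * (P / r)) * (W + κ * ε) := by
  have hx : 0 < 4 - L * ε := by nlinarith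
  have hx2 : 0 < (4 - L * ε) ^ 2 := by positivity
  rw [div_pow, le_div_iff₀ hx2] at hP
  have hPr : P / r ≤ c * P := by
    rw [div_le_iff₀ hr]; nlinarith
  have hWk : 0 < W + κ * ε := by positivity
  have h1 : (1 + ε) * (2 - ε * (c * P)) * (W + κ * ε) ≤
      (1 + ε) * (2 - ε * (P / r)) * (W + κ * ε) := by
    apply mul_le_mul_of_nonneg_right _ hWk.le
    apply mul_le_mul_of_nonneg_left _ (by linarith)
    nlinarith
  refine lt_of_lt_of_le ?_ h1
  have hc : 0 < c := pos_of_mul_pos_left (by linarith : 0 < c * r) hr.le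
  have key : 0 < W * (64 - 32 * L + 4 * L ^ 2 * ε ^ 2 - c * (1 + ε) * (4 + L * ε) ^ 2)
      + κ * (1 + ε) * (2 * (4 - L * ε) ^ 2 - c * ε * (4 + L * ε) ^ 2) := by
    rcases le_total 0 (64 - 32 * L + 4 * L ^ 2 * ε ^ 2 - c * (1 + ε) * (4 + L * ε) ^ 2) with h | h
    · rcases h.eq_or_lt with h0 | h0
      · rw [← h0] at hG ⊢; linarith
      · have := mul_pos hW0 h0; linarith
    · nlinarith [mul_le_mul_of_nonpos_right hW h]
  have h2 : 0 < 2 * (1 - ε) * W + ε * c * (1 + ε) * (W + κ * ε) := by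
    have := mul_pos (sub_pos.2 hε1) hW0
    positivity
  have h3 := mul_le_mul_of_nonneg_right hP h2.le
  have h4 : (4 + L * ε) ^ 2 * (2 * (1 - ε) * W + ε * c * (1 + ε) * (W + κ * ε))
      < 2 * (1 + ε) * (W + κ * ε) * (4 - L * ε) ^ 2 := by
    nlinarith [mul_pos hε0 key]
  have h5 : P * (2 * (1 - ε) * W + ε * c * (1 + ε) * (W + κ * ε)) < 2 * (1 + ε) * (W + κ * ε) := by
    apply lt_of_mul_lt_mul_right _ hx2.le
    linarith
  linarith

/-- For moderate r a numerical bound R₀ of r³/(1+r)² leaves room even at ε = 0, and P/r ≤ 1 is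
enough. -/
theorem pade_strict_direct {L W W₀ R₀ ε P r : ℝ} (hε0 : 0 < ε) (hε1 : ε < 1)
    (hL4 : L < 4) (hW0 : 0 < W₀) (hW : W₀ ≤ W) (hr : 0 < r) (hPr : P ≤ r) (hR₀ : 0 ≤ R₀)
    (hP : P ≤ ((4 + L * ε) / (4 - L * ε)) ^ 2)
    (hG : (1 - ε) * (4 + L * ε) ^ 2 * R₀ <
      (1 + ε) * (2 - ε) * (W₀ + ε) * (4 - L * ε) ^ 2) :
    (1 - ε) * P * R₀ < (1 + ε) * (2 - ε * (P / r)) * (W + 1 * ε) := by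
  have hx : 0 < 4 - L * ε := by nlinarith
  have hx2 : 0 < (4 - L * ε) ^ 2 := by positivity
  rw [div_pow, le_div_iff₀ hx2] at hP
  have h0 : P / r ≤ 1 := (div_le_one hr).2 hPr
  have h1 : (1 + ε) * (2 - ε) * (W₀ + ε) ≤ (1 + ε) * (2 - ε * (P / r)) * (W + 1 * ε) := by
    apply mul_le_mul
    · apply mul_le_mul_of_nonneg_left _ (by linarith)
      nlinarith
    · linarith
    · linarith
    · apply mul_nonneg (by linarith)
      nlinarith
  refine lt_of_lt_of_le ?_ h1
  apply lt_of_mul_lt_mul_right _ hx2.le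
  refine lt_of_le_of_lt ?_ hG
  have := mul_le_mul_of_nonneg_left hP (mul_nonneg (sub_nonneg.2 hε1.le) hR₀)
  linarith

/-- Bernstein monomials: the polynomial inequalities on [0, 1] below are certified as combinations
of these with nonnegative coefficients. -/
theorem pow_mul_one_sub_pow_nonneg {ε : ℝ} (h0 : 0 ≤ ε) (h1 : ε ≤ 1) (i j : ℕ) :
    0 ≤ ε ^ i * (1 - ε) ^ j :=
  mul_nonneg (pow_nonneg h0 _) (pow_nonneg (sub_nonneg.2 h1) _)

theorem cube_div_sq_mono {r b : ℝ} (hr : 0 < r) (hb : r ≤ b) :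
    r ^ 3 / (1 + r) ^ 2 ≤ b ^ 3 / (1 + b) ^ 2 := by
  have h1 : r / (1 + r) ≤ b / (1 + b) := by
    rw [div_le_div_iff₀ (by linarith) (by linarith)]
    linarith
  have h0 : 0 ≤ r / (1 + r) := by positivity
  calc r ^ 3 / (1 + r) ^ 2 = r * (r / (1 + r)) ^ 2 := by rw [div_pow]; ring
    _ ≤ b * (b / (1 + b)) ^ 2 := mul_le_mul hb (pow_le_pow_left₀ h0 h1 2) (by positivity)
      (by linarith)
    _ = _ := by rw [div_pow]; ring

section
variable {ε : ℝ} (h0 : 0 ≤ ε) (h1 : ε ≤ 1)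
include h0 h1

theorem poly_pos_first : (1 - ε) * (4 + 1.39 * ε) ^ 2 * 2.56 <
    (1 + ε) * (2 - ε) * (2.19 + ε) * (4 - 1.39 * ε) ^ 2 := by
  have hb := pow_mul_one_sub_pow_nonneg h0 h1
  linarith [hb 0 5, hb 1 4, hb 2 3, hb 3 2, hb 4 1, hb 5 0]

theorem poly_pos_second : (1 - ε) * (4 + 1.735 * ε) ^ 2 * 4.08 <
    (1 + ε) * (2 - ε) * (2.79 + ε) * (4 - 1.735 * ε) ^ 2 := by
  have hb := pow_mul_one_sub_pow_nonneg h0 h1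
  linarith [hb 0 5, hb 1 4, hb 2 3, hb 3 2, hb 4 1, hb 5 0]

theorem poly_pos_third : 0 ≤ 2 * (4 - 2.08 * ε) ^ 2 - 0.177 * ε * (4 + 2.08 * ε) ^ 2 := by
  have hb := pow_mul_one_sub_pow_nonneg h0 h1
  linarith [hb 0 3, hb 1 2, hb 2 1, hb 3 0]

theorem poly_pos_third' : 0 <
    3.52 * (64 - 32 * 2.08 + 4 * 2.08 ^ 2 * ε ^ 2 - 0.177 * (1 + ε) * (4 + 2.08 * ε) ^ 2)
      + 1 * (1 + ε) * (2 * (4 - 2.08 * ε) ^ 2 - 0.177 * ε * (4 + 2.08 * ε) ^ 2) := by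
  have hb := pow_mul_one_sub_pow_nonneg h0 h1
  linarith [hb 0 4, hb 1 3, hb 2 2, hb 3 1, hb 4 0]

theorem poly_pos_fourth : 0 ≤ 2 * (4 - 2.255 * ε) ^ 2 - 0.125 * ε * (4 + 2.255 * ε) ^ 2 := by
  have hb := pow_mul_one_sub_pow_nonneg h0 h1
  linarith [hb 0 3, hb 1 2, hb 2 1, hb 3 0]

theorem poly_pos_fourth' : 0 <
    3.55 * (64 - 32 * 2.255 + 4 * 2.255 ^ 2 * ε ^ 2 - 0.125 * (1 + ε) * (4 + 2.255 * ε) ^ 2)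
      + 2 * (1 + ε) * (2 * (4 - 2.255 * ε) ^ 2 - 0.125 * ε * (4 + 2.255 * ε) ^ 2) := by
  have hb := pow_mul_one_sub_pow_nonneg h0 h1
  linarith [hb 0 4, hb 1 3, hb 2 2, hb 3 1, hb 4 0]

end

theorem direct_bound_small {ε r P R W : ℝ} (hr : 0.3563 < r) (h1 : r ≤ 1) (hε0 : 0 < ε)
    (hε1 : ε < 1) (hP : P = r ^ ε) (hR0 : 0 ≤ R) (hR : R ≤ 1 / 4) (hW : 1.1939 ≤ W) :
    (1 - ε) * P * R < (1 + ε) * (2 - ε * (P / r)) * (W + 1 * ε) := by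
  have hr0 : 0 < r := by linarith
  have hP0 : 0 < P := hP ▸ Real.rpow_pos_of_pos hr0 _
  have hP1 : P ≤ 1 := hP ▸ Real.rpow_le_one hr0.le h1 hε0.le
  have h2 : P / r ≤ 1 + (1 - ε) * 1.8067 := by
    have e1 : P / r = r⁻¹ ^ (1 - ε) := by
      rw [Real.inv_rpow hr0.le, ← Real.rpow_neg hr0.le, hP, show -(1 - ε) = ε - 1 by ring,
        Real.rpow_sub_one hr0.ne']
    rw [e1]
    refine (rpow_le_chord (by positivity) (by linarith) (by linarith)).trans ?_
    have : r⁻¹ ≤ 2.8067 := by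
      rw [inv_le_comm₀ hr0 (by norm_num)]
      refine le_trans ?_ hr.le
      norm_num
    have := mul_le_mul_of_nonneg_left (sub_le_sub_right this 1) (sub_nonneg.2 hε1.le)
    linarith
  have h3 : 0.8 ≤ 2 - ε * (P / r) := by
    have := mul_le_mul_of_nonneg_left h2 hε0.le
    -- The parabola ε (1 + 1.8067 (1 - ε)) peaks near ε = 0.77 with a value below 1.2; here 1.8067
    -- bounds 1/0.3563 - 1.
    nlinarith only [this, sq_nonneg (ε - 0.77)]
  have h4 : (1 - ε) * P * R ≤ 1 * 1 * (1 / 4) :=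
    mul_le_mul (mul_le_mul (by linarith) hP1 hP0.le (by norm_num)) hR hR0 (by norm_num)
  have h5 : 1 * 0.8 ≤ (1 + ε) * (2 - ε * (P / r)) :=
    mul_le_mul (by linarith) h3 (by norm_num) (by linarith)
  have h6 : 1 * 0.8 * 1.1939 ≤ (1 + ε) * (2 - ε * (P / r)) * (W + 1 * ε) :=
    mul_le_mul h5 (by linarith) (by norm_num) (by linarith)
  linarith

/-- Put R = r³/(1+r)² and W = 1 + 1/(1+s) + 2r/(1+r). The hypothesis `H` reads R ≤ 2W, the limit of
the claim as α → 1, so near α = 1 strictness has to come from the gain κ(1-α) in the ratio term. For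
r ≤ 5.65 a numerical bound on R suffices; beyond that `H` is used. -/
theorem det_bound {α r s : ℝ} (hα0 : 0 < α) (hα1 : α < 1) (hr : 0.3563 < r) (hs : 0.3563 < s)
    (hs1 : s ≤ 4.156)
    (H : 0 ≤ 2 + 2 / (1 + s) + 4 * r / (1 + r) - r ^ 3 / (1 + r) ^ 2) :
    0 < 2 - (1 - α) * r ^ (-α) ∧
    α * (r ^ (4 - α) / (1 + r) ^ 2) <
      (2 - α) * (2 - (1 - α) * r ^ (-α)) * (ratioTerm α s + 2 * r / (1 + r)) := by
  obtain ⟨ε, hε⟩ : ∃ ε, ε = 1 - α := ⟨_, rfl⟩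
  have hε0 : 0 < ε := by linarith
  have hε1 : ε < 1 := by linarith
  have hα : α = 1 - ε := by linarith
  have hr0 : 0 < r := by linarith
  have h1r : 0 < 1 + r := by linarith
  obtain ⟨P, hP⟩ : ∃ P, P = r ^ ε := ⟨_, rfl⟩
  have hP0 : 0 < P := hP ▸ Real.rpow_pos_of_pos hr0 _
  have e1 : r ^ (-α) = P / r := by
    rw [hP, show -α = ε - 1 by linarith, Real.rpow_sub_one hr0.ne']
  have e2 : r ^ (4 - α) = r ^ 3 * P := by
    rw [hP, show 4 - α = ((3 : ℕ) : ℝ) + ε by push_cast; linarith, Real.rpow_add hr0,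
      Real.rpow_natCast]
  obtain ⟨W, hW⟩ : ∃ W, W = 1 + 1 / (1 + s) + 2 * r / (1 + r) := ⟨_, rfl⟩
  obtain ⟨R, hR⟩ : ∃ R, R = r ^ 3 / (1 + r) ^ 2 := ⟨_, rfl⟩
  have hRW : R ≤ 2 * W := by
    rw [hW, hR]
    have : 2 * (1 + 1 / (1 + s) + 2 * r / (1 + r)) = 2 + 2 / (1 + s) + 4 * r / (1 + r) := by ring
    linarith
  have hR0 : 0 ≤ R := by rw [hR]; positivity
  have hs_lo : 0.1939 ≤ 1 / (1 + s) := by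
    rw [le_div_iff₀ (by linarith)]; linarith
  have hs_hi : 1 / (1 + s) ≤ 0.7374 := by
    rw [div_le_iff₀ (by linarith)]; linarith
  have hφ : W + 1 * ε ≤ ratioTerm α s + 2 * r / (1 + r) := by
    have := ratioTerm_ge hα0 hα1 (by linarith) hs1
    rw [hW, hε]; linarith
  have main : ∀ κ : ℝ, W + κ * ε ≤ ratioTerm α s + 2 * r / (1 + r) → 0 ≤ W + κ * ε →
      (1 - ε) * P * R < (1 + ε) * (2 - ε * (P / r)) * (W + κ * ε) →
      0 < 2 - (1 - α) * r ^ (-α) ∧ α * (r ^ (4 - α) / (1 + r) ^ 2) <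
      (2 - α) * (2 - (1 - α) * r ^ (-α)) * (ratioTerm α s + 2 * r / (1 + r)) := by
    intro κ h1 h1' h2
    have h3 : 0 ≤ (1 - ε) * P * R :=
      mul_nonneg (mul_nonneg (by linarith) hP0.le) hR0
    have h4 : 0 < 2 - ε * (P / r) := by
      by_contra hc
      push Not at hc
      have : (1 + ε) * (2 - ε * (P / r)) * (W + κ * ε) ≤ 0 :=
        mul_nonpos_of_nonpos_of_nonneg (mul_nonpos_of_nonneg_of_nonpos (by linarith) hc) h1'
      linarith
    rw [← hε, e1, e2, show 2 - α = 1 + ε by linarith]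
    refine ⟨h4, ?_⟩
    rw [hα]
    rw [hα] at h1
    calc (1 - ε) * (r ^ 3 * P / (1 + r) ^ 2) = (1 - ε) * P * R := by rw [hR]; ring
      _ < _ := h2
      _ ≤ _ := mul_le_mul_of_nonneg_left h1 (mul_nonneg (by linarith) h4.le)
  have hW1 : 1.1939 ≤ W := by
    have : 0 ≤ 2 * r / (1 + r) := by positivity
    rw [hW]; linarith
  rcases le_total r 1 with h1 | h1
  · apply main 1 hφ (by linarith)
    exact direct_bound_small hr h1 hε0 hε1 hP hR0 (hR ▸ (cube_div_sq_mono hr0 h1).trans (by norm_num)) hW1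
  have hPr : P ≤ r := by
    rw [hP]
    calc r ^ ε ≤ r ^ (1 : ℝ) := Real.rpow_le_rpow_of_exponent_le h1 hε1.le
      _ = r := Real.rpow_one r
  rcases le_total r 4 with h4 | h4
  · apply main 1 hφ (by linarith)
    have hRs : R ≤ 2.56 := by
      rw [hR]
      exact (cube_div_sq_mono hr0 h4).trans (by norm_num)
    have hW2 : 2.19 ≤ W := by
      have : 1 ≤ 2 * r / (1 + r) := by rw [le_div_iff₀ h1r]; linarith
      rw [hW]; linarith
    refine lt_of_le_of_lt (mul_le_mul_of_nonneg_left hRs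
      (mul_nonneg (by linarith) hP0.le)) ?_
    refine pade_strict_direct (L := 1.39) (W₀ := 2.19) hε0 hε1 (by norm_num)
      (by norm_num) hW2 hr0 hPr (by norm_num) ?_ ?_
    · rw [hP]
      exact rpow_le_pade hr0 (log_le_of_pow_le (a := 1) (b := 2) hr0 (by norm_num)
        (by norm_num; linarith) (by norm_num)) (by norm_num) (by norm_num) hε0.le hε1.le
    · exact poly_pos_first hε0.le hε1.le
  -- The break point satisfies 5.65² ≤ 2⁵, so its logarithm is controlled by log 2.
  rcases le_total r 5.65 with h5 | h5
  · apply main 1 hφ (by linarith)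
    have hRs : R ≤ 4.08 := by
      rw [hR]
      exact (cube_div_sq_mono hr0 h5).trans (by norm_num)
    have hW2 : 2.79 ≤ W := by
      have : 1.6 ≤ 2 * r / (1 + r) := by rw [le_div_iff₀ h1r]; linarith
      rw [hW]; linarith
    refine lt_of_le_of_lt (mul_le_mul_of_nonneg_left hRs
      (mul_nonneg (by linarith) hP0.le)) ?_
    refine pade_strict_direct (L := 1.735) (W₀ := 2.79) hε0 hε1 (by norm_num)
      (by norm_num) hW2 hr0 hPr (by norm_num) ?_ ?_
    · rw [hP]
      exact rpow_le_pade hr0 (log_le_of_pow_le (a := 2) (b := 5) hr0 (by norm_num)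
        (by norm_num; nlinarith only [h4, h5]) (by norm_num)) (by norm_num) (by norm_num) hε0.le hε1.le
    · exact poly_pos_second hε0.le hε1.le
  rcases le_total r 8 with h8 | h8
  · apply main 1 hφ (by linarith)
    have hW2 : W ≤ 3.52 := by
      have : 2 * r / (1 + r) ≤ 1.778 := by rw [div_le_iff₀ h1r]; linarith
      rw [hW]; linarith
    refine lt_of_le_of_lt (mul_le_mul_of_nonneg_left hRW
      (mul_nonneg (by linarith) hP0.le)) ?_
    -- 2.08 bounds log 8 and 0.177 bounds 1/5.65.
    refine pade_strict (L := 2.08) (c := 0.177) (Wm := 3.52) hε0 hε1 (by norm_num)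
      (by linarith) hW2 (by norm_num) hr0 (by linarith) hP0 ?_ ?_ ?_
    · rw [hP]
      exact rpow_le_pade hr0 (log_le_of_pow_le (a := 1) (b := 3) hr0 (by norm_num)
        (by norm_num; linarith) (by norm_num)) (by norm_num) (by norm_num) hε0.le hε1.le
    · exact mul_nonneg (by linarith) (poly_pos_third hε0.le hε1.le)
    · exact poly_pos_third' hε0.le hε1.le
  -- Since R grows like r - 2 while 2W stays bounded, `H` forces r ≤ 9.5; R ≥ 8³/9² in turn forces
  -- 1/(1+s) ≥ 1/3, that is s ≤ 2, and the gain κ = 2 becomes available.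
  · have hR8 : R = r - 2 + (3 * r + 2) / (1 + r) ^ 2 := by
      rw [hR]; field_simp; ring
    have hRr : r - 2 ≤ R := by
      have : 0 ≤ (3 * r + 2) / (1 + r) ^ 2 := by positivity
      linarith
    have hR9 : 6.32 ≤ R := by
      rw [hR]
      exact le_trans (by norm_num) (cube_div_sq_mono (by norm_num) h8)
    have hr2 : 2 * r / (1 + r) ≤ 2 := by rw [div_le_iff₀ h1r]; linarith
    have hr95 : r ≤ 9.5 := by
      rw [hW] at hRW; linarith
    have hr3 : 2 * r / (1 + r) ≤ 1.81 := by rw [div_le_iff₀ h1r]; linarith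
    have hs2 : s ≤ 2 := by
      have : 1 / 3 ≤ 1 / (1 + s) := by
        rw [hW] at hRW; linarith
      have := (div_le_div_iff₀ (by norm_num) (by linarith : 0 < 1 + s)).1 this
      linarith
    have hW2 : W ≤ 3.55 := by
      rw [hW]; linarith
    have hφ2 : W + 2 * ε ≤ ratioTerm α s + 2 * r / (1 + r) := by
      have := ratioTerm_ge_two hα0 hα1 (by linarith) hs2
      rw [hW, hε]; linarith
    apply main 2 hφ2 (by linarith)
    refine lt_of_le_of_lt (mul_le_mul_of_nonneg_left hRW
      (mul_nonneg (by linarith) hP0.le)) ?_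
    refine pade_strict (L := 2.255) (c := 0.125) (Wm := 3.55) hε0 hε1 (by norm_num)
      (by linarith) hW2 (by norm_num) hr0 (by linarith) hP0 ?_ ?_ ?_
    · rw [hP]
      refine rpow_le_pade hr0 (log_le_of_pow_le (a := 4) (b := 13) hr0 (by norm_num)
        ?_ (by norm_num)) (by norm_num) (by norm_num) hε0.le hε1.le
      calc r ^ 4 ≤ 9.5 ^ 4 := pow_le_pow_left₀ hr0.le hr95 4
        _ ≤ 2 ^ 13 := by norm_num
    · exact mul_nonneg (by linarith) (poly_pos_fourth hε0.le hε1.le)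
    · exact poly_pos_fourth' hε0.le hε1.le

/-! ### The third row -/

theorem slack_poly_pos {q : ℝ} (hq : 0 ≤ q) :
    (5.808 * (1 + 2 * (0.3563 * (1 + q))) * (1 + 0.3563 * (1 + q)) * (q * (1 + q))
      - 4 * (1 + 0.3563 * (1 + q)) ^ 2 - 2 * (q * (4 + 3 * q)) * (1 + 0.3563 * (1 + q)) ^ 2)
      * (1 + 3 * q) ≤ 12 * (q * (1 + q)) ^ 2 * (0.3563 * (1 + q)) ^ 2 := by
  have h2 := mul_nonneg hq hq
  have h3 := mul_nonneg h2 hq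
  have h4 := mul_nonneg h2 h2
  nlinarith only [hq, h2, h3, h4, mul_nonneg hq (sq_nonneg (q - 1)),
    mul_nonneg hq (sq_nonneg (q ^ 2 - 1)), sq_nonneg (q ^ 2 - q), sq_nonneg (q ^ 3),
    mul_nonneg hq (sq_nonneg (q ^ 2 - q)), sq_nonneg (q ^ 2 - 1), sq_nonneg (q - 1),
    sq_nonneg (q ^ 3 - q)]

/-- The scale-free form of the inequality that balances the third row, with r and q the two step
ratios. In r the positive term on the left decreases and the right side increases, so r = 0.3563 is
the worst case and a polynomial inequality in q remains. The constant 5.808 bounds 1/(0.3563² ·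
1.3563). -/
theorem slack_ratio_bound {r q : ℝ} (hr : 0.3563 ≤ r) (hq : 0 < q) :
    (1 / (r ^ 2 * (1 + r)) * ((1 + 2 * (r * (1 + q))) / (2 * (1 + r * (1 + q))))
        - 2 / (q * (1 + q)) - (4 + 3 * q) / (1 + q)) * (1 + 3 * q) ≤
      6 * (q * (1 + q)) * (r * (1 + q) / (1 + r * (1 + q))) ^ 2 := by
  have hr0 : 0 < r := by linarith
  have e1 : 1 / (r ^ 2 * (1 + r)) * ((1 + 2 * (r * (1 + q))) / (2 * (1 + r * (1 + q)))) ≤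
      5.808 * ((1 + 2 * (0.3563 * (1 + q))) / (2 * (1 + 0.3563 * (1 + q)))) := by
    have a1 : 1 / (r * (1 + r)) ≤ 5.808 * 0.3563 := by
      rw [div_le_iff₀ (by positivity)]
      nlinarith
    have a2 : (1 + 2 * (r * (1 + q))) / (2 * (1 + r * (1 + q))) / r ≤
        (1 + 2 * (0.3563 * (1 + q))) / (2 * (1 + 0.3563 * (1 + q))) / 0.3563 := by
      rw [div_div, div_div, div_le_div_iff₀ (by positivity) (by positivity)]
      nlinarith [mul_nonneg (sub_nonneg.2 hr) (by positivity : 0 ≤ 1 + q),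
        mul_nonneg (mul_nonneg (sub_nonneg.2 hr) (by positivity : 0 ≤ 1 + q)) hr0.le,
        mul_nonneg (mul_nonneg (mul_nonneg (sub_nonneg.2 hr) (by positivity : 0 ≤ 1 + q)) hr0.le)
          (by positivity : 0 ≤ 1 + q)]
    calc _ = 1 / (r * (1 + r)) * ((1 + 2 * (r * (1 + q))) / (2 * (1 + r * (1 + q))) / r) := by
          field_simp
      _ ≤ 5.808 * 0.3563 * ((1 + 2 * (0.3563 * (1 + q))) / (2 * (1 + 0.3563 * (1 + q))) / 0.3563) :=
          mul_le_mul a1 a2 (by positivity) (by norm_num)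
      _ = _ := by ring
  have e2 : (0.3563 * (1 + q) / (1 + 0.3563 * (1 + q))) ^ 2 ≤
      (r * (1 + q) / (1 + r * (1 + q))) ^ 2 := by
    apply pow_le_pow_left₀ (by positivity)
    rw [div_le_div_iff₀ (by positivity) (by positivity)]
    nlinarith
  have e3 : (5.808 * ((1 + 2 * (0.3563 * (1 + q))) / (2 * (1 + 0.3563 * (1 + q))))
        - 2 / (q * (1 + q)) - (4 + 3 * q) / (1 + q)) * (1 + 3 * q) ≤
      6 * (q * (1 + q)) * (0.3563 * (1 + q) / (1 + 0.3563 * (1 + q))) ^ 2 := by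
    have hp := slack_poly_pos hq.le
    have hu : 0 < 1 + 0.3563 * (1 + q) := by positivity
    have hd : 0 < 2 * (q * (1 + q)) * (1 + 0.3563 * (1 + q)) ^ 2 := by positivity
    rw [← sub_nonneg] at hp ⊢
    have := div_nonneg hp hd.le
    refine this.trans_eq ?_
    generalize 0.3563 * (1 + q) = u at *
    have : 1 + q ≠ 0 := by positivity
    field_simp
    ring
  calc _ ≤ (5.808 * ((1 + 2 * (0.3563 * (1 + q))) / (2 * (1 + 0.3563 * (1 + q))))
        - 2 / (q * (1 + q)) - (4 + 3 * q) / (1 + q)) * (1 + 3 * q) :=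
        mul_le_mul_of_nonneg_right (by linarith) (by positivity)
    _ ≤ _ := e3
    _ ≤ _ := mul_le_mul_of_nonneg_left e2 (by positivity)

/-- AB/(A+B) is the minimum of AX² + BY² on the line X - Y = 1. -/
theorem sq_add_sq_ge {A B δ X Y : ℝ} (hA : 0 < A) (hB : 0 < B) (h : δ * (A + B) ≤ A * B) :
    δ * (X - Y) ^ 2 ≤ A * X ^ 2 + B * Y ^ 2 := by
  have h1 : δ ≤ A * B / (A + B) := by rwa [le_div_iff₀ (by linarith)]
  have h2 : A * B / (A + B) * (X - Y) ^ 2 ≤ A * X ^ 2 + B * Y ^ 2 := by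
    rw [div_mul_eq_mul_div, div_le_iff₀ (by linarith)]
    nlinarith [sq_nonneg (A * X + B * Y)]
  exact (mul_le_mul_of_nonneg_right h1 (sq_nonneg _)).trans h2

/-- For a concave upper bound of the slope, the weight of the right node is bounded by the one of a
quadratic polynomial. -/
theorem rightWeight_le_of_slope {w x y m L : ℝ} (hwx : w < x) (hxy : x < y) {J : ℝ → ℝ}
    (hJ : IntervalIntegrable J volume w x)
    (h : MonotoneOn (fun s => m * ((1 - x / L) * s + s ^ 2 / (2 * L)) - J s) (Set.Icc w x)) :
    rightWeight w x y J ≤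
      m * (x - w) ^ 3 / (6 * ((y - x) * (y - w))) * (1 - (x - w) / (2 * L)) := by
  refine (rightWeight_mono hwx hxy hJ
    (by apply Continuous.intervalIntegrable; fun_prop) h).trans_eq ?_
  rw [rightWeight_eq]
  have h1 : ∫ s in w..x, (2 * s - w - x) * (m * ((1 - x / L) * s + s ^ 2 / (2 * L))) =
      m * (x - w) ^ 3 / 6 * (1 - (x - w) / (2 * L)) := by
    have hd : ∀ s ∈ Set.uIcc w x, HasDerivAt (fun s : ℝ => m * ((1 - x / L) *
        (2 / 3 * s ^ 3 - (w + x) / 2 * s ^ 2) + (s ^ 4 / 2 - (w + x) / 3 * s ^ 3) / (2 * L)))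
        ((2 * s - w - x) * (m * ((1 - x / L) * s + s ^ 2 / (2 * L)))) s := by
      intro s _
      have p2 := hasDerivAt_pow 2 s
      have p3 := hasDerivAt_pow 3 s
      have p4 := hasDerivAt_pow 4 s
      refine (((((p3.const_mul (2 / 3)).sub (p2.const_mul ((w + x) / 2))).const_mul
        (1 - x / L)).add (((p4.div_const 2).sub (p3.const_mul ((w + x) / 3))).div_const
        (2 * L))).const_mul m).congr_deriv ?_
      push_cast
      ring
    rw [intervalIntegral.integral_eq_sub_of_hasDerivAt hd
      (by apply Continuous.intervalIntegrable; fun_prop)]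
    ring
  rw [h1]
  generalize (y - x) * (y - w) = d
  ring

section
variable {α θ : ℝ} (hα0 : 0 < α) (hα1 : α < 1) (hθ : 0 ≤ θ) (hθ1 : θ ≤ 1)
include hα0 hα1 hθ hθ1

omit hα1 in
-- As (T₁-s) J'(s) is nondecreasing, J'(s) ≤ J'(x)(T₁-x)/(T₁-s) on [w, x]. This majorant is convex
-- in s and lies below its chord, which is integrated exactly. The last factor is the improvement
-- over the tangent comparison.
theorem rightWeight_kerMix_le {w x y T₁ T₂ : ℝ} (hwx : w < x) (hxy : x < y) (hx : x < T₁)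
    (hT : T₁ ≤ T₂) :
    rightWeight w x y (kerMix α θ T₁ T₂) ≤ kerMixDeriv α θ T₁ T₂ x * (x - w) ^ 3 /
      (6 * ((y - x) * (y - w))) * (1 - (x - w) / (2 * (T₁ - w))) := by
  apply rightWeight_le_of_slope hwx hxy (kerMix_intervalIntegrable hT hwx.le hx)
  set m := kerMixDeriv α θ T₁ T₂ x
  have hL : 0 < T₁ - w := by linarith
  have hm : 0 ≤ m := kerMixDeriv_nonneg hα0.le hθ hθ1 hT hx
  have hd : ∀ s, s < T₁ → HasDerivAt (fun s => m * ((1 - x / (T₁ - w)) * s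
      + s ^ 2 / (2 * (T₁ - w))) - kerMix α θ T₁ T₂ s)
      (m * (1 - (x - s) / (T₁ - w)) - kerMixDeriv α θ T₁ T₂ s) s := by
    intro s hs
    refine (((((hasDerivAt_id s).const_mul (1 - x / (T₁ - w))).add
      ((hasDerivAt_pow 2 s).div_const (2 * (T₁ - w)))).const_mul m).sub
      (hasDerivAt_kerMix hs (hs.trans_le hT))).congr_deriv ?_
    field_simp
    push_cast
    ring
  apply monotoneOn_of_hasDerivWithinAt_nonneg (convex_Icc w x)
    (f' := fun s => m * (1 - (x - s) / (T₁ - w)) - kerMixDeriv α θ T₁ T₂ s)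
  · exact fun s hs => (hd s (lt_of_le_of_lt hs.2 hx)).continuousAt.continuousWithinAt
  · intro s hs
    rw [interior_Icc] at hs
    exact (hd s (hs.2.trans hx)).hasDerivWithinAt
  · intro s hs
    rw [interior_Icc] at hs
    have h1 := kerMixDeriv_mul_mono hα0.le hθ hθ1 hT hs.2.le hx
    have hs1 : 0 < T₁ - s := by linarith [hs.2]
    have h2 : (T₁ - x) ≤ (T₁ - s) * (1 - (x - s) / (T₁ - w)) := by
      have : (T₁ - s) * (1 - (x - s) / (T₁ - w)) - (T₁ - x) =
          (x - s) * (s - w) / (T₁ - w) := by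
        field_simp
        ring
      have h3 : 0 ≤ (x - s) * (s - w) / (T₁ - w) :=
        div_nonneg (mul_nonneg (by linarith [hs.2]) (by linarith [hs.1])) hL.le
      linarith
    have h4 := mul_le_mul_of_nonneg_left h2 hm
    rw [sub_nonneg]
    apply le_of_mul_le_mul_left _ hs1
    nlinarith

/-- With v = T₂ - T₁, the difference of the two sides is D(0) - θ D(v), where D(v) = (b+v)^(-α) - Cα
(a+v)^(-α-1). Since D(0) ≥ 0, D is nonincreasing and 0 ≤ θ ≤ 1, it is nonnegative. -/
theorem kerMix_ge_mul_deriv {w x T₁ T₂ : ℝ} (hwx : w < x) (hx : x < T₁) (hT : T₁ ≤ T₂) :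
    kerMixDeriv α θ T₁ T₂ x * ((T₁ - x) ^ 3 / (2 * (T₁ - w) ^ 2)) ≤ kerMix α θ T₁ T₂ w := by
  obtain ⟨a, ha⟩ : ∃ a, a = T₁ - x := ⟨_, rfl⟩
  obtain ⟨b, hb⟩ : ∃ b, b = T₁ - w := ⟨_, rfl⟩
  obtain ⟨v, hv⟩ : ∃ v, v = T₂ - T₁ := ⟨_, rfl⟩
  have ha0 : 0 < a := by linarith
  have hab : a < b := by linarith
  have hb0 : 0 < b := by linarith
  have hv0 : 0 ≤ v := by linarith
  unfold kerMixDeriv kerMix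
  rw [show T₂ - x = a + v by linarith, show T₂ - w = b + v by linarith, ← ha, ← hb]
  set C := a ^ 3 / (2 * b ^ 2) with hC
  have hC0 : 0 < C := by positivity
  have hmono : MonotoneOn (fun v => C * α * (a + v) ^ (-α - 1) - (b + v) ^ (-α)) (Set.Ici 0) := by
    have hd : ∀ v : ℝ, 0 ≤ v → HasDerivAt
        (fun v => C * α * (a + v) ^ (-α - 1) - (b + v) ^ (-α))
        (C * α * ((-α - 1) * (a + v) ^ (-α - 1 - 1)) - (-α) * (b + v) ^ (-α - 1)) v := by
      intro v hv
      have a1 : HasDerivAt (fun v => (a + v) ^ (-α - 1)) _ v :=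
        ((hasDerivAt_id v).const_add a).rpow_const (p := -α - 1) (Or.inl (by simp; linarith))
      have a2 : HasDerivAt (fun v => (b + v) ^ (-α)) _ v :=
        ((hasDerivAt_id v).const_add b).rpow_const (p := -α) (Or.inl (by simp; linarith))
      refine ((a1.const_mul (C * α)).sub a2).congr_deriv ?_
      simp
    apply monotoneOn_of_hasDerivWithinAt_nonneg (convex_Ici 0)
      (f' := fun v => C * α * ((-α - 1) * (a + v) ^ (-α - 1 - 1)) - (-α) * (b + v) ^ (-α - 1))
    · exact fun v hv => (hd v hv).continuousAt.continuousWithinAt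
    · intro v hv
      rw [interior_Ici] at hv
      exact (hd v (le_of_lt hv)).hasDerivWithinAt
    · intro v hv
      rw [interior_Ici] at hv
      have hv : 0 < v := hv
      have hav : 0 < a + v := by linarith
      have hbv : 0 < b + v := by linarith
      have p : 0 < (a + v) ^ (-α - 1) := Real.rpow_pos_of_pos hav _
      have h1 : (a + v) ^ (-α - 1 - 1) ≤ (a + v) ^ (-α - 1) / a := by
        rw [Real.rpow_sub_one hav.ne']
        exact div_le_div_of_nonneg_left p.le ha0 (by linarith)
      have h2 : (a + v) ^ (-α - 1) ≤ (b / a) ^ 2 * (b + v) ^ (-α - 1) := by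
        have e : (a + v) ^ (-α - 1) = ((b + v) / (a + v)) ^ (α + 1) * (b + v) ^ (-α - 1) := by
          rw [Real.div_rpow hbv.le hav.le, show -α - 1 = -(α + 1) by ring, Real.rpow_neg hav.le,
            Real.rpow_neg hbv.le]
          have := (Real.rpow_pos_of_pos hbv (α + 1)).ne'
          field_simp
        rw [e]
        apply mul_le_mul_of_nonneg_right _ (Real.rpow_nonneg hbv.le _)
        have h3 : (b + v) / (a + v) ≤ b / a := by
          rw [div_le_div_iff₀ hav ha0]; nlinarith
        have h4 : 1 ≤ b / a := by rw [le_div_iff₀ ha0]; linarith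
        calc ((b + v) / (a + v)) ^ (α + 1) ≤ (b / a) ^ (α + 1) :=
              Real.rpow_le_rpow (by positivity) h3 (by linarith)
          _ ≤ (b / a) ^ (2 : ℝ) := Real.rpow_le_rpow_of_exponent_le h4 (by linarith)
          _ = (b / a) ^ 2 := by norm_cast
      have h5 : C * ((α + 1) * (a + v) ^ (-α - 1 - 1)) ≤ (b + v) ^ (-α - 1) := by
        calc C * ((α + 1) * (a + v) ^ (-α - 1 - 1))
            ≤ C * (2 * ((b / a) ^ 2 * (b + v) ^ (-α - 1) / a)) := by
              apply mul_le_mul_of_nonneg_left _ hC0.le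
              apply mul_le_mul (by linarith) _ (Real.rpow_nonneg hav.le _) (by norm_num)
              exact h1.trans (div_le_div_of_nonneg_right h2 ha0.le)
          _ = (b + v) ^ (-α - 1) := by
              rw [hC]; field_simp
      nlinarith
  have h0 : C * α * a ^ (-α - 1) ≤ b ^ (-α) := by
    have e : a ^ (-α) = (b / a) ^ α * b ^ (-α) := by
      rw [Real.div_rpow hb0.le ha0.le, Real.rpow_neg ha0.le, Real.rpow_neg hb0.le]
      have := (Real.rpow_pos_of_pos hb0 α).ne'
      field_simp
    have h4 : 1 ≤ b / a := by rw [le_div_iff₀ ha0]; linarith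
    have h1 : (b / a) ^ α ≤ b / a := by
      calc (b / a) ^ α ≤ (b / a) ^ (1 : ℝ) := Real.rpow_le_rpow_of_exponent_le h4 hα1.le
        _ = b / a := Real.rpow_one _
    rw [Real.rpow_sub_one ha0.ne', e]
    have hp : 0 < b ^ (-α) := Real.rpow_pos_of_pos hb0 _
    have hCa : C * α * (b / a) / a ≤ 1 := by
      have : C * α * (b / a) / a = α * a / (2 * b) := by
        rw [hC]; field_simp
      rw [this, div_le_one (by positivity)]
      nlinarith
    calc C * α * ((b / a) ^ α * b ^ (-α) / a) = C * α * (b / a) ^ α / a * b ^ (-α) := by ring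
      _ ≤ 1 * b ^ (-α) := by
        apply mul_le_mul_of_nonneg_right _ hp.le
        refine le_trans ?_ hCa
        gcongr
      _ = _ := one_mul _
  have h1 := hmono (Set.mem_Ici.2 le_rfl) (Set.mem_Ici.2 hv0) hv0
  simp only [add_zero] at h1
  nlinarith [mul_nonneg (sub_nonneg.2 hθ1) (sub_nonneg.2 h0), mul_le_mul_of_nonneg_left h1 hθ]

omit hθ1 in
-- The right side is a difference of the single kernel over a shift of length T₁ - y, at least that
-- length times its slope at w by convexity. The slope at w is compared with the one at x through a
-- ratio at most 1, whose exponent α + 1 is at most 2.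
theorem kerMix_one_ge_mul_deriv {w x y T₁ T₂ : ℝ} (hwx : w < x) (hxy : x < y) (hy : y < T₁)
    (hT : T₁ ≤ T₂) :
    kerMixDeriv α θ T₁ T₂ x * ((T₁ - y) * ((T₁ - x) / (T₁ - w)) ^ 2) ≤ kerMix α 1 y T₁ w := by
  have h1 := kerMix_sub_monotoneOn hα0.le le_rfl (zero_le_one) (le_refl T₁) (p := w)
    (b := w + (T₁ - y)) (by linarith) (Set.left_mem_Icc.2 (by linarith))
    (Set.right_mem_Icc.2 (by linarith)) (by linarith)
  simp only [kerMix, kerMixDeriv, zero_mul, sub_zero] at h1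
  rw [show T₁ - (w + (T₁ - y)) = y - w by ring] at h1
  have ha0 : 0 < T₁ - x := by linarith
  have hb0 : 0 < T₁ - w := by linarith
  have h2 : kerMixDeriv α θ T₁ T₂ x ≤ α * (T₁ - x) ^ (-α - 1) := by
    unfold kerMixDeriv
    apply mul_le_mul_of_nonneg_left _ hα0.le
    have := mul_nonneg hθ (Real.rpow_nonneg (by linarith : 0 ≤ T₂ - x) (-α - 1))
    linarith
  have h3 : (T₁ - x) ^ (-α - 1) * ((T₁ - x) / (T₁ - w)) ^ 2 ≤ (T₁ - w) ^ (-α - 1) := by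
    have e : (T₁ - w) ^ (-α - 1) =
        (T₁ - x) ^ (-α - 1) * ((T₁ - x) / (T₁ - w)) ^ (α + 1) := by
      rw [Real.div_rpow ha0.le hb0.le, show -α - 1 = -(α + 1) by ring, Real.rpow_neg ha0.le,
        Real.rpow_neg hb0.le]
      have := (Real.rpow_pos_of_pos ha0 (α + 1)).ne'
      field_simp
    rw [e]
    apply mul_le_mul_of_nonneg_left _ (Real.rpow_nonneg ha0.le _)
    have h4 : (T₁ - x) / (T₁ - w) ≤ 1 := by rw [div_le_one hb0]; linarith
    calc ((T₁ - x) / (T₁ - w)) ^ 2 = ((T₁ - x) / (T₁ - w)) ^ (2 : ℝ) := by norm_cast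
      _ ≤ _ := Real.rpow_le_rpow_of_exponent_ge (by positivity) h4 (by linarith)
  have hV : 0 < T₁ - y := by linarith
  have h5 : kerMixDeriv α θ T₁ T₂ x * ((T₁ - y) * ((T₁ - x) / (T₁ - w)) ^ 2) ≤
      α * (T₁ - x) ^ (-α - 1) * ((T₁ - y) * ((T₁ - x) / (T₁ - w)) ^ 2) :=
    mul_le_mul_of_nonneg_right h2 (by positivity)
  have h6 := mul_le_mul_of_nonneg_left h3 (mul_nonneg hα0.le hV.le)
  unfold kerMix
  linarith

/-- The coefficient of (X - Y)² can be negative, since no upper bound ties the second ratio to the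
first. It is applied with X = v₃ - v₀ and Y = v₂ - v₀, so that (X - Y)² is the square of the third
increment and the terms in X² and Y² are the squares saved from the telescoping. -/
theorem third_row_nonneg {w x y z T₂ : ℝ} (hwx : w < x) (hxy : x < y) (hyz : y < z)
    (hT : z ≤ T₂) (hr : 0.3563 ≤ (y - x) / (x - w)) (X Y : ℝ) :
    0 ≤ (2 * rightWeight x y z (kerMix α θ z T₂) - rightWeight w x y (kerMix α θ z T₂)
        + (leftWeight x y z (kerMix α θ z T₂) + kerMix α θ z T₂ y)) * (X - Y) ^ 2
      + -leftWeight w x y (kerMix α θ z T₂) * X ^ 2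
      + -leftWeight w x y (kerMix α 1 y z) * Y ^ 2 := by
  set m := kerMixDeriv α θ z T₂ x with hm
  have hm0 : 0 ≤ m := kerMixDeriv_nonneg hα0.le hθ hθ1 hT (hxy.trans hyz)
  have hmono := kerMix_sub_monotoneOn hα0.le hθ hθ1 hT (p := x) hyz
  have hint := kerMix_intervalIntegrable (α := α) (θ := θ) hT hxy.le hyz
  have b1 := rightWeight_ge hxy hyz hint hmono
  have b2 := leftWeight_add_right_ge hxy hyz hint hmono
  have b3 := rightWeight_kerMix_le hα0 hθ hθ1 hwx hxy (hxy.trans hyz) hT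
  have b4 := kerMix_ge_mul_deriv hα0 hα1 hθ hθ1 hwx (hxy.trans hyz) hT
  have b5 := kerMix_one_ge_mul_deriv hα0 hα1 hθ hwx hxy hyz hT
  have b6 := neg_leftWeight_kerMix_ge hα0.le hθ hθ1 hT hwx hxy (hxy.trans hyz)
  have b7 := neg_leftWeight_kerMix_ge hα0.le zero_le_one le_rfl hyz.le hwx hxy hxy
  obtain ⟨L, hL⟩ : ∃ L, L = x - w := ⟨_, rfl⟩
  obtain ⟨τ, hτ⟩ : ∃ τ, τ = y - x := ⟨_, rfl⟩
  obtain ⟨V, hV⟩ : ∃ V, V = z - y := ⟨_, rfl⟩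
  have hL0 : 0 < L := by linarith
  have hτ0 : 0 < τ := by linarith
  have hV0 : 0 < V := by linarith
  rw [show y - w = L + τ by linarith, show z - w = L + τ + V by linarith, ← hL, ← hτ] at b3
  rw [show z - x = τ + V by linarith, ← hτ, ← hV] at b1 b2
  rw [show z - x = τ + V by linarith, show z - w = L + τ + V by linarith] at b4 b5
  rw [← hV] at b5
  rw [← hL, ← hτ] at hr
  have hq : 0 < V / τ := div_pos hV0 hτ0
  have key := slack_ratio_bound hr hq
  set A := (τ + V) ^ 3 / (2 * (L + τ + V) ^ 2) with hA
  set B := V * ((τ + V) / (L + τ + V)) ^ 2 with hB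
  have hA0 : 0 < A := by positivity
  have hB0 : 0 < B := by positivity
  -- The deficit per unit slope J'(x); A and B are the credits of the two spare squares in the same
  -- unit.
  obtain ⟨δ, hδ⟩ : ∃ δ, δ = L ^ 3 / (6 * (τ * (L + τ))) * (1 - L / (2 * (L + τ + V)))
    - 2 * (τ ^ 3 / (6 * (V * (τ + V)))) - τ * (4 * τ + 3 * V) / (6 * (τ + V)) := ⟨_, rfl⟩
  have hδle : δ * (A + B) ≤ A * B := by
    have e1 : δ * (A + B) = ((1 / ((τ / L) ^ 2 * (1 + τ / L)) * ((1 + 2 * (τ / L * (1 + V / τ)))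
        / (2 * (1 + τ / L * (1 + V / τ)))) - 2 / (V / τ * (1 + V / τ))
        - (4 + 3 * (V / τ)) / (1 + V / τ)) * (1 + 3 * (V / τ))) *
        (τ ^ 2 / 12 * ((τ + V) / (L + τ + V)) ^ 2) := by
      rw [hδ, hA, hB]
      field_simp
      ring
    have e2 : A * B = 6 * (V / τ * (1 + V / τ)) *
        (τ / L * (1 + V / τ) / (1 + τ / L * (1 + V / τ))) ^ 2 *
        (τ ^ 2 / 12 * ((τ + V) / (L + τ + V)) ^ 2) := by
      rw [hA, hB]
      field_simp
      ring
    rw [e1, e2]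
    exact mul_le_mul_of_nonneg_right key (by positivity)
  have hfin := mul_nonneg hm0 (sub_nonneg.2 (sq_add_sq_ge (X := X) (Y := Y) hA0 hB0 hδle))
  have hD : -(m * δ) ≤ 2 * rightWeight x y z (kerMix α θ z T₂) - rightWeight w x y (kerMix α θ z T₂)
        + (leftWeight x y z (kerMix α θ z T₂) + kerMix α θ z T₂ y) := by
    have : -(m * δ) = 2 * (m * τ ^ 3 / (6 * (V * (τ + V))))
        - m * L ^ 3 / (6 * (τ * (L + τ))) * (1 - L / (2 * (L + τ + V)))
        + m * (τ * (4 * τ + 3 * V) / (6 * (τ + V))) := by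
      rw [hδ]; ring
    rw [this]
    linarith
  have c1 := mul_le_mul_of_nonneg_right hD (sq_nonneg (X - Y))
  have c2 := mul_le_mul_of_nonneg_right (b4.trans b6) (sq_nonneg X)
  have c3 := mul_le_mul_of_nonneg_right (b5.trans b7) (sq_nonneg Y)
  nlinarith only [hfin, c1, c2, c3]

end

/-! ### Monotonicity of the history coefficients -/

theorem intervalIntegrable_rpow_of_lt {α l r T : ℝ} (hlr : l ≤ r) (hr : r < T) :
    IntervalIntegrable (fun s => (T - s) ^ (-α)) volume l r := by
  have := kerMix_intervalIntegrable (α := α) (θ := 0) (le_refl T) hlr hr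
  have e : kerMix α 0 T T = fun s => (T - s) ^ (-α) := by
    ext s; simp [kerMix]
  rwa [e] at this

theorem leftWeight_kerMix {α θ x y z T₁ T₂ : ℝ} (hxy : x ≤ y) (h₁ : y < T₁) (h₂ : y < T₂) :
    leftWeight x y z (kerMix α θ T₁ T₂) = leftWeight x y z (fun s => (T₁ - s) ^ (-α))
      - θ * leftWeight x y z (fun s => (T₂ - s) ^ (-α)) := by
  unfold leftWeight kerMix
  rw [← intervalIntegral.integral_const_mul, ← intervalIntegral.integral_sub]
  · congr 1; ext s; ring
  · exact (intervalIntegrable_rpow_of_lt hxy h₁).continuousOn_mul (by fun_prop)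
  · exact ((intervalIntegrable_rpow_of_lt hxy h₂).continuousOn_mul (by fun_prop)).const_mul _

theorem rightWeight_kerMix {α θ x y z T₁ T₂ : ℝ} (hxy : x ≤ y) (h₁ : y < T₁) (h₂ : y < T₂) :
    rightWeight x y z (kerMix α θ T₁ T₂) = rightWeight x y z (fun s => (T₁ - s) ^ (-α))
      - θ * rightWeight x y z (fun s => (T₂ - s) ^ (-α)) := by
  unfold rightWeight kerMix
  rw [← intervalIntegral.integral_const_mul, ← intervalIntegral.integral_sub]
  · congr 1; ext s; ring
  · exact (intervalIntegrable_rpow_of_lt hxy h₁).continuousOn_mul (by fun_prop)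
  · exact ((intervalIntegrable_rpow_of_lt hxy h₂).continuousOn_mul (by fun_prop)).const_mul _

/-- The functional of the kernel that represents `histCoeff`. -/
noncomputable def histFun (t : ℕ → ℝ) (J : ℝ → ℝ) : ℕ → ℝ
  | 0 => 0
  | 1 => -leftWeight (t 0) (t 1) (t 2) J
  | i + 2 => rightWeight (t i) (t (i + 1)) (t (i + 2)) J
      - leftWeight (t (i + 1)) (t (i + 2)) (t (i + 3)) J

section
variable {t : ℕ → ℝ} (ht : StrictMono t) (α : ℝ)
include ht

theorem histCoeff_eq_histFun {k j : ℕ} (h : j < k) :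
    histCoeff α t k j = histFun t (fun s => (t k - s) ^ (-α)) j := by
  match j with
  | 0 => simp [histCoeff, histFun]
  | 1 =>
    simp only [histCoeff, histFun, one_ne_zero, if_false, if_true]
    rw [coeffA_eq_leftWeight ht α (i := 0) h]
  | i + 2 =>
    simp only [histCoeff, histFun, coeffD]
    rw [if_neg (by lia), if_neg (by lia), show i + 2 - 1 = i + 1 by lia,
      coeffC_eq_rightWeight ht α (by lia), coeffA_eq_leftWeight ht α (i := i + 1) h]

/-- θ = 0 gives a single row and θ = 1 the difference of two rows, so one positivity statement
serves both. -/
theorem histFun_kerMix (θ : ℝ) {k k' j : ℕ} (h : j < k) (h' : j < k') :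
    histFun t (kerMix α θ (t k) (t k')) j = histCoeff α t k j - θ * histCoeff α t k' j := by
  rw [histCoeff_eq_histFun ht α h, histCoeff_eq_histFun ht α h']
  match j with
  | 0 => simp [histFun]
  | 1 =>
    simp only [histFun]
    rw [leftWeight_kerMix (ht zero_lt_one).le (ht h) (ht h')]
    ring
  | i + 2 =>
    simp only [histFun]
    rw [leftWeight_kerMix (ht (Nat.lt_succ_self _)).le (ht h) (ht h'),
      rightWeight_kerMix (ht (Nat.lt_succ_self _)).le (ht (by lia)) (ht (by lia))]
    ring

variable {α} {θ : ℝ} (hα0 : 0 < α) (hθ : 0 ≤ θ) (hθ1 : θ ≤ 1)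
  (hρ : ∀ i, 0.3563 ≤ stepRatio t (i + 2))
include hα0 hθ hθ1 hρ

omit hα0 hθ hθ1 in
theorem cube_le_of_ratio (i : ℕ) : t (i + 1) - t i ≤ 2.8067 * (t (i + 2) - t (i + 1)) := by
  have h := hρ i
  unfold stepRatio at h
  rw [show i + 2 - 1 = i + 1 by lia, le_div_iff₀ (timeStep_pos ht i),
    show timeStep t (i + 2) = _ from timeStep_succ t (i + 1), timeStep_succ] at h
  have h1 := ht (Nat.lt_succ_self i)
  have h2 := ht (Nat.lt_succ_self (i + 1))
  simp only [Nat.succ_eq_add_one, add_assoc, Nat.reduceAdd] at h h1 h2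
  linarith

/-- The first two increments need only that the kernel is nonnegative and nondecreasing. The later
ones involve the right weight of the preceding interval with a minus sign and use convexity together
with the lower bound on the ratios. -/
theorem histFun_incr_nonneg {T₁ T₂ : ℝ} (hT : T₁ ≤ T₂) (i : ℕ) (hi : t (i + 1) < T₁) :
    0 ≤ histFun t (kerMix α θ T₁ T₂) (i + 1) - histFun t (kerMix α θ T₁ T₂) i := by
  match i with
  | 0 =>
    simp only [histFun, sub_zero]
    exact (kerMix_nonneg hα0.le hθ hθ1 hT ((ht zero_lt_one).trans hi)).trans
      (neg_leftWeight_kerMix_ge hα0.le hθ hθ1 hT (ht zero_lt_one) (ht one_lt_two) hi)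
  | 1 =>
    simp only [histFun, zero_add, Nat.reduceAdd] at hi ⊢
    have h1 := (ht one_lt_two).trans hi
    have a1 := rightWeight_kerMix_nonneg hα0.le hθ hθ1 hT (ht zero_lt_one) (ht one_lt_two) h1
    have a2 := leftWeight_kerMix_add_nonneg hα0.le hθ hθ1 hT (ht zero_lt_one) (ht one_lt_two) h1
    have a3 := neg_leftWeight_kerMix_ge hα0.le hθ hθ1 hT (ht one_lt_two)
      (ht (by norm_num : 2 < 3)) hi
    linarith
  | i + 2 =>
    simp only [histFun, add_assoc, Nat.reduceAdd] at hi ⊢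
    have l1 : t i < t (i + 1) := ht (by lia)
    have l2 : t (i + 1) < t (i + 2) := ht (by lia)
    have l3 : t (i + 2) < t (i + 3) := ht (by lia)
    have l4 : t (i + 3) < t (i + 4) := ht (by lia)
    refine interp_weights_kerMix_diff_nonneg hα0.le hθ hθ1 hT l1 l2 l3 l4 hi ?_
    have h := cube_le_of_ratio ht hρ i
    generalize hL : t (i + 1) - t i = L at *
    generalize hτ : t (i + 2) - t (i + 1) = τ at *
    generalize hV : t (i + 3) - t (i + 2) = V at *
    rw [show t (i + 2) - t i = L + τ by linarith]
    have hL0 : 0 < L := by linarith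
    have hτ0 : 0 < τ := by linarith
    have hV0 : 0 < V := by linarith
    -- With L ≤ 2.8067 τ the quotient is at most 2.8067³/3.8067 < 5.82 times τ. This matches 3τ +
    -- 2.82τ, where 2.82 lies just below the constant 2√2 of the arithmetic-geometric mean.
    have h1 : L ^ 3 / (τ * (L + τ)) ≤ 5.82 * τ := by
      rw [div_le_iff₀ (by positivity)]
      have e1 : L ^ 2 ≤ 2.8067 * τ * L := by nlinarith
      have e2 : L ^ 3 ≤ 2.8067 * τ * (2.8067 * τ * L) := by
        calc L ^ 3 = L * L ^ 2 := by ring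
          _ ≤ (2.8067 * τ) * (2.8067 * τ * L) := mul_le_mul h e1 (by positivity) (by positivity)
      have e3 : 0 ≤ τ ^ 2 * (2.8067 * τ - L) := by
        apply mul_nonneg (by positivity); linarith
      nlinarith [mul_pos (pow_pos hτ0 2) hL0]
    have h2 : 2.82 * τ ≤ τ ^ 2 / V + 2 * V := by
      rw [div_add' _ _ _ hV0.ne', le_div_iff₀ hV0]
      nlinarith [sq_nonneg (τ - 1.41 * V)]
    linarith

omit hθ hθ1 in
/-- The increments of `histCoeff` in the second index are nonnegative. -/
theorem histCoeff_incr_nonneg {k i : ℕ} (h : i + 1 < k) :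
    histCoeff α t k i ≤ histCoeff α t k (i + 1) := by
  have := histFun_incr_nonneg ht hα0 le_rfl zero_le_one hρ (le_refl (t k)) i (ht h)
  rw [histFun_kerMix ht α 0 h h, histFun_kerMix ht α 0 (by lia) (by lia)] at this
  linarith

omit hθ hθ1 in
/-- The increments of `histCoeff` in the second index decrease with the first one. -/
theorem histCoeff_incr_anti {k i : ℕ} (h : i + 1 < k) :
    histCoeff α t (k + 1) (i + 1) - histCoeff α t (k + 1) i ≤
      histCoeff α t k (i + 1) - histCoeff α t k i := by
  have := histFun_incr_nonneg ht hα0 zero_le_one le_rfl hρ (ht (Nat.lt_succ_self k)).le i (ht h)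
  rw [histFun_kerMix ht α 1 h (by lia), histFun_kerMix ht α 1 (by lia) (by lia)] at this
  linarith

end

/-! ### Remaining diagonal weights -/

/-- Twice the diagonal coefficients of `Γ(1 - α) L_k^α`. -/
noncomputable def diagCoeff (α : ℝ) (t : ℕ → ℝ) (k : ℕ) : ℝ :=
  if k = 1 then 2 * (1 - α)⁻¹ * timeStep t 1 ^ (-α)
  else 2 * (coeffC α t k k + coeffC α t k (k - 1))

/-- The functional of the kernel that bounds the row sums from below. -/
noncomputable def rowFun (w x y z : ℝ) (J : ℝ → ℝ) : ℝ :=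
  2 * rightWeight x y z J - rightWeight w x y J + (leftWeight x y z J + J y)

section
variable {t : ℕ → ℝ} (ht : StrictMono t) {α : ℝ} (hα0 : 0 < α) (hα1 : α < 1)
include ht hα0 hα1

/-- The two kernel values are those subtracted here and added back in `rowFun`, where J(y)
compensates the nonpositive left weight. What is left on this side has a closed form. -/
theorem explicit_row (i : ℕ) :
    (1 - α) * (2 - α) * (2 * coeffC α t (i + 2) (i + 2) + coeffA α t (i + 3) (i + 2)
      - coeffA α t (i + 3) (i + 3) - (t (i + 2) - t (i + 1)) ^ (-α)
      + (t (i + 3) - t (i + 1)) ^ (-α)) =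
    α * timeStep t (i + 2) ^ (-α) * (ratioTerm α (stepRatio t (i + 3))
      + 2 * stepRatio t (i + 2) / (1 + stepRatio t (i + 2))) := by
  have e1 := coeffC_self_eq ht hα1 i
  have e2 := coeffA_pred_eq ht hα1 (i + 1)
  have e3 := coeffA_self_eq ht hα1 (i + 1)
  simp only [add_assoc, Nat.reduceAdd] at e2 e3
  have hτ := timeStep_pos ht (i + 1)
  have hτ' := timeStep_eq_mul_stepRatio ht (i + 1)
  have hq := stepRatio_pos ht (i + 1)
  simp only [add_assoc, Nat.reduceAdd] at hτ hτ' hq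
  have e4 : t (i + 2) - t (i + 1) = timeStep t (i + 2) := (timeStep_succ t (i + 1)).symm
  have e5 : t (i + 3) - t (i + 1) = timeStep t (i + 2) * (1 + stepRatio t (i + 3)) := by
    have h3 : timeStep t (i + 3) = t (i + 3) - t (i + 2) := timeStep_succ t (i + 2)
    linarith
  rw [e4, e5, Real.mul_rpow hτ.le (by linarith)]
  rw [hτ', Real.mul_rpow hτ.le hq.le] at e3
  have hr := stepRatio_pos ht i
  generalize timeStep t (i + 2) ^ (-α) = A at *
  generalize stepRatio t (i + 3) = q at *
  generalize stepRatio t (i + 2) = r at *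
  have e6 : q ^ (-α) * q ^ 2 = q ^ (2 - α) := by
    rw [show 2 - α = -α + (2 : ℕ) by push_cast; ring, Real.rpow_add hq, Real.rpow_natCast]
  have e7 : (1 + q) ^ α = ((1 + q) ^ (-α))⁻¹ := by
    rw [Real.rpow_neg (by linarith), inv_inv]
  have hB : (1 + q) ^ (-α) ≠ 0 := (Real.rpow_pos_of_pos (by linarith) _).ne'
  have e3' : (1 - α) * (2 - α) * coeffA α t (i + 3) (i + 3) =
      A * (α * q ^ (2 - α) / (1 + q)) := by
    rw [e3, ← e6]; ring
  have e8 : (1 - α) * (2 - α) * (2 * coeffC α t (i + 2) (i + 2) + coeffA α t (i + 3) (i + 2)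
      - coeffA α t (i + 3) (i + 3) - A + A * (1 + q) ^ (-α)) =
      2 * (A * (2 - α + α * r / (1 + r))) + A * ((1 + q) ^ (-α) * (α * q - 2 + 2 * α)
        - α * q ^ (2 - α) / (1 + q)) - A * (α * q ^ (2 - α) / (1 + q))
        + (1 - α) * (2 - α) * (A * (1 + q) ^ (-α) - A) := by
    rw [← e1, ← e2, ← e3']; ring
  rw [e8]
  unfold ratioTerm
  rw [e7]
  generalize (1 + q) ^ (-α) = B at *
  generalize q ^ (2 - α) = D at *
  have h1 : 1 + q ≠ 0 := by linarith
  have h2 : 1 + r ≠ 0 := by linarith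
  field_simp
  ring

omit hα0 hα1 in
theorem lastRow_eq (i : ℕ) :
    lastRow (histCoeff α t) (diagCoeff α t) (fun k => coeffA α t k k) (i + 3) =
      2 * coeffC α t (i + 3) (i + 3) - coeffA α t (i + 3) (i + 3)
        - (t (i + 3) - t (i + 2)) ^ (-α)
        + rowFun (t i) (t (i + 1)) (t (i + 2)) (t (i + 3))
          (kerMix α 0 (t (i + 3)) (t (i + 3))) := by
  have l1 : t i < t (i + 1) := ht (by lia)
  have l2 : t (i + 1) < t (i + 2) := ht (by lia)
  have l3 : t (i + 2) < t (i + 3) := ht (by lia)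
  unfold lastRow rowFun diagCoeff
  rw [if_neg (by lia), show i + 3 - 1 = i + 2 by lia, histCoeff_eq_histFun ht α (by lia),
    leftWeight_kerMix l2.le l3 l3, rightWeight_kerMix l2.le l3 l3,
    rightWeight_kerMix l1.le (l2.trans l3) (l2.trans l3),
    coeffC_eq_rightWeight ht α (i := i + 1) (by lia)]
  simp only [histFun, kerMix]
  ring

omit hα1 in
-- The two sides differ by one right weight of the later kernel, which is nonnegative; dropping it
-- lets the mixed kernel with θ = 1 enter all terms of `rowFun`.
theorem innerRow_ge (i : ℕ) :
    2 * coeffC α t (i + 3) (i + 3) - coeffA α t (i + 3) (i + 3) + coeffA α t (i + 4) (i + 3)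
        - coeffA α t (i + 4) (i + 4) - (t (i + 3) - t (i + 2)) ^ (-α)
        + (t (i + 4) - t (i + 2)) ^ (-α)
        + rowFun (t i) (t (i + 1)) (t (i + 2)) (t (i + 3))
          (kerMix α 1 (t (i + 3)) (t (i + 4))) ≤
    innerRow (histCoeff α t) (diagCoeff α t) (fun k => coeffA α t k k) (i + 3) := by
  have l1 : t i < t (i + 1) := ht (by lia)
  have l2 : t (i + 1) < t (i + 2) := ht (by lia)
  have l3 : t (i + 2) < t (i + 3) := ht (by lia)
  have l4 : t (i + 3) < t (i + 4) := ht (by lia)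
  have h := rightWeight_kerMix_nonneg hα0.le le_rfl zero_le_one (le_refl (t (i + 4))) l2 l3
    (l3.trans l4)
  rw [rightWeight_kerMix l2.le (l3.trans l4) (l3.trans l4)] at h
  unfold innerRow
  rw [lastRow_eq ht i]
  unfold rowFun
  rw [show i + 3 - 1 = i + 2 by lia, show i + 3 + 1 = i + 4 by lia,
    histCoeff_eq_histFun ht α (by lia), histCoeff_eq_histFun ht α (by lia),
    leftWeight_kerMix l2.le l3 l3, rightWeight_kerMix l2.le l3 l3,
    rightWeight_kerMix l1.le (l2.trans l3) (l2.trans l3),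
    leftWeight_kerMix l2.le l3 (l3.trans l4), rightWeight_kerMix l2.le l3 (l3.trans l4),
    rightWeight_kerMix l1.le (l2.trans l3) (l2.trans (l3.trans l4)),
    coeffA_eq_leftWeight ht α (k := i + 4) (i := i + 2) (by lia)]
  simp only [histFun, kerMix]
  simp only [add_assoc, Nat.reduceAdd]
  linarith

theorem last_explicit (i : ℕ) :
    (1 - α) * (2 - α) * (2 * coeffC α t (i + 3) (i + 3) - coeffA α t (i + 3) (i + 3)
      - (t (i + 3) - t (i + 2)) ^ (-α)) =
    α / timeStep t (i + 3) ^ α * ((1 + α) * (2 - α) / α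
      - stepRatio t (i + 3) * (stepRatio t (i + 3) - 2) / (1 + stepRatio t (i + 3))) := by
  have e1 := coeffC_self_eq ht hα1 (i + 1)
  have e3 := coeffA_self_eq ht hα1 (i + 1)
  simp only [add_assoc, Nat.reduceAdd] at e1 e3
  have hτ : 0 < timeStep t (i + 3) := timeStep_pos ht (i + 2)
  have hr : 0 < stepRatio t (i + 3) := stepRatio_pos ht (i + 1)
  have e4 : t (i + 3) - t (i + 2) = timeStep t (i + 3) := (timeStep_succ t (i + 2)).symm
  rw [e4, div_eq_mul_inv α, ← Real.rpow_neg hτ.le, mul_sub, mul_sub, e3]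
  rw [show (1 - α) * (2 - α) * (2 * coeffC α t (i + 3) (i + 3)) =
    2 * ((1 - α) * (2 - α) * coeffC α t (i + 3) (i + 3)) by ring, e1]
  generalize timeStep t (i + 3) ^ (-α) = A at *
  generalize stepRatio t (i + 3) = r at *
  have h2 : 1 + r ≠ 0 := by linarith
  field_simp
  ring

theorem inner_explicit (i : ℕ) :
    (1 - α) * (2 - α) * (2 * coeffC α t (i + 3) (i + 3) - coeffA α t (i + 3) (i + 3)
      + coeffA α t (i + 4) (i + 3) - coeffA α t (i + 4) (i + 4)
      - (t (i + 3) - t (i + 2)) ^ (-α) + (t (i + 4) - t (i + 2)) ^ (-α)) =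
    α / timeStep t (i + 3) ^ α * (ratioTerm α (stepRatio t (i + 4))
      - stepRatio t (i + 3) * (stepRatio t (i + 3) - 2) / (1 + stepRatio t (i + 3))) := by
  have e1 := explicit_row ht hα0 hα1 (i + 1)
  have e3 := coeffA_self_eq ht hα1 (i + 1)
  simp only [add_assoc, Nat.reduceAdd] at e1 e3
  have hτ : 0 < timeStep t (i + 3) := timeStep_pos ht (i + 2)
  have hr : 0 < stepRatio t (i + 3) := stepRatio_pos ht (i + 1)
  rw [div_eq_mul_inv α, ← Real.rpow_neg hτ.le]
  have : (1 - α) * (2 - α) * (2 * coeffC α t (i + 3) (i + 3) - coeffA α t (i + 3) (i + 3)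
      + coeffA α t (i + 4) (i + 3) - coeffA α t (i + 4) (i + 4)
      - (t (i + 3) - t (i + 2)) ^ (-α) + (t (i + 4) - t (i + 2)) ^ (-α)) =
      (1 - α) * (2 - α) * (2 * coeffC α t (i + 3) (i + 3)
      + coeffA α t (i + 4) (i + 3) - coeffA α t (i + 4) (i + 4)
      - (t (i + 3) - t (i + 2)) ^ (-α) + (t (i + 4) - t (i + 2)) ^ (-α))
      - (1 - α) * (2 - α) * coeffA α t (i + 3) (i + 3) := by ring
  rw [this, e1, e3]
  generalize timeStep t (i + 3) ^ (-α) = A at *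
  generalize stepRatio t (i + 3) = r at *
  have h2 : 1 + r ≠ 0 := by linarith
  field_simp
  ring

end

section
variable {t : ℕ → ℝ} (ht : StrictMono t) {α : ℝ} (hα0 : 0 < α) (hα1 : α < 1)
include ht hα0

/-- The ratio hypothesis is the step condition of `interp_weights_kerMix_nonneg` divided by the
first step length and cleared of denominators. -/
theorem rowFun_nonneg {θ T₁ T₂ : ℝ} (hθ : 0 ≤ θ) (hθ1 : θ ≤ 1) (hT : T₁ ≤ T₂) (i : ℕ)
    (hi : t (i + 2) < T₁)
    (h : stepRatio t (i + 3) * (1 - 3 * (stepRatio t (i + 2) ^ 2 * (1 + stepRatio t (i + 2)))) ≤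
      stepRatio t (i + 2) ^ 2 * (1 + stepRatio t (i + 2))) :
    0 ≤ rowFun (t i) (t (i + 1)) (t (i + 2)) (t (i + 3)) (kerMix α θ T₁ T₂) := by
  have l1 : t i < t (i + 1) := ht (by lia)
  have l2 : t (i + 1) < t (i + 2) := ht (by lia)
  have l3 : t (i + 2) < t (i + 3) := ht (by lia)
  have h1 := rightWeight_kerMix_nonneg hα0.le hθ hθ1 hT l2 l3 hi
  have h2 := interp_weights_kerMix_nonneg hα0.le hθ hθ1 hT l1 l2 l3 hi (by
    have hL := timeStep_pos ht i
    have hr := stepRatio_pos ht i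
    have hs := stepRatio_pos ht (i + 1)
    have e1 := timeStep_eq_mul_stepRatio ht i
    have e2 := timeStep_eq_mul_stepRatio ht (i + 1)
    have f0 := timeStep_succ t i
    have f1 := timeStep_succ t (i + 1)
    have f2 := timeStep_succ t (i + 2)
    simp only [add_assoc, Nat.reduceAdd] at hs e1 e2 f1 f2
    rw [show t (i + 2) - t i = timeStep t (i + 1) + timeStep t (i + 2) by linarith,
      ← f0, ← f1, ← f2, e2, e1]
    generalize timeStep t (i + 1) = L at *
    generalize stepRatio t (i + 2) = r at *
    generalize stepRatio t (i + 3) = s at *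
    have g1 : L ^ 3 / (L * r * (L + L * r)) = L * (1 / (r * (1 + r))) := by
      field_simp
    have g2 : 3 * (L * r) + (L * r) ^ 2 / (L * r * s) = L * (3 * r + r / s) := by
      field_simp
    rw [g1, g2]
    refine mul_le_mul_of_nonneg_left ?_ hL.le
    rw [div_le_iff₀ (by positivity), ← sub_nonneg]
    have g3 : (3 * r + r / s) * (r * (1 + r)) - 1 =
        (r ^ 2 * (1 + r) - s * (1 - 3 * (r ^ 2 * (1 + r)))) / s := by
      field_simp
      ring
    rw [g3]
    exact div_nonneg (by linarith) hs.le)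
  unfold rowFun
  linarith

include hα1

omit ht hα0 in
theorem one_sub_mul_two_sub_pos : 0 < (1 - α) * (2 - α) := by
  have : 0 < 1 - α := by linarith
  have : 0 < 2 - α := by linarith
  positivity

omit ht hα0 hα1 in
theorem gWeight_last (i : ℕ) : gWeight α t (i + 3) (i + 3) =
    α / timeStep t (i + 3) ^ α * ((1 + α) * (2 - α) / α
      - stepRatio t (i + 3) * (stepRatio t (i + 3) - 2) / (1 + stepRatio t (i + 3))) := by
  unfold gWeight
  rw [if_neg (by lia), if_neg (by lia)]

omit ht hα0 hα1 in
theorem gWeight_inner {n i : ℕ} (h : i + 3 < n) : gWeight α t n (i + 3) =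
    α / timeStep t (i + 3) ^ α * (ratioTerm α (stepRatio t (i + 4))
      - stepRatio t (i + 3) * (stepRatio t (i + 3) - 2) / (1 + stepRatio t (i + 3))) := by
  unfold gWeight ratioTerm
  rw [if_neg (by lia), if_pos h]

theorem lastRow_eq_gWeight_add (i : ℕ) :
    (1 - α) * (2 - α) * lastRow (histCoeff α t) (diagCoeff α t) (fun k => coeffA α t k k) (i + 3) =
      gWeight α t (i + 3) (i + 3) + (1 - α) * (2 - α) *
        rowFun (t i) (t (i + 1)) (t (i + 2)) (t (i + 3)) (kerMix α 0 (t (i + 3)) (t (i + 3))) := by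
  rw [lastRow_eq ht i, gWeight_last, ← last_explicit ht hα0 hα1]
  ring

theorem gWeight_add_le_innerRow {n i : ℕ} (h : i + 3 < n) :
    gWeight α t n (i + 3) + (1 - α) * (2 - α) *
        rowFun (t i) (t (i + 1)) (t (i + 2)) (t (i + 3)) (kerMix α 1 (t (i + 3)) (t (i + 4))) ≤
    (1 - α) * (2 - α) *
      innerRow (histCoeff α t) (diagCoeff α t) (fun k => coeffA α t k k) (i + 3) := by
  rw [gWeight_inner h, ← inner_explicit ht hα0 hα1, ← mul_add]
  exact mul_le_mul_of_nonneg_left (innerRow_ge ht hα0 i) (one_sub_mul_two_sub_pos hα1).le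

theorem gWeight_pos_of_ratioCond
    (hratio : ∀ k : ℕ, 3 ≤ k → RatioCond (stepRatio t k) (stepRatio t (k + 1)))
    {n i : ℕ} (h : i + 3 ≤ n) : 0 < gWeight α t n (i + 3) := by
  have c1 := hratio (i + 3) (by lia)
  have hr : 0 < stepRatio t (i + 3) := stepRatio_pos ht (i + 1)
  have hs : 0 < stepRatio t (i + 4) := stepRatio_pos ht (i + 2)
  have hτ : 0 < timeStep t (i + 3) := timeStep_pos ht (i + 2)
  have hτ' : 0 < α / timeStep t (i + 3) ^ α := div_pos hα0 (Real.rpow_pos_of_pos hτ _)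
  have hr' := c1.left_lt
  rcases h.lt_or_eq with h | h
  · have c2 := hratio (i + 4) (by lia)
    have hm := c1.mul_le_upper
    rw [gWeight_inner h]
    refine mul_pos hτ' ?_
    have hq := ratioTerm_ge hα0 hα1 hs c2.left_lt.le
    rw [show i + 3 + 1 = i + 4 by lia] at hm
    generalize stepRatio t (i + 3) = r at *
    generalize stepRatio t (i + 4) = s at *
    -- Cleared of denominators this is the upper constraint for large ratios; strictness comes from
    -- the extra 1 - α in `ratioTerm_ge`.
    have h3 : r * (r - 2) / (1 + r) ≤ 1 + 1 / (1 + s) := by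
      rw [div_le_iff₀ (by linarith), ← sub_nonneg]
      have : (1 + 1 / (1 + s)) * (1 + r) - r * (r - 2) =
          (-r ^ 2 + 4 * r + 2 - s * (r ^ 2 - 3 * r - 1)) / (1 + s) := by
        field_simp
        ring
      rw [this]
      exact div_nonneg (by linarith) (by linarith)
    linarith
  · rw [← h, gWeight_last]
    refine mul_pos hτ' ?_
    generalize stepRatio t (i + 3) = r at *
    have h3 : r * (r - 2) / (1 + r) < 2 := by
      rw [div_lt_iff₀ (by linarith)]
      nlinarith
    have h4 : 2 ≤ (1 + α) * (2 - α) / α := by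
      rw [le_div_iff₀ hα0]
      nlinarith
    linarith

theorem gWeight_le_innerRow
    (hratio : ∀ k : ℕ, 3 ≤ k → RatioCond (stepRatio t k) (stepRatio t (k + 1)))
    {n i : ℕ} (h : i + 4 < n) :
    gWeight α t n (i + 4) ≤ (1 - α) * (2 - α) *
      innerRow (histCoeff α t) (diagCoeff α t) (fun k => coeffA α t k k) (i + 4) := by
  have h1 := gWeight_add_le_innerRow ht hα0 hα1 (i := i + 1) h
  have h2 := rowFun_nonneg ht hα0 zero_le_one le_rfl (ht (Nat.lt_succ_self (i + 4))).le (i + 1)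
    (ht (Nat.lt_succ_self (i + 3))) (hratio (i + 3) (by lia)).mul_le_lower
  have := mul_nonneg (one_sub_mul_two_sub_pos hα1).le h2
  exact le_trans (le_add_of_nonneg_right this) h1

theorem gWeight_le_lastRow
    (hratio : ∀ k : ℕ, 3 ≤ k → RatioCond (stepRatio t k) (stepRatio t (k + 1))) (i : ℕ) :
    gWeight α t (i + 4) (i + 4) ≤ (1 - α) * (2 - α) *
      lastRow (histCoeff α t) (diagCoeff α t) (fun k => coeffA α t k k) (i + 4) := by
  have h1 := lastRow_eq_gWeight_add ht hα0 hα1 (i + 1)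
  have h2 := rowFun_nonneg ht hα0 le_rfl zero_le_one (le_refl (t (i + 4))) (i + 1)
    (ht (Nat.lt_succ_self (i + 3))) (hratio (i + 3) (by lia)).mul_le_lower
  have := mul_nonneg (one_sub_mul_two_sub_pos hα1).le h2
  rw [h1]
  exact le_add_of_nonneg_right this

/-- When the third row is the last one, no later row consumes its first increment, so the whole
coefficient of (v₃ - v₀)² is available: θ = 0. -/
theorem third_lastRow_ge (hρ : 0.3563 ≤ stepRatio t 2) (v : ℕ → ℝ) :
    gWeight α t 3 3 * (v 3 - v 2) ^ 2 ≤ (1 - α) * (2 - α) *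
      (lastRow (histCoeff α t) (diagCoeff α t) (fun k => coeffA α t k k) 3 * (v 3 - v 2) ^ 2
        + histCoeff α t 3 1 * (v 3 - v 0) ^ 2
        + (histCoeff α t 2 1 - histCoeff α t 3 1) * (v 2 - v 0) ^ 2) := by
  have h0 := one_sub_mul_two_sub_pos hα1
  have h1 := lastRow_eq_gWeight_add ht hα0 hα1 0
  have l1 : t 0 < t 1 := ht (by lia)
  have l2 : t 1 < t 2 := ht (by lia)
  have l3 : t 2 < t 3 := ht (by lia)
  have h2 := third_row_nonneg hα0 hα1 le_rfl zero_le_one l1 l2 l3 (le_refl (t 3))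
    (by have := hρ; unfold stepRatio at this; exact this) (v 3 - v 0) (v 2 - v 0)
  have e1 := histFun_kerMix ht α 0 (k := 3) (k' := 3) (j := 1) (by lia) (by lia)
  have e2 := histFun_kerMix ht α 1 (k := 2) (k' := 3) (j := 1) (by lia) (by lia)
  simp only [histFun] at e1 e2
  rw [e1, e2] at h2
  have h3 := mul_nonneg h0.le h2
  simp only [zero_add] at h1
  rw [mul_add, mul_add, ← mul_assoc, h1]
  unfold rowFun
  refine le_of_sub_nonneg (h3.trans_eq ?_)
  ring

theorem third_innerRow_ge (hρ : 0.3563 ≤ stepRatio t 2) {n : ℕ} (hn : 3 < n) (v : ℕ → ℝ) :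
    gWeight α t n 3 * (v 3 - v 2) ^ 2 ≤ (1 - α) * (2 - α) *
      (innerRow (histCoeff α t) (diagCoeff α t) (fun k => coeffA α t k k) 3 * (v 3 - v 2) ^ 2
        + (histCoeff α t 3 1 - histCoeff α t 4 1) * (v 3 - v 0) ^ 2
        + (histCoeff α t 2 1 - histCoeff α t 3 1) * (v 2 - v 0) ^ 2) := by
  have h0 := one_sub_mul_two_sub_pos hα1
  have h1 := gWeight_add_le_innerRow ht hα0 hα1 (i := 0) hn
  have l1 : t 0 < t 1 := ht (by lia)
  have l2 : t 1 < t 2 := ht (by lia)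
  have l3 : t 2 < t 3 := ht (by lia)
  have l4 : t 3 < t 4 := ht (by lia)
  have h2 := third_row_nonneg hα0 hα1 zero_le_one le_rfl l1 l2 l3 l4.le
    (by have := hρ; unfold stepRatio at this; exact this) (v 3 - v 0) (v 2 - v 0)
  have e1 := histFun_kerMix ht α 1 (k := 3) (k' := 4) (j := 1) (by lia) (by lia)
  have e2 := histFun_kerMix ht α 1 (k := 2) (k' := 3) (j := 1) (by lia) (by lia)
  simp only [histFun] at e1 e2
  rw [e1, e2] at h2
  have h3 := mul_nonneg h0.le h2
  simp only [zero_add] at h1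
  have h4 := mul_le_mul_of_nonneg_right h1 (sq_nonneg (v 3 - v 2))
  unfold rowFun at h4
  generalize innerRow (histCoeff α t) (diagCoeff α t) (fun k => coeffA α t k k) 3 = R at *
  refine le_of_sub_nonneg ((add_nonneg (sub_nonneg.2 h4) h3).trans_eq ?_)
  ring

end

/-! ### The leading 2 × 2 block and positivity of the weights -/

/-- The smaller eigenvalue of a positive definite symmetric `2 × 2` matrix is positive. -/
theorem smaller_eigenvalue_pos {a b c : ℝ} (ha : 0 < a) (hb : 0 < b) (hd : c ^ 2 < a * b) :
    0 < (a + b - Real.sqrt ((a - b) ^ 2 + 4 * (c * c))) / 2 := by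
  have : Real.sqrt ((a - b) ^ 2 + 4 * (c * c)) < a + b := by
    rw [Real.sqrt_lt' (by linarith)]
    nlinarith
  linarith

/-- A symmetric `2 × 2` matrix is bounded below by its smaller eigenvalue. -/
theorem smaller_eigenvalue_mul_le (a b c x y : ℝ) :
    (a + b - Real.sqrt ((a - b) ^ 2 + 4 * (c * c))) / 2 * (x ^ 2 + y ^ 2) ≤
      a * x ^ 2 + 2 * c * x * y + b * y ^ 2 := by
  have h0 : 0 ≤ (a - b) ^ 2 + 4 * (c * c) := by nlinarith [sq_nonneg (a - b), sq_nonneg c]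
  have h1 := Real.sq_sqrt h0
  have h2 := Real.sqrt_nonneg ((a - b) ^ 2 + 4 * (c * c))
  set s := Real.sqrt ((a - b) ^ 2 + 4 * (c * c))
  have h3 : |(a - b) * (x ^ 2 - y ^ 2) + 2 * c * (2 * x * y)| ≤ s * (x ^ 2 + y ^ 2) := by
    apply abs_le_of_sq_le_sq _ (by positivity)
    rw [mul_pow, h1]
    nlinarith [sq_nonneg ((a - b) * (2 * x * y) - 2 * c * (x ^ 2 - y ^ 2))]
  nlinarith [neg_le_of_abs_le h3]

section
variable {t : ℕ → ℝ} (ht : StrictMono t) {α : ℝ} (hα0 : 0 < α) (hα1 : α < 1)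
include ht hα0 hα1

theorem matC_zero_zero_ge :
    (2 - α) * timeStep t 1 ^ (-α) * (2 - (1 - α) * stepRatio t 2 ^ (-α)) ≤
      (1 - α) * (2 - α) * matC α t 0 0 := by
  have a12 := coeffA_eq_leftWeight ht α (i := 0) one_lt_two
  simp only [zero_add] at a12
  have h1 := leftWeight_kerMix_add_nonneg hα0.le le_rfl zero_le_one (le_refl (t 2))
    (ht zero_lt_one) (ht one_lt_two) (ht one_lt_two)
  rw [leftWeight_kerMix (ht zero_lt_one).le (ht one_lt_two) (ht one_lt_two),
    ← a12] at h1
  simp only [kerMix, zero_mul, sub_zero] at h1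
  have e1 : t 2 - t 1 = timeStep t 1 * stepRatio t 2 :=
    (timeStep_succ t 1).symm.trans (timeStep_eq_mul_stepRatio ht 0)
  have hτ : 0 < timeStep t 1 := timeStep_pos ht 0
  have hr : 0 < stepRatio t 2 := stepRatio_pos ht 0
  rw [e1, Real.mul_rpow hτ.le hr.le] at h1
  have h2 : 1 - α ≠ 0 := by linarith
  have h0 := one_sub_mul_two_sub_pos hα1
  simp only [matC, Matrix.of_apply, Matrix.cons_val_zero, Matrix.cons_val', Matrix.empty_val',
    Matrix.cons_val_fin_one]
  generalize timeStep t 1 ^ (-α) = A at *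
  generalize stepRatio t 2 ^ (-α) = R at *
  generalize coeffA α t 2 1 = a at *
  have h3 := mul_nonneg h0.le h1
  have e2 : (1 - α) * (2 - α) * (2 * (1 - α)⁻¹ * A - -a) =
      (2 - α) * (2 * A) + (1 - α) * (2 - α) * a := by
    field_simp
    ring
  rw [e2]
  linarith

/-- C₂₂ is the combination of `explicit_row` plus 2 c_1^2 - c_1^3 and (a_1^2 - a_1^3) + J(t₁), where
J is the mixed kernel with θ = 1; both are nonnegative by the weight estimates. -/
theorem matC_one_one_ge :
    α * (timeStep t 1 ^ (-α) * stepRatio t 2 ^ (-α)) * (ratioTerm α (stepRatio t 3)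
      + 2 * stepRatio t 2 / (1 + stepRatio t 2)) ≤ (1 - α) * (2 - α) * matC α t 1 1 := by
  have l1 := ht zero_lt_one
  have l2 := ht one_lt_two
  have l3 : t 2 < t 3 := ht (by lia)
  have a12 := coeffA_eq_leftWeight ht α (k := 2) (i := 0) (by lia)
  have a13 := coeffA_eq_leftWeight ht α (k := 3) (i := 0) (by lia)
  have c12 := coeffC_eq_rightWeight ht α (k := 2) (i := 0) (by lia)
  have c13 := coeffC_eq_rightWeight ht α (k := 3) (i := 0) (by lia)
  simp only [zero_add] at a12 a13 c12 c13
  have h1 := leftWeight_kerMix_add_nonneg hα0.le zero_le_one le_rfl l3.le l1 l2 l2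
  have h2 := rightWeight_kerMix_nonneg hα0.le zero_le_one le_rfl l3.le l1 l2 l2
  have h3 := rightWeight_kerMix_nonneg hα0.le le_rfl zero_le_one (le_refl (t 2)) l1 l2 l2
  rw [leftWeight_kerMix l1.le l2 (l2.trans l3),
    ← a12, ← a13] at h1
  rw [rightWeight_kerMix l1.le l2 (l2.trans l3),
    ← c12, ← c13] at h2
  rw [rightWeight_kerMix l1.le l2 l2, ← c12] at h3
  simp only [kerMix, zero_mul, sub_zero, one_mul] at h1 h2 h3
  have e1 := explicit_row ht hα0 hα1 0
  have e2 : timeStep t 2 = timeStep t 1 * stepRatio t 2 := timeStep_eq_mul_stepRatio ht 0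
  have hτ : 0 < timeStep t 1 := timeStep_pos ht 0
  have hr : 0 < stepRatio t 2 := stepRatio_pos ht 0
  simp only [zero_add] at e1
  rw [← Real.mul_rpow hτ.le hr.le, ← e2, ← e1]
  refine mul_le_mul_of_nonneg_left ?_ (one_sub_mul_two_sub_pos hα1).le
  simp only [matC, coeffD, Matrix.of_apply, Matrix.cons_val_one, Matrix.cons_val',
    Matrix.cons_val_fin_one, Nat.add_one_sub_one]
  linarith

omit hα0 in
theorem matC_zero_one_eq :
    (1 - α) * (2 - α) * matC α t 0 1 = -(timeStep t 1 ^ (-α) * stepRatio t 2 ^ (-α) *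
      (α * stepRatio t 2 ^ 2 / (1 + stepRatio t 2))) := by
  have e1 := coeffA_self_eq ht hα1 0
  have e2 : timeStep t 2 = timeStep t 1 * stepRatio t 2 := timeStep_eq_mul_stepRatio ht 0
  have hτ : 0 < timeStep t 1 := timeStep_pos ht 0
  have hr : 0 < stepRatio t 2 := stepRatio_pos ht 0
  simp only [zero_add] at e1
  rw [← Real.mul_rpow hτ.le hr.le, ← e2, ← e1]
  simp [matC]

/-- Lower bounds for the diagonal and the exact off-diagonal entry share powers of τ₁ and ρ₂; once
these are cancelled, positivity of the determinant follows from `det_bound`. -/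
theorem gHat_pos (hfirst : FirstRatioCond (stepRatio t 2) (stepRatio t 3)) : 0 < gHat α t := by
  obtain ⟨c1, c2, c3, c4⟩ := hfirst
  have hlow := rhoLow_gt
  have hhigh := rhoHigh_lt
  obtain ⟨d1, d2⟩ := det_bound hα0 hα1 (by linarith) (by linarith) (by linarith) c4
  have hf := one_sub_mul_two_sub_pos hα1
  have h00 := matC_zero_zero_ge ht hα0 hα1
  have h11 := matC_one_one_ge ht hα0 hα1
  have h01 := matC_zero_one_eq ht hα1
  have hA : 0 < timeStep t 1 ^ (-α) := Real.rpow_pos_of_pos (timeStep_pos ht 0) _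
  have hr : 0 < stepRatio t 2 := stepRatio_pos ht 0
  have hs : 0 < stepRatio t 3 := stepRatio_pos ht 1
  have hR : 0 < stepRatio t 2 ^ (-α) := Real.rpow_pos_of_pos hr _
  have hq := ratioTerm_ge hα0 hα1 hs (by linarith)
  have e4 : stepRatio t 2 ^ (4 - α) = stepRatio t 2 ^ (-α) * stepRatio t 2 ^ 4 := by
    rw [show 4 - α = -α + (4 : ℕ) by push_cast; ring, Real.rpow_add hr, Real.rpow_natCast]
  rw [e4] at d2
  have hQ : 0 < ratioTerm α (stepRatio t 3) + 2 * stepRatio t 2 / (1 + stepRatio t 2) := by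
    have : 0 < 1 / (1 + stepRatio t 3) := by positivity
    have : 0 < 2 * stepRatio t 2 / (1 + stepRatio t 2) := by positivity
    linarith
  have h2 : 0 < 2 - α := by linarith
  have hsymm : matC α t 1 0 = matC α t 0 1 := by simp [matC]
  unfold gHat
  rw [hsymm]
  generalize timeStep t 1 ^ (-α) = A at *
  generalize stepRatio t 2 ^ (-α) = R at *
  generalize ratioTerm α (stepRatio t 3) + 2 * stepRatio t 2 / (1 + stepRatio t 2) = Q at *
  generalize stepRatio t 2 = r at *
  have p00 : 0 < (2 - α) * A * (2 - (1 - α) * R) := by positivity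
  have p11 : 0 < α * (A * R) * Q := by positivity
  have hd := mul_le_mul h00 h11 p11.le (p00.le.trans h00)
  have hd2 : ((1 - α) * (2 - α) * matC α t 0 1) ^ 2 <
      (2 - α) * A * (2 - (1 - α) * R) * (α * (A * R) * Q) := by
    rw [h01]
    calc (-(A * R * (α * r ^ 2 / (1 + r)))) ^ 2
        = α * A ^ 2 * R * (α * (R * r ^ 4 / (1 + r) ^ 2)) := by
          field_simp
      _ < α * A ^ 2 * R * ((2 - α) * (2 - (1 - α) * R) * Q) := by
          apply mul_lt_mul_of_pos_left d2; positivity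
      _ = _ := by ring
  refine smaller_eigenvalue_pos (pos_of_mul_pos_right (p00.trans_le h00) hf.le)
    (pos_of_mul_pos_right (p11.trans_le h11) hf.le) ?_
  have hd3 := hd2.trans_le hd
  rw [show (1 - α) * (2 - α) * matC α t 0 0 * ((1 - α) * (2 - α) * matC α t 1 1) =
    ((1 - α) * (2 - α)) ^ 2 * (matC α t 0 0 * matC α t 1 1) by ring, mul_pow] at hd3
  exact lt_of_mul_lt_mul_left hd3 (by positivity)

omit ht hα0 hα1 in
theorem gHat_mul_le (x y : ℝ) :
    gHat α t * (x ^ 2 + y ^ 2) ≤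
      (diagCoeff α t 1 - histCoeff α t 2 1) * x ^ 2 - 2 * coeffA α t 2 2 * x * y
        + (diagCoeff α t 2 - histCoeff α t 2 1 - (histCoeff α t 3 2 - histCoeff α t 3 1)
          - coeffA α t 3 3) * y ^ 2 := by
  have h := smaller_eigenvalue_mul_le (matC α t 0 0) (matC α t 1 1) (matC α t 0 1) x y
  have hsymm : matC α t 1 0 = matC α t 0 1 := by simp [matC]
  unfold gHat
  rw [hsymm]
  refine h.trans_eq ?_
  simp [matC, diagCoeff, histCoeff]
  ring

theorem coeffA_self_nonneg (k : ℕ) (hk : 2 ≤ k) : 0 ≤ coeffA α t k k := by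
  obtain ⟨i, rfl⟩ := Nat.exists_eq_add_of_le' hk
  have h := coeffA_self_eq ht hα1 i
  have hr := stepRatio_pos ht i
  have hτ : 0 < timeStep t (i + 2) := timeStep_pos ht (i + 1)
  refine nonneg_of_mul_nonneg_right (?_ : 0 ≤ (1 - α) * (2 - α) * _) (one_sub_mul_two_sub_pos hα1)
  rw [h]
  positivity

omit ht hα0 hα1 in
theorem stepRatio_ge (hfirst : FirstRatioCond (stepRatio t 2) (stepRatio t 3))
    (hratio : ∀ k : ℕ, 3 ≤ k → RatioCond (stepRatio t k) (stepRatio t (k + 1))) (i : ℕ) :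
    0.3563 ≤ stepRatio t (i + 2) := by
  have := rhoLow_gt
  rcases i with _ | i
  · linarith [hfirst.1]
  · have := (hratio (i + 3) (by lia)).left_gt
    rw [show i + 1 + 2 = i + 3 by lia]
    linarith

theorem gWeight_pos (hfirst : FirstRatioCond (stepRatio t 2) (stepRatio t 3))
    (hratio : ∀ k : ℕ, 3 ≤ k → RatioCond (stepRatio t k) (stepRatio t (k + 1)))
    {n k : ℕ} (hk : k ≤ n) : 0 < gWeight α t n k := by
  rcases le_or_gt k 2 with h | h
  · unfold gWeight
    rw [if_pos h]
    have := one_sub_mul_two_sub_pos hα1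
    have := gHat_pos ht hα0 hα1 hfirst
    rw [mul_comm (2 - α)]
    positivity
  · obtain ⟨i, rfl⟩ := Nat.exists_eq_add_of_le' h
    exact gWeight_pos_of_ratioCond ht hα0 hα1 hratio hk

/-! ### Assembly for a real sequence -/

/-- The weighted sum of squared increments is bounded by the quadratic form. -/
theorem sum_gWeight_mul_sq_le_lowerForm (hfirst : FirstRatioCond (stepRatio t 2) (stepRatio t 3))
    (hratio : ∀ k : ℕ, 3 ≤ k → RatioCond (stepRatio t k) (stepRatio t (k + 1)))
    (v : ℕ → ℝ) (n : ℕ) :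
    ∑ k ∈ Finset.range (n + 2), gWeight α t (n + 2) (k + 1) * (v (k + 1) - v k) ^ 2 ≤
      (1 - α) * (2 - α) *
        lowerForm (histCoeff α t) (diagCoeff α t) (fun k => coeffA α t k k) v (n + 1) := by
  have hρ := stepRatio_ge hfirst hratio
  -- The default value at index 0 removes the boundary term of the Abel summation and makes S k 1
  -- itself the first increment.
  have hS0 : ∀ k, histCoeff α t k 0 = 0 := fun k => by simp [histCoeff]
  have hf := one_sub_mul_two_sub_pos hα1
  have g12 : ∀ m k, k ≤ 2 → gWeight α t m k = (1 - α) * (2 - α) * gHat α t := fun m k hk => by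
    unfold gWeight
    rw [if_pos hk, mul_comm (2 - α)]
  have hb := mul_le_mul_of_nonneg_left (gHat_mul_le (α := α) (t := t) (v 1 - v 0) (v 2 - v 1)) hf.le
  have hinc : ∀ k i, i + 1 < k → 0 ≤ histCoeff α t k (i + 1) - histCoeff α t k i := fun k i h =>
    sub_nonneg.2 (histCoeff_incr_nonneg ht hα0 hρ h)
  have hanti : ∀ k i, i + 1 < k → histCoeff α t (k + 1) (i + 1) - histCoeff α t (k + 1) i ≤
      histCoeff α t k (i + 1) - histCoeff α t k i := fun k i h =>
    histCoeff_incr_anti ht hα0 hρ h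
  have ha := coeffA_self_nonneg ht hα0 hα1
  -- The cases have n + 2 time steps: with two there is only the 2 × 2 block, with three the third
  -- row is last, and with four or more it is an inner row.
  match n with
  | 0 =>
    rw [lowerForm_one hS0]
    have h1 := incrForm_nonneg (S := histCoeff α t 2) (v := v) 1 (fun i hi => by
      have := hinc 2 i (by simp at hi; lia); linarith)
    have h2 := mul_nonneg (hinc 3 1 (by lia)) (sq_nonneg (v 2 - v 1))
    have h3 := mul_nonneg (ha 3 (by lia)) (sq_nonneg (v 2 - v 1))
    simp only [Finset.sum_range_succ, Finset.sum_range_zero, zero_add, Nat.reduceAdd]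
    rw [g12 2 1 (by lia), g12 2 2 le_rfl]
    have h4 := mul_nonneg hf.le (add_nonneg h1 (add_nonneg h2 h3))
    linarith
  | 1 =>
    refine le_trans ?_ (mul_le_mul_of_nonneg_left (lowerForm_two_ge hS0 (ha 3 (by lia))) hf.le)
    have h1 : histCoeff α t 3 1 * (v 3 - v 0) ^ 2 ≤ incrForm (histCoeff α t 3) v 2 := by
      unfold incrForm
      simp only [Finset.sum_range_succ, Finset.sum_range_zero, zero_add, hS0, sub_zero,
        Nat.reduceAdd]
      linarith [mul_nonneg (hinc 3 1 (by lia)) (sq_nonneg (v 3 - v 1))]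
    have h2 := third_lastRow_ge ht hα0 hα1 (hρ 0) v
    simp only [Finset.sum_range_succ, Finset.sum_range_zero, zero_add, Nat.reduceAdd]
    rw [g12 3 1 (by lia), g12 3 2 le_rfl]
    have h4 := mul_le_mul_of_nonneg_left h1 hf.le
    linarith
  | n + 2 =>
    refine le_trans ?_ (mul_le_mul_of_nonneg_left (lowerForm_ge hS0 n ha
      (fun k i _ h => hanti k i h)) hf.le)
    have h1 := incrForm_nonneg (S := histCoeff α t (n + 4)) (v := v) (n + 3) (fun i hi => by
      have := hinc (n + 4) i (by simp at hi; lia); linarith)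
    have h2 := third_innerRow_ge ht hα0 hα1 (hρ 0) (n := n + 4) (by lia) v
    have h3 : ∑ i ∈ Finset.range n, gWeight α t (n + 4) (i + 4) * (v (i + 4) - v (i + 3)) ^ 2 ≤
        (1 - α) * (2 - α) * ∑ i ∈ Finset.range n, innerRow (histCoeff α t) (diagCoeff α t)
          (fun k => coeffA α t k k) (i + 4) * (v (i + 4) - v (i + 3)) ^ 2 := by
      rw [Finset.mul_sum]
      refine Finset.sum_le_sum fun i hi => ?_
      rw [← mul_assoc]
      exact mul_le_mul_of_nonneg_right (gWeight_le_innerRow ht hα0 hα1 hratio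
        (by simp at hi; lia)) (sq_nonneg _)
    have h5 := mul_le_mul_of_nonneg_right (gWeight_le_lastRow ht hα0 hα1 hratio n)
      (sq_nonneg (v (n + 4) - v (n + 3)))
    rw [Finset.sum_range_succ' _ n]
    rw [show n + 2 + 2 = n + 4 by lia, Finset.sum_range_succ, Finset.sum_range_succ',
      Finset.sum_range_succ', Finset.sum_range_succ']
    simp only [zero_add, Nat.reduceAdd, add_assoc] at h3 ⊢
    rw [g12 _ 1 (by lia), g12 _ 2 le_rfl]
    have h6 := mul_nonneg hf.le h1
    linarith

end

/-! ### Gamma factors, integrability and integration over Ω -/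

theorem sum_Icc_one_eq_sum_range (f : ℕ → ℝ) (n : ℕ) :
    ∑ k ∈ Finset.Icc 1 n, f k = ∑ k ∈ Finset.range n, f (k + 1) := by
  rw [Finset.range_eq_Ico, Finset.sum_Ico_add' f 0 n 1]
  congr 1

section
variable {α : ℝ} (hα1 : α < 1)
include hα1

theorem gamma_two_sub_eq : Real.Gamma (2 - α) = (1 - α) * Real.Gamma (1 - α) := by
  rw [← Real.Gamma_add_one (by linarith)]
  congr 1; ring

theorem gamma_three_sub_eq :
    Real.Gamma (3 - α) = (1 - α) * (2 - α) * Real.Gamma (1 - α) := by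
  rw [show 3 - α = (2 - α) + 1 by ring, Real.Gamma_add_one (by linarith), gamma_two_sub_eq hα1]
  ring

variable {t : ℕ → ℝ} (ht : StrictMono t)
include ht

theorem fracL2_one (v : ℕ → ℝ) :
    2 * Real.Gamma (1 - α) * fracL2 α t v 1 = diagCoeff α t 1 * (v 1 - v 0) := by
  have hG : Real.Gamma (1 - α) ≠ 0 := (Real.Gamma_pos_of_pos (by linarith)).ne'
  have hτ : 0 < timeStep t 1 := timeStep_pos ht 0
  have h1 : 1 - α ≠ 0 := by linarith
  have h2 := (Real.rpow_pos_of_pos hτ α).ne'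
  unfold fracL2 diagCoeff
  rw [if_pos rfl, if_pos rfl, gamma_two_sub_eq hα1, Real.rpow_neg hτ.le]
  field_simp

theorem two_gamma_mul_sum_fracL2 (v : ℕ → ℝ) (m : ℕ) :
    2 * Real.Gamma (1 - α) *
        ∑ k ∈ Finset.range (m + 1), fracL2 α t v (k + 1) * (v (k + 1) - v k) =
      lowerForm (histCoeff α t) (diagCoeff α t) (fun k => coeffA α t k k) v m := by
  rw [Finset.sum_range_succ', mul_add, Finset.mul_sum, ← mul_assoc _ (fracL2 α t v (0 + 1)),
    zero_add, fracL2_one hα1 ht, lowerForm, add_comm]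
  congr 1
  · ring
  · refine Finset.sum_congr rfl fun i _ => ?_
    have h := gamma_mul_fracL2 hα1 ht v i
    have e : diagCoeff α t (i + 2) / 2 = coeffC α t (i + 2) (i + 2) + coeffC α t (i + 2) (i + 1) := by
      unfold diagCoeff
      rw [if_neg (by lia), show i + 2 - 1 = i + 1 by lia]
      ring
    rw [e, ← h]
    ring

theorem memLp_fracL2 {X : Type*} [MeasurableSpace X] {μ : Measure X} {w : ℕ → X → ℝ} {n : ℕ}
    (hw : ∀ k ≤ n, MemLp (w k) 2 μ) {k : ℕ} (hk : k + 1 ≤ n) :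
    MemLp (fun x => fracL2 α t (fun i => w i x) (k + 1)) 2 μ := by
  have hG : Real.Gamma (1 - α) ≠ 0 := (Real.Gamma_pos_of_pos (by linarith)).ne'
  have hd : ∀ i, i + 1 ≤ n → MemLp (fun x => w (i + 1) x - w i x) 2 μ := fun i hi =>
    (hw (i + 1) hi).sub (hw i (by lia))
  match k with
  | 0 =>
    have e : ∀ x, fracL2 α t (fun i => w i x) (0 + 1) =
        (2 * Real.Gamma (1 - α))⁻¹ * diagCoeff α t 1 * (w 1 x - w 0 x) := fun x => by
      rw [mul_assoc, ← fracL2_one hα1 ht (fun i => w i x), inv_mul_cancel_left₀ (by simpa using hG)]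
    simp only [e]
    exact (hd 0 (by lia)).const_mul _
  | m + 1 =>
    have e : ∀ x, fracL2 α t (fun i => w i x) (m + 1 + 1) = (Real.Gamma (1 - α))⁻¹ *
        ((coeffC α t (m + 2) (m + 2) + coeffC α t (m + 2) (m + 1)) * (w (m + 2) x - w (m + 1) x)
        - coeffA α t (m + 2) (m + 2) * (w (m + 1) x - w m x)
        + ∑ i ∈ Finset.range (m + 1),
          histCoeff α t (m + 2) (i + 1) * (w (i + 1) x - w i x)) := fun x => by
      rw [← gamma_mul_fracL2 hα1 ht (fun i => w i x), inv_mul_cancel_left₀ hG]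
    simp only [e]
    have h1 := (hd (m + 1) (by lia)).const_mul
      (coeffC α t (m + 2) (m + 2) + coeffC α t (m + 2) (m + 1))
    have h2 := (hd m (by lia)).const_mul (coeffA α t (m + 2) (m + 2))
    have h3 : MemLp (fun x => ∑ i ∈ Finset.range (m + 1),
        histCoeff α t (m + 2) (i + 1) * (w (i + 1) x - w i x)) 2 μ :=
      memLp_finsetSum _ fun i hi => (hd i (by simp at hi; lia)).const_mul _
    exact ((h1.sub h2).add h3).const_mul _

end

theorem theorem3p2 (α : ℝ) (hα0 : 0 < α) (hα1 : α < 1)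
    (t : ℕ → ℝ) (ht0 : t 0 = 0) (ht : StrictMono t)
    (hfirst : FirstRatioCond (stepRatio t 2) (stepRatio t 3))
    (hratio : ∀ k : ℕ, 3 ≤ k → RatioCond (stepRatio t k) (stepRatio t (k + 1)))
    (n : ℕ) (hn : 2 ≤ n) :
    (∀ k ∈ Finset.Icc 1 n, 0 < gWeight α t n k) ∧
    ∀ (d : ℕ) (Ω : Set (EuclideanSpace ℝ (Fin d))), MeasurableSet Ω →
      ∀ u : ℝ → EuclideanSpace ℝ (Fin d) → ℝ,
        (∀ k ≤ n, MemLp (u (t k)) 2 (volume.restrict Ω)) →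
        (∑ k ∈ Finset.Icc 1 n, gWeight α t n k / (2 * Real.Gamma (3 - α)) *
            ∫ x in Ω, (u (t k) x - u (t (k - 1)) x) ^ 2) ≤ bilinB α t Ω n u u ∧
        0 ≤ ∑ k ∈ Finset.Icc 1 n, gWeight α t n k / (2 * Real.Gamma (3 - α)) *
            ∫ x in Ω, (u (t k) x - u (t (k - 1)) x) ^ 2 := by
  have hpos : ∀ k ∈ Finset.Icc 1 n, 0 < gWeight α t n k := fun k hk =>
    gWeight_pos ht hα0 hα1 hfirst hratio (Finset.mem_Icc.1 hk).2
  have hG3 : 0 < Real.Gamma (3 - α) := Real.Gamma_pos_of_pos (by linarith)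
  refine ⟨hpos, fun d Ω _ u hu => ⟨?_, Finset.sum_nonneg fun k hk => ?_⟩⟩
  · obtain ⟨m, rfl⟩ := Nat.exists_eq_add_of_le' hn
    have hd : ∀ i ∈ Finset.range (m + 2),
        MemLp (fun x => u (t (i + 1)) x - u (t i) x) 2 (volume.restrict Ω) := fun i hi =>
      (hu (i + 1) (by simp at hi; lia)).sub (hu i (by simp at hi; lia))
    have hL : ∀ i ∈ Finset.range (m + 2), MemLp
        (fun x => fracL2 α t (fun j => u (t j) x) (i + 1)) 2 (volume.restrict Ω) := fun i hi =>
      memLp_fracL2 hα1 ht (w := fun j => u (t j)) hu (by simp at hi; lia)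
    have hI : ∀ i ∈ Finset.range (m + 2), Integrable (fun x => fracL2 α t (fun j => u (t j) x) (i + 1)
        * (u (t (i + 1)) x - u (t i) x)) (volume.restrict Ω) := fun i hi =>
      (hL i hi).integrable_mul (hd i hi)
    unfold bilinB
    rw [sum_Icc_one_eq_sum_range, sum_Icc_one_eq_sum_range]
    simp only [Nat.add_sub_cancel, ← integral_const_mul]
    rw [← integral_finsetSum _ fun i hi => ((hd i hi).integrable_sq).const_mul _,
      ← integral_finsetSum _ hI]
    refine integral_mono
      (integrable_finsetSum _ fun i hi => ((hd i hi).integrable_sq).const_mul _)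
      (integrable_finsetSum _ hI) fun x => ?_
    have h := sum_gWeight_mul_sq_le_lowerForm ht hα0 hα1 hfirst hratio (fun j => u (t j) x) m
    rw [← two_gamma_mul_sum_fracL2 hα1 ht, ← mul_assoc] at h
    simp only [div_mul_eq_mul_div, ← Finset.sum_div]
    rw [div_le_iff₀ (by positivity), gamma_three_sub_eq hα1]
    refine h.trans_eq ?_
    ring
  · exact mul_nonneg (div_nonneg (hpos k hk).le (by positivity))
      (integral_nonneg fun x => sq_nonneg _)
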